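/- **Theorem 5.4** (combinatorial CLT for general i.i.d. sequences). Let $\mathbb N=\{0,1,2,\dots\}$ and $q\ge 1$. Let $K$ be a (finite or infinite) symmetric set of $q$-tuples $(i_1,\dots,i_q)\in\mathbb N^q$ with pairwise distinct entries (symmetric: closed under permuting the entries), let $(b_k)_{k\ge 0}$ be a sequence of real numbers, let $\mu_b=\sum_{k\ge 0}b_k^2\,\delta_k$ on $\mathbb N$, so that $\mu_b^{\otimes q}(A)=\sum_{(i_1,\dots,i_q)\in A}b_{i_1}^2\cdots b_{i_q}^2$ for $A\subset\mathbb N^q$, and assume $0<\mu_b^{\otimes q}(K)<\infty$. Let $(X_k)_{k\ge 0}$ be i.i.d. real random variables with $E[X_1]=0$ and $0<E[X_1^2]<\infty$, and put $$S^{(b)}(K)=\frac{1}{\big(q!\,\mu_b^{\otimes q}(K)\,(E[X_1^2])^q\big)^{1/2}}\sum_{(i_1,\dots,i_q)\in K}b_{i_1}\cdots b_{i_q}X_{i_1}\cdots X_{i_q},$$ where the sum converges in $L^2$ (unconditionally, i.e. along the finite subsets of $K$). Let $K^*_j$ be the set of all tuples in $K$ having $j$ among their entries, and let $K^\#\subset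 K\times K$ be the set of all pairs $\big((i_1,\dots,i_q),(j_1,\dots,j_q)\big)$ of tuples of $K$ such that $\{i_1,\dots,i_q\}\cap\{j_1,\dots,j_q\}=\emptyset$ and there are $(k_1,\dots,k_q),(l_1,\dots,l_q)\in K$ with $\{k_1,\dots,k_q\}\cup\{l_1,\dots,l_q\}=\{i_1,\dots,i_q\}\cup\{j_1,\dots,j_q\}$, $\{k_1,\dots,k_q\}\ne\{i_1,\dots,i_q\}$ and $\{k_1,\dots,k_q\}\ne\{j_1,\dots,j_q\}$. Then there is a finite constant $C=C(q)$, depending only on $q$, such that $$d_W\big(S^{(b)}(K),\mathcal N\big)\le C\left(\frac{E[X_1^4]}{(E[X_1^2])^2}\right)^{q}\left[\frac{\big(\mu_b^{\otimes 2q}(K^\#)\big)^{1/2}}{\mu_b^{\otimes q}(K)}+\Big(\sup_{j\ge 0}\frac{\mu_b^{\otimes q}(K^*_j)}{\mu_b^{\otimes q}(K)}\Big)^{1/4}\right],$$ where $\mathcal N$ is the standard normal law and $d_W(X,Y)=\sup_h|E[h(X)]-E[h(Y)]|$, the supremum being over all $h:\mathbb R\to\mathbb R$ with Lipschitz constant at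 most $1$ (if $E[X_1^4]=\infty$ the right-hand side is $+\infty$). -/

import Mathlib

open MeasureTheory ProbabilityTheory Filter Topology
open scoped NNReal ENNReal

noncomputable section

namespace CombCLT

/-- The Wasserstein distance between two laws on the real line: the supremum of
`|∫ h dμ - ∫ h dν|` over all real functions `h` with Lipschitz constant at most `1`,
as an extended nonnegative number. (A Lipschitz function is integrable for every probability
measure with a finite first moment.) -/
def wassersteinDist (μ ν : Measure ℝ) : ℝ≥0∞ :=
  ⨆ (h : ℝ → ℝ) (_ : LipschitzWith 1 h), ENNReal.ofReal |(∫ x, h x ∂μ) - ∫ x, h x ∂ν|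

/-- The measure `μ_b = ∑ₖ bₖ² δₖ` on `ℕ`, written as a density for the counting measure. -/
def weightMeasure (b : ℕ → ℝ) : Measure ℕ :=
  Measure.count.withDensity fun k => ENNReal.ofReal (b k ^ 2)

instance weightMeasure_sigmaFinite (b : ℕ → ℝ) : SigmaFinite (weightMeasure b) :=
  SigmaFinite.withDensity_ofReal _

/-- The product measure `μ_b^{⊗q}` on `ℕ^q`. -/
def weightPow (b : ℕ → ℝ) (q : ℕ) : Measure (Fin q → ℕ) :=
  Measure.pi fun _ => weightMeasure b

/-- The product measure `μ_b^{⊗2q}`, on `ℕ^q × ℕ^q`. -/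
def weightPowPair (b : ℕ → ℝ) (q : ℕ) : Measure ((Fin q → ℕ) × (Fin q → ℕ)) :=
  (weightPow b q).prod (weightPow b q)

/-- `K` is a symmetric set of `q`-tuples with pairwise distinct entries. -/
structure IsSymmetricOffDiagonal {q : ℕ} (K : Set (Fin q → ℕ)) : Prop where
  injective : ∀ i ∈ K, Function.Injective i
  symmetric : ∀ i ∈ K, ∀ σ : Equiv.Perm (Fin q), i ∘ σ ∈ K

/-- `K*_j`: the tuples of `K` that have `j` among their entries. -/
def star {q : ℕ} (K : Set (Fin q → ℕ)) (j : ℕ) : Set (Fin q → ℕ) :=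
  {i | i ∈ K ∧ ∃ k, i k = j}

/-- `K^#`: the pairs `(i, j)` of tuples of `K` without common entries, for which there are
`k, l ∈ K` with `{k} ∪ {l} = {i} ∪ {j}` where `k` coincides neither with `i` nor with `j`,
as sets of entries (that is, up to the order of the entries). -/
def sharp {q : ℕ} (K : Set (Fin q → ℕ)) : Set ((Fin q → ℕ) × (Fin q → ℕ)) :=
  {p | p.1 ∈ K ∧ p.2 ∈ K ∧ Disjoint (Set.range p.1) (Set.range p.2) ∧
    ∃ k ∈ K, ∃ l ∈ K, Set.range k ∪ Set.range l = Set.range p.1 ∪ Set.range p.2 ∧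
      Set.range k ≠ Set.range p.1 ∧ Set.range k ≠ Set.range p.2}

variable {Ω : Type*} [MeasurableSpace Ω]

/-- The normalizing factor `(q! μ_b^{⊗q}(K) (E[X₁²])^q)^{-1/2}`. -/
def normFactor (P : Measure Ω) (X : ℕ → Ω → ℝ) (b : ℕ → ℝ) {q : ℕ} (K : Set (Fin q → ℕ)) : ℝ :=
  1 / Real.sqrt (q.factorial * (weightPow b q K).toReal * (∫ ω, X 1 ω ^ 2 ∂P) ^ q)

/-- `S` is the normalized homogeneous sum
`S^{(b)}(K) = (q! μ_b^{⊗q}(K) (E[X₁²])^q)^{-1/2} ∑_{i ∈ K} b_{i_1} ⋯ b_{i_q} X_{i_1} ⋯ X_{i_q}`,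
the (possibly infinite) sum being the limit in `L²(P)` of the finite partial sums, regardless of
the order of summation. For finite `K` this determines `S` as the finite sum almost surely. -/
def IsHomogeneousSum (P : Measure Ω) (X : ℕ → Ω → ℝ) (b : ℕ → ℝ) {q : ℕ}
    (K : Set (Fin q → ℕ)) (S : Ω → ℝ) : Prop :=
  MemLp S 2 P ∧
    Tendsto (fun F : Finset K => eLpNorm
      (fun ω => S ω - normFactor P X b K * ∑ i ∈ F, ∏ k, b (i.1 k) * X (i.1 k) ω) 2 P)
      atTop (𝓝 0)

end CombCLT

end

/-!
For a multilinear polynomial `F = ∑_A c_A ∏_{k ∈ A} X_k` of degree `q` with `∑_A c_A² = 1` in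
independent standardized variables, Stein's equation is tested on `F = ∑_k X_k D_k / q`, where `D_k`
is the partial derivative of `F` in `X_k`. Splitting off the contribution of `X_k` to `F` and Taylor
expanding bounds the distance from `F` to the normal law by `E|∑_k D_k² / q - 1|` and `E|D_k|³`. By
hypercontractivity the latter is controlled by the influences, which are the masses of `K*_k`.
The square of `∑_k D_k² - q` is a sum over quadruples of index sets that share their symmetric
differences; the quadruples made of disjoint pairs produce `K^#`, all others again an influence.
An infinite `K` is exhausted by the tuples with entries below `n`, along which the sums converge
in `L²`.
-/

namespace CombCLT

/-! ### Integrals of real functions -/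

section Integral

variable {Ω : Type*} [MeasurableSpace Ω] {P : Measure Ω} {f g : Ω → ℝ}

lemma integrable_of_abs_le (hg : Integrable g P) (hf : Measurable f) (h : ∀ ω, |f ω| ≤ g ω) :
    Integrable f P :=
  hg.mono' hf.aestronglyMeasurable (ae_of_all _ h)

lemma abs_pow_le_one_add_pow_four (x : ℝ) {n : ℕ} (hn : n ≤ 4) : |x ^ n| ≤ 1 + x ^ 4 := by
  rw [abs_pow, ← Even.pow_abs (by decide) x]
  rcases le_total |x| 1 with h | h
  · exact (pow_le_one₀ (abs_nonneg x) h).trans (le_add_of_nonneg_right (by positivity))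
  · exact (pow_le_pow_right₀ h hn).trans (le_add_of_nonneg_left zero_le_one)

lemma integrable_pow_of_pow_four [IsFiniteMeasure P] (hf : Measurable f)
    (h : Integrable (fun ω => f ω ^ 4) P) {n : ℕ} (hn : n ≤ 4) : Integrable (fun ω => f ω ^ n) P :=
  integrable_of_abs_le ((integrable_const 1).add h) (hf.pow_const n)
    fun ω => abs_pow_le_one_add_pow_four (f ω) hn

lemma abs_pow_mul_pow_le_pow_four (x y : ℝ) {m n : ℕ} (h : m + n ≤ 4) :
    |x ^ m * y ^ n| ≤ 1 + x ^ 4 + y ^ 4 := by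
  set z := max |x| |y| with hz
  have hz0 : 0 ≤ z := (abs_nonneg x).trans (le_max_left _ _)
  calc |x ^ m * y ^ n| = |x| ^ m * |y| ^ n := by rw [abs_mul, abs_pow, abs_pow]
    _ ≤ z ^ m * z ^ n := by gcongr <;> simp [hz]
    _ = |z ^ (m + n)| := by rw [← pow_add, abs_of_nonneg (pow_nonneg hz0 _)]
    _ ≤ 1 + z ^ 4 := abs_pow_le_one_add_pow_four _ h
    _ ≤ 1 + (x ^ 4 + y ^ 4) := by
        gcongr
        rcases max_choice |x| |y| with e | e <;> rw [hz, e, Even.pow_abs (by decide)]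
        · exact le_add_of_nonneg_right (by positivity)
        · exact le_add_of_nonneg_left (by positivity)
    _ = 1 + x ^ 4 + y ^ 4 := (add_assoc _ _ _).symm

lemma integrable_pow_mul_pow [IsFiniteMeasure P] (hf : Measurable f) (hg : Measurable g)
    (hf4 : Integrable (fun ω => f ω ^ 4) P) (hg4 : Integrable (fun ω => g ω ^ 4) P) {m n : ℕ}
    (h : m + n ≤ 4) : Integrable (fun ω => f ω ^ m * g ω ^ n) P :=
  integrable_of_abs_le (((integrable_const 1).add hf4).add hg4)
    ((hf.pow_const m).mul (hg.pow_const n)) fun ω => abs_pow_mul_pow_le_pow_four (f ω) (g ω) h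

lemma sq_integral_mul_le (hf : Integrable (fun ω => f ω ^ 2) P)
    (hg : Integrable (fun ω => g ω ^ 2) P) (hfg : Integrable (fun ω => f ω * g ω) P) :
    (∫ ω, f ω * g ω ∂P) ^ 2 ≤ (∫ ω, f ω ^ 2 ∂P) * ∫ ω, g ω ^ 2 ∂P := by
  have quadratic_nonneg : ∀ t : ℝ, 0 ≤ (∫ ω, f ω ^ 2 ∂P) * (t * t)
      + (2 * ∫ ω, f ω * g ω ∂P) * t + ∫ ω, g ω ^ 2 ∂P := fun t => by
    have h : 0 ≤ ∫ ω, (t ^ 2 * f ω ^ 2 + 2 * t * (f ω * g ω) + g ω ^ 2) ∂P :=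
      integral_nonneg fun ω => by
        simpa only [Pi.zero_apply, add_sq, mul_pow, mul_assoc] using sq_nonneg (t * f ω + g ω)
    have hi : Integrable (fun ω => t ^ 2 * f ω ^ 2 + 2 * t * (f ω * g ω)) P :=
      (hf.const_mul _).add (hfg.const_mul _)
    rw [integral_add hi hg, integral_add (hf.const_mul _) (hfg.const_mul _), integral_const_mul,
      integral_const_mul] at h
    linarith
  have := discrim_le_zero quadratic_nonneg
  rw [discrim] at this
  linarith

lemma integral_abs_le_sqrt_integral_sq [IsProbabilityMeasure P] (hf : Integrable f P)
    (hf2 : Integrable (fun ω => f ω ^ 2) P) : ∫ ω, |f ω| ∂P ≤ √(∫ ω, f ω ^ 2 ∂P) := by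
  have h := sq_integral_mul_le (P := P) (f := fun ω => |f ω|) (g := fun _ => 1)
    (by simpa only [sq_abs] using hf2) (integrable_const _) (by simpa using hf.abs)
  simp only [sq_abs, mul_one, one_pow, integral_const, probReal_univ, one_smul] at h
  exact Real.le_sqrt_of_sq_le h

lemma integral_abs_cube_le [IsFiniteMeasure P] (hf : Measurable f)
    (hf4 : Integrable (fun ω => f ω ^ 4) P) {s : ℝ} (hs : 0 < s) :
    ∫ ω, |f ω| ^ 3 ∂P ≤ (s * ∫ ω, f ω ^ 2 ∂P + s⁻¹ * ∫ ω, f ω ^ 4 ∂P) / 2 := by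
  have hf2 := integrable_pow_of_pow_four hf hf4 (n := 2) (by decide)
  have young : ∀ x : ℝ, |x| ^ 3 ≤ (s * x ^ 2 + s⁻¹ * x ^ 4) / 2 := fun x => by
    have gap : (s * |x| ^ 2 + s⁻¹ * |x| ^ 4) / 2 - |x| ^ 3
        = s⁻¹ / 2 * (|x| ^ 2 * (s - |x|) ^ 2) := by
      field_simp
      ring
    have gap_nonneg : 0 ≤ s⁻¹ / 2 * (x ^ 2 * (s - |x|) ^ 2) := by positivity
    rw [Even.pow_abs (by decide), Even.pow_abs (by decide)] at gap
    linarith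
  calc ∫ ω, |f ω| ^ 3 ∂P ≤ ∫ ω, (s * f ω ^ 2 + s⁻¹ * f ω ^ 4) / 2 ∂P :=
        integral_mono_of_nonneg (ae_of_all _ fun ω => by positivity)
          (((hf2.const_mul s).add (hf4.const_mul s⁻¹)).div_const 2) (ae_of_all _ fun ω => young _)
    _ = (s * ∫ ω, f ω ^ 2 ∂P + s⁻¹ * ∫ ω, f ω ^ 4 ∂P) / 2 := by
        rw [integral_div, integral_add (hf2.const_mul s) (hf4.const_mul s⁻¹), integral_const_mul,
          integral_const_mul]

lemma integrable_comp_of_lipschitz {E F : Type*} [NormedAddCommGroup E] [NormedAddCommGroup F]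
    [IsFiniteMeasure P] {K : ℝ≥0} {h : E → F} (hh : LipschitzWith K h) {Y : Ω → E}
    (hY : Integrable Y P) : Integrable (fun ω => h (Y ω)) P := by
  have h0 : Integrable (fun ω => h (Y ω) - h 0) P := memLp_one_iff_integrable.1 <|
    (hh.sub (LipschitzWith.const (h 0))).comp_memLp (sub_self _) (memLp_one_iff_integrable.2 hY)
  exact (h0.add (integrable_const (h 0))).congr (ae_of_all _ fun ω => sub_add_cancel _ _)

lemma abs_sub_le_of_lipschitz {h : ℝ → ℝ} (hh : LipschitzWith 1 h) (x y : ℝ) :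
    |h x - h y| ≤ |x - y| := by
  simpa [Real.dist_eq] using hh.dist_le_mul x y

end Integral

/-! ### Gaussian tails and Stein's equation -/

section Gaussian

/-- The standard normal density `φ`. -/
noncomputable abbrev stdPDF : ℝ → ℝ := gaussianPDFReal 0 1

lemma stdPDF_eq (x : ℝ) : stdPDF x = (√(2 * Real.pi))⁻¹ * Real.exp (-(1 / 2) * x ^ 2) := by
  simp only [stdPDF, gaussianPDFReal, NNReal.coe_one, mul_one, sub_zero]
  congr 2
  ring

lemma stdPDF_pos (x : ℝ) : 0 < stdPDF x := gaussianPDFReal_pos 0 1 x one_ne_zero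

lemma stdPDF_neg (x : ℝ) : stdPDF (-x) = stdPDF x := by
  rw [stdPDF_eq, stdPDF_eq, neg_sq]

lemma hasDerivAt_stdPDF (x : ℝ) : HasDerivAt stdPDF (-(x * stdPDF x)) x := by
  have h := (((hasDerivAt_pow 2 x).const_mul (-(1 / 2) : ℝ)).exp).const_mul (√(2 * Real.pi))⁻¹
  rw [← funext stdPDF_eq] at h
  refine h.congr_deriv ?_
  rw [stdPDF_eq]
  push_cast
  ring

lemma continuous_stdPDF : Continuous stdPDF :=
  continuous_iff_continuousAt.2 fun x => (hasDerivAt_stdPDF x).continuousAt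

lemma integrable_stdPDF : Integrable stdPDF := integrable_gaussianPDFReal 0 1

lemma integrable_pow_mul_stdPDF (n : ℕ) : Integrable fun x => x ^ n * stdPDF x := by
  have hn : (-1 : ℝ) < n := (neg_one_lt_zero).trans_le n.cast_nonneg
  refine ((integrable_rpow_mul_exp_neg_mul_sq one_half_pos hn).const_mul
    (√(2 * Real.pi))⁻¹).congr (ae_of_all _ fun x => ?_)
  simp only [stdPDF_eq, Real.rpow_natCast]
  ring

lemma integrable_id_mul_stdPDF : Integrable fun x => x * stdPDF x := by
  simpa using integrable_pow_mul_stdPDF 1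

/-- The upper tail `1 - Φ` of the standard normal law. -/
noncomputable def stdTail (x : ℝ) : ℝ := ∫ t in Set.Ioi x, stdPDF t

lemma stdTail_nonneg (x : ℝ) : 0 ≤ stdTail x :=
  setIntegral_nonneg measurableSet_Ioi fun t _ => (stdPDF_pos t).le

lemma stdTail_le_one (x : ℝ) : stdTail x ≤ 1 := by
  rw [← integral_gaussianPDFReal_eq_one 0 (one_ne_zero (α := ℝ≥0))]
  exact setIntegral_le_integral integrable_stdPDF (ae_of_all _ fun t => (stdPDF_pos t).le)

lemma integral_Ioi_id_mul_stdPDF (x : ℝ) : ∫ t in Set.Ioi x, t * stdPDF t = stdPDF x := by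
  have hd : ∀ t, HasDerivAt (fun t => - stdPDF t) (t * stdPDF t) t := fun t =>
    (hasDerivAt_stdPDF t).neg.congr_deriv (neg_neg _)
  have h0 := tendsto_zero_of_hasDerivAt_of_integrableOn_Ioi (a := x) (fun t _ => hd t)
    integrable_id_mul_stdPDF.integrableOn integrable_stdPDF.neg.integrableOn
  rw [integral_Ioi_of_hasDerivAt_of_tendsto' (fun t _ => hd t)
    integrable_id_mul_stdPDF.integrableOn h0, zero_sub, neg_neg]

lemma integral_Ioi_sq_mul_stdPDF (x : ℝ) :
    ∫ t in Set.Ioi x, t ^ 2 * stdPDF t = x * stdPDF x + stdTail x := by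
  have hd : ∀ t, HasDerivAt (fun t => -(t * stdPDF t)) (t ^ 2 * stdPDF t - stdPDF t) t :=
    fun t => ((hasDerivAt_id' t).mul (hasDerivAt_stdPDF t)).neg.congr_deriv (by ring)
  have hi : Integrable fun t => t ^ 2 * stdPDF t - stdPDF t :=
    (integrable_pow_mul_stdPDF 2).sub integrable_stdPDF
  have h0 := tendsto_zero_of_hasDerivAt_of_integrableOn_Ioi (a := x) (fun t _ => hd t)
    hi.integrableOn integrable_id_mul_stdPDF.neg.integrableOn
  have h1 := integral_Ioi_of_hasDerivAt_of_tendsto' (a := x) (fun t _ => hd t) hi.integrableOn h0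
  rw [integral_sub (integrable_pow_mul_stdPDF 2).integrableOn integrable_stdPDF.integrableOn] at h1
  rw [stdTail]
  linarith

lemma mul_stdTail_le (x : ℝ) : x * stdTail x ≤ stdPDF x := by
  rw [← integral_Ioi_id_mul_stdPDF, stdTail, ← integral_const_mul]
  exact setIntegral_mono_on (integrable_stdPDF.const_mul x).integrableOn
    integrable_id_mul_stdPDF.integrableOn measurableSet_Ioi
    fun t ht => mul_le_mul_of_nonneg_right (le_of_lt ht) (stdPDF_pos t).le

lemma mul_stdPDF_le (x : ℝ) : x * stdPDF x ≤ (1 + x ^ 2) * stdTail x := by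
  have h : 0 ≤ ∫ t in Set.Ioi x, (t - x) ^ 2 * stdPDF t :=
    setIntegral_nonneg measurableSet_Ioi fun t _ => by have := stdPDF_pos t; positivity
  have expand : ∀ t, (t - x) ^ 2 * stdPDF t
      = t ^ 2 * stdPDF t - 2 * x * (t * stdPDF t) + x ^ 2 * stdPDF t := fun t => by ring
  have i1 := (integrable_pow_mul_stdPDF 2).integrableOn (s := Set.Ioi x)
  have i2 := (integrable_id_mul_stdPDF.const_mul (2 * x)).integrableOn (s := Set.Ioi x)
  have i3 := (integrable_stdPDF.const_mul (x ^ 2)).integrableOn (s := Set.Ioi x)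
  have i12 : IntegrableOn (fun t => t ^ 2 * stdPDF t - 2 * x * (t * stdPDF t)) (Set.Ioi x) :=
    i1.sub i2
  simp only [expand] at h
  rw [integral_add i12 i3, integral_sub i1 i2, integral_const_mul, integral_const_mul,
    integral_Ioi_sq_mul_stdPDF, integral_Ioi_id_mul_stdPDF, ← stdTail] at h
  linarith

/-- The Mills ratio `(1 - Φ) / φ`. -/
noncomputable def millsRatio (x : ℝ) : ℝ := stdTail x / stdPDF x

lemma millsRatio_nonneg (x : ℝ) : 0 ≤ millsRatio x :=
  div_nonneg (stdTail_nonneg x) (stdPDF_pos x).le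

lemma mul_millsRatio_le_one (x : ℝ) : x * millsRatio x ≤ 1 := by
  rw [millsRatio, mul_div_assoc', div_le_one (stdPDF_pos x)]
  exact mul_stdTail_le x

lemma le_mul_millsRatio (x : ℝ) : x ≤ (1 + x ^ 2) * millsRatio x := by
  rw [millsRatio, mul_div_assoc', le_div_iff₀ (stdPDF_pos x)]
  exact mul_stdPDF_le x

lemma millsRatio_le {x : ℝ} (hx : 0 ≤ x) : millsRatio x ≤ 1 + (stdPDF 1)⁻¹ := by
  have hp1 := inv_pos.2 (stdPDF_pos 1)
  rcases le_total 1 x with h | h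
  · have := le_mul_of_one_le_left (millsRatio_nonneg x) h
    linarith [mul_millsRatio_le_one x]
  · have stdPDF_one_le : stdPDF 1 ≤ stdPDF x := by
      simp only [stdPDF_eq]
      gcongr _ * Real.exp ?_
      nlinarith
    calc millsRatio x ≤ 1 / stdPDF 1 := by
          rw [millsRatio]
          gcongr
          · exact stdPDF_pos 1
          · exact stdTail_le_one x
      _ ≤ 1 + (stdPDF 1)⁻¹ := by rw [one_div]; linarith

lemma integrable_id_stdGaussian : Integrable (fun x : ℝ => x) (gaussianReal 0 1) :=
  (memLp_id_gaussianReal 1).integrable (by simp)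

lemma integral_stdGaussian (g : ℝ → ℝ) :
    ∫ x, g x ∂gaussianReal 0 1 = ∫ x, g x * stdPDF x := by
  rw [integral_gaussianReal_eq_integral_smul one_ne_zero]
  simp [mul_comm]

lemma integral_sq_stdGaussian : ∫ x, x ^ 2 ∂gaussianReal 0 1 = 1 := by
  have h := variance_id_gaussianReal (μ := 0) (v := 1)
  rw [variance_eq_sub (memLp_id_gaussianReal 2)] at h
  simpa using h

lemma integral_abs_stdGaussian_le : ∫ x, |x| ∂gaussianReal 0 1 ≤ 1 := by
  simpa [integral_sq_stdGaussian] using integral_abs_le_sqrt_integral_sq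
    integrable_id_stdGaussian (memLp_id_gaussianReal (μ := 0) (v := 1) 2).integrable_sq

lemma integral_comp_neg_stdGaussian (h : ℝ → ℝ) :
    ∫ y, h (-y) ∂gaussianReal 0 1 = ∫ y, h y ∂gaussianReal 0 1 := by
  rw [integral_stdGaussian, integral_stdGaussian, ← integral_neg_eq_self]
  simp [stdPDF_neg]

variable {h : ℝ → ℝ}

lemma abs_sub_integral_stdGaussian_le (hh : LipschitzWith 1 h) (x : ℝ) :
    |h x - ∫ y, h y ∂gaussianReal 0 1| ≤ |x| + 1 := by
  have hi := integrable_comp_of_lipschitz hh integrable_id_stdGaussian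
  calc |h x - ∫ y, h y ∂gaussianReal 0 1| = |∫ y, (h x - h y) ∂gaussianReal 0 1| := by
        rw [integral_sub (integrable_const _) hi]; simp
    _ ≤ ∫ y, |h x - h y| ∂gaussianReal 0 1 := abs_integral_le_integral_abs
    _ ≤ ∫ y, (|x| + |y|) ∂gaussianReal 0 1 :=
        integral_mono ((integrable_const _).sub hi).abs
          ((integrable_const _).add integrable_id_stdGaussian.abs)
          fun y => (abs_sub_le_of_lipschitz hh x y).trans (abs_sub x y)
    _ ≤ |x| + 1 := by
        rw [integral_add (integrable_const _) integrable_id_stdGaussian.abs]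
        simpa using integral_abs_stdGaussian_le

/-- The test function centered under the standard normal law, times the normal density. -/
noncomputable def steinIntegrand (h : ℝ → ℝ) (t : ℝ) : ℝ :=
  (h t - ∫ y, h y ∂gaussianReal 0 1) * stdPDF t

/-- The bounded solution of Stein's equation `f' x - x f x = h x - E h(N)`. -/
noncomputable def steinSol (h : ℝ → ℝ) (x : ℝ) : ℝ :=
  -((∫ t in Set.Ioi x, steinIntegrand h t) / stdPDF x)

/-- The derivative of `steinSol h`, read off Stein's equation. -/
noncomputable def steinDeriv (h : ℝ → ℝ) (x : ℝ) : ℝ :=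
  x * steinSol h x + (h x - ∫ y, h y ∂gaussianReal 0 1)

lemma continuous_steinIntegrand (hh : LipschitzWith 1 h) : Continuous (steinIntegrand h) :=
  (hh.continuous.sub continuous_const).mul continuous_stdPDF

lemma abs_steinIntegrand_le (hh : LipschitzWith 1 h) (t : ℝ) :
    |steinIntegrand h t| ≤ (|t| + 1) * stdPDF t := by
  rw [steinIntegrand, abs_mul, abs_of_pos (stdPDF_pos t)]
  exact mul_le_mul_of_nonneg_right (abs_sub_integral_stdGaussian_le hh t) (stdPDF_pos t).le

lemma integrable_steinIntegrand (hh : LipschitzWith 1 h) : Integrable (steinIntegrand h) := by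
  refine integrable_of_abs_le (integrable_id_mul_stdPDF.abs.add integrable_stdPDF)
    (continuous_steinIntegrand hh).measurable fun t => ?_
  rw [Pi.add_apply, abs_mul, abs_of_pos (stdPDF_pos t)]
  linarith [abs_steinIntegrand_le hh t]

lemma integral_steinIntegrand (hh : LipschitzWith 1 h) : ∫ t, steinIntegrand h t = 0 := by
  simp only [steinIntegrand]
  rw [← integral_stdGaussian fun t => h t - ∫ y, h y ∂gaussianReal 0 1, integral_sub
    (integrable_comp_of_lipschitz hh integrable_id_stdGaussian) (integrable_const _)]
  simp

lemma hasDerivAt_integral_Ioi {f : ℝ → ℝ} (hc : Continuous f) (hi : Integrable f) (x : ℝ) :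
    HasDerivAt (fun x => ∫ t in Set.Ioi x, f t) (-f x) x := by
  have split : (fun x => ∫ t in Set.Ioi x, f t)
      = fun x => (∫ t in Set.Ioi 0, f t) - ∫ t in (0 : ℝ)..x, f t := funext fun x => by
    rw [← intervalIntegral.integral_Ioi_sub_Ioi' hi.integrableOn hi.integrableOn, sub_sub_cancel]
  rw [split]
  exact (intervalIntegral.integral_hasDerivAt_right (hc.intervalIntegrable _ _)
    (hc.stronglyMeasurableAtFilter _ _) hc.continuousAt).const_sub _

lemma hasDerivAt_steinSol (hh : LipschitzWith 1 h) (x : ℝ) :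
    HasDerivAt (steinSol h) (steinDeriv h x) x := by
  have hp := (stdPDF_pos x).ne'
  refine ((hasDerivAt_integral_Ioi (continuous_steinIntegrand hh) (integrable_steinIntegrand hh)
    x).div (hasDerivAt_stdPDF x) hp).neg.congr_deriv ?_
  rw [steinDeriv, steinSol, steinIntegrand]
  field_simp
  ring

lemma continuous_steinSol (hh : LipschitzWith 1 h) : Continuous (steinSol h) :=
  continuous_iff_continuousAt.2 fun x => (hasDerivAt_steinSol hh x).continuousAt

lemma continuous_steinDeriv (hh : LipschitzWith 1 h) : Continuous (steinDeriv h) :=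
  (continuous_id.mul (continuous_steinSol hh)).add (hh.continuous.sub continuous_const)

lemma abs_steinSol_le_of_nonneg (hh : LipschitzWith 1 h) {x : ℝ} (hx : 0 ≤ x) :
    |steinSol h x| ≤ 2 + (stdPDF 1)⁻¹ := by
  have hp := stdPDF_pos x
  have tail_le : |∫ t in Set.Ioi x, steinIntegrand h t| ≤ stdPDF x + stdTail x := by
    calc |∫ t in Set.Ioi x, steinIntegrand h t| ≤ ∫ t in Set.Ioi x, |steinIntegrand h t| :=
          abs_integral_le_integral_abs
      _ ≤ ∫ t in Set.Ioi x, (t * stdPDF t + stdPDF t) := by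
          refine setIntegral_mono_on (integrable_steinIntegrand hh).abs.integrableOn
            (integrable_id_mul_stdPDF.add integrable_stdPDF).integrableOn measurableSet_Ioi
            fun t ht => ?_
          rw [← add_one_mul, ← abs_of_pos (lt_of_le_of_lt hx ht)]
          simpa only [abs_abs] using abs_steinIntegrand_le hh |t|
      _ = stdPDF x + stdTail x := by
          rw [integral_add integrable_id_mul_stdPDF.integrableOn integrable_stdPDF.integrableOn,
            integral_Ioi_id_mul_stdPDF, stdTail]
  calc |steinSol h x| = |∫ t in Set.Ioi x, steinIntegrand h t| / stdPDF x := by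
        rw [steinSol, abs_neg, abs_div, abs_of_pos hp]
    _ ≤ (stdPDF x + stdTail x) / stdPDF x := by gcongr
    _ = 1 + millsRatio x := by rw [add_div, div_self hp.ne', millsRatio]
    _ ≤ 2 + (stdPDF 1)⁻¹ := by linarith [millsRatio_le hx]

lemma integrable_increment_mul_stdPDF (hh : LipschitzWith 1 h) (x : ℝ) :
    Integrable fun t => (h t - h x) * stdPDF t := by
  refine ((integrable_steinIntegrand hh).add (integrable_stdPDF.const_mul
    ((∫ y, h y ∂gaussianReal 0 1) - h x))).congr (ae_of_all _ fun t => ?_)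
  simp only [steinIntegrand, Pi.add_apply]
  ring

lemma abs_integral_Ioi_increment_le (hh : LipschitzWith 1 h) (x : ℝ) :
    |∫ t in Set.Ioi x, (h t - h x) * stdPDF t| ≤ stdPDF x - x * stdTail x := by
  calc |∫ t in Set.Ioi x, (h t - h x) * stdPDF t|
      ≤ ∫ t in Set.Ioi x, |(h t - h x) * stdPDF t| := abs_integral_le_integral_abs
    _ ≤ ∫ t in Set.Ioi x, (t * stdPDF t - x * stdPDF t) := by
        refine setIntegral_mono_on (integrable_increment_mul_stdPDF hh x).abs.integrableOn
          (integrable_id_mul_stdPDF.sub (integrable_stdPDF.const_mul x)).integrableOn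
          measurableSet_Ioi fun t ht => ?_
        have hxt : 0 < t - x := sub_pos.2 (Set.mem_Ioi.1 ht)
        rw [abs_mul, abs_of_pos (stdPDF_pos t), ← sub_mul, ← abs_of_pos hxt]
        exact mul_le_mul_of_nonneg_right (abs_sub_le_of_lipschitz hh t x) (stdPDF_pos t).le
    _ = stdPDF x - x * stdTail x := by
        rw [integral_sub integrable_id_mul_stdPDF.integrableOn
          (integrable_stdPDF.const_mul x).integrableOn, integral_Ioi_id_mul_stdPDF,
          integral_const_mul, stdTail]

lemma steinDeriv_eq (hh : LipschitzWith 1 h) (x : ℝ) :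
    steinDeriv h x = -(x * ((∫ t in Set.Ioi x, (h t - h x) * stdPDF t) / stdPDF x))
      + (h x - ∫ y, h y ∂gaussianReal 0 1) * (1 - x * millsRatio x) := by
  have hp := (stdPDF_pos x).ne'
  have split : ∫ t in Set.Ioi x, steinIntegrand h t = (∫ t in Set.Ioi x, (h t - h x) * stdPDF t)
      + (h x - ∫ y, h y ∂gaussianReal 0 1) * stdTail x := by
    rw [stdTail, ← integral_const_mul, ← integral_add
      (integrable_increment_mul_stdPDF hh x).integrableOn
      (integrable_stdPDF.const_mul _).integrableOn]
    congr 1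
    funext t
    rw [steinIntegrand]
    ring
  rw [steinDeriv, steinSol, split, millsRatio]
  field_simp
  ring

lemma abs_steinDeriv_le_of_nonneg (hh : LipschitzWith 1 h) {x : ℝ} (hx : 0 ≤ x) :
    (1 + x) * |steinDeriv h x| ≤ 6 := by
  have hp := stdPDF_pos x
  set δ := 1 - x * millsRatio x with hδ
  have δ_nonneg : 0 ≤ δ := sub_nonneg.2 (mul_millsRatio_le_one x)
  have δ_le : (1 + x ^ 2) * δ ≤ 1 := by
    rw [hδ]
    nlinarith [le_mul_millsRatio x]
  have increment_le : |(∫ t in Set.Ioi x, (h t - h x) * stdPDF t) / stdPDF x| ≤ δ := by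
    rw [abs_div, abs_of_pos hp, div_le_iff₀ hp, hδ, millsRatio]
    refine (abs_integral_Ioi_increment_le hh x).trans_eq ?_
    field_simp
  have centered_le : |h x - ∫ y, h y ∂gaussianReal 0 1| ≤ x + 1 := by
    simpa only [abs_of_nonneg hx] using abs_sub_integral_stdGaussian_le hh x
  calc (1 + x) * |steinDeriv h x| ≤ (1 + x) * (x * δ + (x + 1) * δ) := by
        rw [steinDeriv_eq hh]
        refine mul_le_mul_of_nonneg_left ((abs_add_le _ _).trans ?_) (by positivity)
        rw [abs_neg, abs_mul, abs_mul, abs_of_nonneg hx, abs_of_nonneg δ_nonneg]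
        gcongr
    _ = ((1 + x) * (2 * x + 1)) * δ := by ring
    _ ≤ (6 * (1 + x ^ 2)) * δ := by
        refine mul_le_mul_of_nonneg_right ?_ δ_nonneg
        nlinarith [sq_nonneg (x - 1)]
    _ ≤ 6 := by linarith

lemma steinSol_comp_neg (hh : LipschitzWith 1 h) (x : ℝ) :
    steinSol (fun x => h (-x)) (-x) = -steinSol h x := by
  have integrand_comp_neg : ∀ t, steinIntegrand (fun x => h (-x)) t = steinIntegrand h (-t) :=
    fun t => by simp only [steinIntegrand, integral_comp_neg_stdGaussian, stdPDF_neg]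
  have hi := integrable_steinIntegrand hh
  have h0 := integral_steinIntegrand hh
  rw [← intervalIntegral.integral_Iic_add_Ioi (b := x) hi.integrableOn hi.integrableOn] at h0
  simp only [steinSol, integrand_comp_neg, stdPDF_neg]
  rw [integral_comp_neg_Ioi, neg_neg, eq_neg_of_add_eq_zero_left h0, neg_div]

lemma steinDeriv_comp_neg (hh : LipschitzWith 1 h) (x : ℝ) :
    steinDeriv (fun x => h (-x)) (-x) = steinDeriv h x := by
  simp only [steinDeriv, steinSol_comp_neg hh, integral_comp_neg_stdGaussian, neg_mul_neg, neg_neg]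

lemma lipschitzWith_comp_neg (hh : LipschitzWith 1 h) : LipschitzWith 1 fun x => h (-x) :=
  LipschitzWith.of_dist_le_mul fun x y => by
    simpa only [dist_neg_neg] using hh.dist_le_mul (-x) (-y)

/-- A bound on the solution of Stein's equation for `1`-Lipschitz test functions. -/
noncomputable def steinConst : ℝ := 2 + (stdPDF 1)⁻¹

lemma abs_steinSol_le (hh : LipschitzWith 1 h) (x : ℝ) : |steinSol h x| ≤ steinConst := by
  rcases le_total 0 x with hx | hx
  · exact abs_steinSol_le_of_nonneg hh hx
  · have := abs_steinSol_le_of_nonneg (lipschitzWith_comp_neg hh) (neg_nonneg.2 hx)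
    rwa [steinSol_comp_neg hh, abs_neg] at this

lemma one_add_abs_mul_abs_steinDeriv_le (hh : LipschitzWith 1 h) (x : ℝ) :
    (1 + |x|) * |steinDeriv h x| ≤ 6 := by
  rcases le_total 0 x with hx | hx
  · rw [abs_of_nonneg hx]
    exact abs_steinDeriv_le_of_nonneg hh hx
  · have := abs_steinDeriv_le_of_nonneg (lipschitzWith_comp_neg hh) (neg_nonneg.2 hx)
    rwa [steinDeriv_comp_neg hh, ← abs_of_nonpos hx] at this

lemma abs_steinDeriv_le (hh : LipschitzWith 1 h) (x : ℝ) : |steinDeriv h x| ≤ 6 :=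
  (le_mul_of_one_le_left (abs_nonneg _) (le_add_of_nonneg_right (abs_nonneg x))).trans
    (one_add_abs_mul_abs_steinDeriv_le hh x)

/-- A Lipschitz constant for the derivative of the solution of Stein's equation. -/
noncomputable def steinLip : ℝ := steinConst + 7

lemma steinLip_pos : 0 < steinLip := by
  have := inv_pos.2 (stdPDF_pos 1)
  rw [steinLip, steinConst]
  positivity

lemma abs_steinDeriv_sub_le (hh : LipschitzWith 1 h) (x y : ℝ) :
    |steinDeriv h x - steinDeriv h y| ≤ steinLip * |x - y| := by
  have hasDerivAt_id_mul : ∀ t,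
      HasDerivAt (fun t => t * steinSol h t) (steinSol h t + t * steinDeriv h t) t :=
    fun t => ((hasDerivAt_id' t).mul (hasDerivAt_steinSol hh t)).congr_deriv (by ring)
  have norm_deriv_le : ∀ t, ‖steinSol h t + t * steinDeriv h t‖ ≤ steinConst + 6 := fun t => by
    refine (norm_add_le _ _).trans (add_le_add (abs_steinSol_le hh t) ?_)
    rw [norm_mul, Real.norm_eq_abs, Real.norm_eq_abs]
    linarith [one_add_abs_mul_abs_steinDeriv_le hh t, abs_nonneg (steinDeriv h t)]
  have id_mul_lipschitz : |x * steinSol h x - y * steinSol h y| ≤ (steinConst + 6) * |x - y| :=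
    Convex.norm_image_sub_le_of_norm_hasDerivWithin_le (s := Set.univ)
      (fun t _ => (hasDerivAt_id_mul t).hasDerivWithinAt) (fun t _ => norm_deriv_le t) convex_univ
      (Set.mem_univ y) (Set.mem_univ x)
  calc |steinDeriv h x - steinDeriv h y|
      = |(x * steinSol h x - y * steinSol h y) + (h x - h y)| := by
        rw [steinDeriv, steinDeriv]; ring_nf
    _ ≤ (steinConst + 6) * |x - y| + |x - y| :=
        (abs_add_le _ _).trans (add_le_add id_mul_lipschitz (abs_sub_le_of_lipschitz hh x y))
    _ = steinLip * |x - y| := by rw [steinLip]; ring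

lemma abs_steinSol_taylor_le (hh : LipschitzWith 1 h) (x y : ℝ) :
    |steinSol h y - steinSol h x - (y - x) * steinDeriv h x| ≤ steinLip * |y - x| ^ 2 := by
  have hasDerivAt_remainder : ∀ t, HasDerivAt (fun t => steinSol h t - t * steinDeriv h x)
      (steinDeriv h t - steinDeriv h x) t := fun t =>
    ((hasDerivAt_steinSol hh t).sub ((hasDerivAt_id' t).mul_const _)).congr_deriv (by ring)
  have norm_deriv_le : ∀ t ∈ Set.uIcc x y,
      ‖steinDeriv h t - steinDeriv h x‖ ≤ steinLip * |y - x| := fun t ht =>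
    (abs_steinDeriv_sub_le hh t x).trans
      (mul_le_mul_of_nonneg_left (Set.abs_sub_left_of_mem_uIcc ht) steinLip_pos.le)
  calc |steinSol h y - steinSol h x - (y - x) * steinDeriv h x|
      = |steinSol h y - y * steinDeriv h x - (steinSol h x - x * steinDeriv h x)| := by
        congr 1; ring
    _ ≤ steinLip * |y - x| * |y - x| :=
        Convex.norm_image_sub_le_of_norm_hasDerivWithin_le
          (fun t _ => (hasDerivAt_remainder t).hasDerivWithinAt) norm_deriv_le (convex_uIcc x y)
          Set.left_mem_uIcc Set.right_mem_uIcc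
    _ = steinLip * |y - x| ^ 2 := by ring

section Integrability

variable {Ω : Type*} [MeasurableSpace Ω] {P : Measure Ω} {Y Z : Ω → ℝ}

lemma integrable_mul_steinSol (hh : LipschitzWith 1 h) (hZ : Integrable Z P) (hY : Measurable Y) :
    Integrable (fun ω => Z ω * steinSol h (Y ω)) P :=
  hZ.mul_bdd ((continuous_steinSol hh).measurable.comp hY).aestronglyMeasurable
    (ae_of_all _ fun ω => abs_steinSol_le hh (Y ω))

lemma integrable_mul_steinDeriv (hh : LipschitzWith 1 h) (hZ : Integrable Z P)
    (hY : Measurable Y) : Integrable (fun ω => Z ω * steinDeriv h (Y ω)) P :=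
  hZ.mul_bdd ((continuous_steinDeriv hh).measurable.comp hY).aestronglyMeasurable
    (ae_of_all _ fun ω => abs_steinDeriv_le hh (Y ω))

end Integrability

/-- What remains of `d² f'(F) - x d f(F)` at `F = g + x d` after its Taylor expansion in `x d`
around `g`, where `f` is the solution of Stein's equation; the terms expanded away are
`d² f'(g)`, `x d f(g)` and `x² d² f'(g)`. -/
noncomputable def steinRemainder (h : ℝ → ℝ) (g x d : ℝ) : ℝ :=
  d ^ 2 * (steinDeriv h (g + x * d) - steinDeriv h g)
    - x * d * (steinSol h (g + x * d) - steinSol h g - x * d * steinDeriv h g)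

lemma abs_steinRemainder_le (hh : LipschitzWith 1 h) (g x d : ℝ) :
    |steinRemainder h g x d| ≤ steinLip * (|x| * |d| ^ 3 + |x| ^ 3 * |d| ^ 3) := by
  have deriv_le := abs_steinDeriv_sub_le hh (g + x * d) g
  have taylor_le := abs_steinSol_taylor_le hh g (g + x * d)
  rw [add_sub_cancel_left, abs_mul] at deriv_le taylor_le
  calc |steinRemainder h g x d|
      ≤ |d| ^ 2 * (steinLip * (|x| * |d|)) + |x| * |d| * (steinLip * (|x| * |d|) ^ 2) := by
        refine (abs_sub _ _).trans ?_
        rw [abs_mul, abs_mul, abs_pow, abs_mul]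
        gcongr
    _ = steinLip * (|x| * |d| ^ 3 + |x| ^ 3 * |d| ^ 3) := by ring

end Gaussian

/-! ### Multilinear polynomials in independent standardized variables -/

section MultilinearPolynomial

variable {ι Ω : Type*}

/-- A family of measurable independent random variables. -/
structure IsIndepFamily [MeasurableSpace Ω] (P : Measure Ω) (X : ι → Ω → ℝ) : Prop where
  measurable : ∀ k, Measurable (X k)
  indep : iIndepFun X P

/-- Independent random variables with mean `0`, variance `1` and fourth moments at most `M`. -/
structure IsStdIndep [MeasurableSpace Ω] (P : Measure Ω) (X : ι → Ω → ℝ) (M : ℝ) : Prop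
    extends IsIndepFamily P X where
  integrable_pow_four : ∀ k, Integrable (fun ω => X k ω ^ 4) P
  integral_eq_zero : ∀ k, ∫ ω, X k ω ∂P = 0
  integral_sq : ∀ k, ∫ ω, X k ω ^ 2 ∂P = 1
  integral_pow_four_le : ∀ k, ∫ ω, X k ω ^ 4 ∂P ≤ M

/-- The σ-algebra generated by all variables but the `k`-th. -/
abbrev sigmaExcept (X : ι → Ω → ℝ) (k : ι) : MeasurableSpace Ω :=
  ⨆ i ∈ ({k}ᶜ : Set ι), MeasurableSpace.comap (X i) inferInstance

lemma measurable_sigmaExcept (X : ι → Ω → ℝ) {i k : ι} (h : i ≠ k) :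
    Measurable[sigmaExcept X k] (X i) :=
  measurable_iff_comap_le.2 <| le_iSup₂_of_le
    (f := fun i (_ : i ∈ ({k}ᶜ : Set ι)) => MeasurableSpace.comap (X i) inferInstance) i h le_rfl

/-- The multilinear polynomial `∑_{A ⊆ U} c_A ∏_{k ∈ A} X_k`. -/
noncomputable def mpoly (X : ι → Ω → ℝ) (U : Finset ι) (c : Finset ι → ℝ) (ω : Ω) : ℝ :=
  ∑ A ∈ U.powerset, c A * ∏ k ∈ A, X k ω

lemma mpoly_insert [DecidableEq ι] (X : ι → Ω → ℝ) {U : Finset ι} {j : ι} (hj : j ∉ U)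
    (c : Finset ι → ℝ) (ω : Ω) : mpoly X (insert j U) c ω
      = mpoly X U c ω + X j ω * mpoly X U (fun A => c (insert j A)) ω := by
  rw [mpoly, Finset.sum_powerset_insert hj, mpoly, mpoly, Finset.mul_sum]
  congr 1
  refine Finset.sum_congr rfl fun A hA => ?_
  rw [Finset.prod_insert fun h => hj (Finset.mem_powerset.1 hA h)]
  ring

lemma measurable_mpoly_sigmaExcept (X : ι → Ω → ℝ) {U : Finset ι} {k : ι} (hk : k ∉ U)
    (c : Finset ι → ℝ) : Measurable[sigmaExcept X k] (mpoly X U c) := by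
  unfold mpoly
  refine Finset.measurable_fun_sum _ fun A hA =>
    Measurable.mul (@measurable_const _ _ _ (sigmaExcept X k) _) <|
      Finset.measurable_fun_prod _ fun i hi => measurable_sigmaExcept X ?_
  rintro rfl
  exact hk (Finset.mem_powerset.1 hA hi)

namespace IsIndepFamily

variable [MeasurableSpace Ω] {P : Measure Ω} {X : ι → Ω → ℝ} {k : ι} {G : Ω → ℝ} {g : ℝ → ℝ}

lemma sigmaExcept_le (hX : IsIndepFamily P X) (k : ι) :
    sigmaExcept X k ≤ (inferInstance : MeasurableSpace Ω) :=
  iSup₂_le fun i _ => (hX.measurable i).comap_le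

lemma measurable_of_sigmaExcept (hX : IsIndepFamily P X) (hG : Measurable[sigmaExcept X k] G) :
    Measurable G :=
  hG.mono (hX.sigmaExcept_le k) le_rfl

lemma measurable_mpoly (hX : IsIndepFamily P X) (U : Finset ι) (c : Finset ι → ℝ) :
    Measurable (mpoly X U c) := by
  unfold mpoly
  exact Finset.measurable_fun_sum _ fun A _ => measurable_const.mul
    (Finset.measurable_fun_prod _ fun i _ => hX.measurable i)

lemma indep_sigmaExcept (hX : IsIndepFamily P X) (k : ι) :
    Indep (MeasurableSpace.comap (X k) inferInstance) (sigmaExcept X k) P := by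
  have h := indep_iSup_of_disjoint (fun i => (hX.measurable i).comap_le)
    ((iIndepFun_iff_iIndep _ _ _).1 hX.indep) (S := {k}) (T := {k}ᶜ) disjoint_compl_right
  simpa [sigmaExcept] using h

lemma indepFun (hX : IsIndepFamily P X) (hG : Measurable[sigmaExcept X k] G) (hg : Measurable g) :
    IndepFun (fun ω => g (X k ω)) G P := by
  have h : IndepFun (X k) G P := (IndepFun_iff_Indep _ _ _).2 <|
    indep_of_indep_of_le_right (hX.indep_sigmaExcept k) (measurable_iff_comap_le.1 hG)
  exact h.comp hg measurable_id

lemma integrable_mul (hX : IsIndepFamily P X) (hG : Measurable[sigmaExcept X k] G)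
    (hg : Measurable g) (hi : Integrable (fun ω => g (X k ω)) P) (hGi : Integrable G P) :
    Integrable (fun ω => g (X k ω) * G ω) P :=
  (hX.indepFun hG hg).integrable_mul hi hGi

lemma integral_mul (hX : IsIndepFamily P X) (hG : Measurable[sigmaExcept X k] G)
    (hg : Measurable g) :
    ∫ ω, g (X k ω) * G ω ∂P = (∫ ω, g (X k ω) ∂P) * ∫ ω, G ω ∂P :=
  (hX.indepFun hG hg).integral_fun_mul_eq_mul_integral
    (hg.comp (hX.measurable k)).aestronglyMeasurable
    (hX.measurable_of_sigmaExcept hG).aestronglyMeasurable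

lemma integrable_prod_comp [IsProbabilityMeasure P] (hX : IsIndepFamily P X) (U : Finset ι)
    {g : ι → ℝ → ℝ} (hg : ∀ k, Measurable (g k)) (hi : ∀ k, Integrable (fun ω => g k (X k ω)) P) :
    Integrable (fun ω => ∏ k ∈ U, g k (X k ω)) P ∧
      ∫ ω, ∏ k ∈ U, g k (X k ω) ∂P = ∏ k ∈ U, ∫ ω, g k (X k ω) ∂P := by
  classical
  induction U using Finset.induction_on with
  | empty => simp
  | insert j U hj ih =>
    have hs : Measurable[sigmaExcept X j] fun ω => ∏ k ∈ U, g k (X k ω) :=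
      Finset.measurable_fun_prod _ fun k hk =>
        (hg k).comp (measurable_sigmaExcept X fun h => hj (h ▸ hk))
    simp only [Finset.prod_insert hj]
    exact ⟨hX.integrable_mul hs (hg j) (hi j) ih.1,
      (hX.integral_mul hs (hg j)).trans (by rw [ih.2])⟩

end IsIndepFamily

namespace IsStdIndep

variable [MeasurableSpace Ω] {P : Measure Ω} {X : ι → Ω → ℝ} {M : ℝ} {k : ι} {G H : Ω → ℝ}

lemma integral_mul_eq_zero (hX : IsStdIndep P X M) (hG : Measurable[sigmaExcept X k] G) :
    ∫ ω, X k ω * G ω ∂P = 0 := by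
  have := hX.integral_mul (g := id) hG measurable_id
  simpa only [id, hX.integral_eq_zero, zero_mul] using this

lemma integral_sq_mul (hX : IsStdIndep P X M) (hG : Measurable[sigmaExcept X k] G) :
    ∫ ω, X k ω ^ 2 * G ω ∂P = ∫ ω, G ω ∂P := by
  rw [hX.integral_mul (g := fun x => x ^ 2) hG (measurable_id.pow_const 2), hX.integral_sq, one_mul]

lemma integral_pow_four_mul_le (hX : IsStdIndep P X M) (hG : Measurable[sigmaExcept X k] G)
    (hG0 : 0 ≤ G) : ∫ ω, X k ω ^ 4 * G ω ∂P ≤ M * ∫ ω, G ω ∂P := by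
  rw [hX.integral_mul (g := fun x => x ^ 4) hG (measurable_id.pow_const 4)]
  exact mul_le_mul_of_nonneg_right (hX.integral_pow_four_le k) (integral_nonneg hG0)

variable [IsProbabilityMeasure P]

lemma integrable_pow (hX : IsStdIndep P X M) (k : ι) {n : ℕ} (hn : n ≤ 4) :
    Integrable (fun ω => X k ω ^ n) P :=
  integrable_pow_of_pow_four (hX.measurable k) (hX.integrable_pow_four k) hn

lemma integrable_pow_mul (hX : IsStdIndep P X M) (hG : Measurable[sigmaExcept X k] G)
    (hGi : Integrable G P) {n : ℕ} (hn : n ≤ 4) : Integrable (fun ω => X k ω ^ n * G ω) P :=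
  hX.integrable_mul (g := fun x => x ^ n) hG (measurable_id.pow_const n) (hX.integrable_pow k hn)
    hGi

lemma integrable_mul' (hX : IsStdIndep P X M) (hG : Measurable[sigmaExcept X k] G)
    (hGi : Integrable G P) : Integrable (fun ω => X k ω * G ω) P := by
  simpa only [pow_one] using hX.integrable_pow_mul hG hGi (n := 1) (by decide)

lemma integral_add_mul_sq (hX : IsStdIndep P X M) (hG : Measurable[sigmaExcept X k] G)
    (hH : Measurable[sigmaExcept X k] H) (hG2 : Integrable (fun ω => G ω ^ 2) P)
    (hH2 : Integrable (fun ω => H ω ^ 2) P) :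
    ∫ ω, (G ω + X k ω * H ω) ^ 2 ∂P = ∫ ω, G ω ^ 2 ∂P + ∫ ω, H ω ^ 2 ∂P := by
  have hGH : Integrable (fun ω => G ω * H ω) P :=
    integrable_of_abs_le (hG2.add hH2)
      ((hX.measurable_of_sigmaExcept hG).mul (hX.measurable_of_sigmaExcept hH)) fun ω =>
      abs_le.2 ⟨by simp only [Pi.add_apply]; nlinarith [sq_nonneg (G ω + H ω)],
        by simp only [Pi.add_apply]; nlinarith [sq_nonneg (G ω - H ω)]⟩
  have mGH : Measurable[sigmaExcept X k] fun ω => G ω * H ω := hG.mul hH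
  have cross := hX.integrable_mul' mGH hGH
  have square := hX.integrable_pow_mul (hH.pow_const 2) hH2 (n := 2) (by decide)
  have linear : Integrable (fun ω => G ω ^ 2 + 2 * (X k ω * (G ω * H ω))) P :=
    hG2.add (cross.const_mul 2)
  calc ∫ ω, (G ω + X k ω * H ω) ^ 2 ∂P
      = ∫ ω, (G ω ^ 2 + 2 * (X k ω * (G ω * H ω)) + X k ω ^ 2 * H ω ^ 2) ∂P := by
        congr 1 with ω; ring
    _ = ∫ ω, G ω ^ 2 ∂P + ∫ ω, H ω ^ 2 ∂P := by
        rw [integral_add linear square, integral_add hG2 (cross.const_mul 2), integral_const_mul,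
          hX.integral_mul_eq_zero mGH, hX.integral_sq_mul (hH.pow_const 2), mul_zero,
          add_zero]

lemma integral_add_mul_pow_four_le (hX : IsStdIndep P X M) (hG : Measurable[sigmaExcept X k] G)
    (hH : Measurable[sigmaExcept X k] H) (hG4 : Integrable (fun ω => G ω ^ 4) P)
    (hH4 : Integrable (fun ω => H ω ^ 4) P) :
    ∫ ω, (G ω + X k ω * H ω) ^ 4 ∂P
      ≤ ∫ ω, G ω ^ 4 ∂P + 8 * ∫ ω, G ω ^ 2 * H ω ^ 2 ∂P + 3 * (M * ∫ ω, H ω ^ 4 ∂P) := by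
  have mG := hX.measurable_of_sigmaExcept hG
  have mH := hX.measurable_of_sigmaExcept hH
  have m1 : Measurable[sigmaExcept X k] fun ω => G ω ^ 3 * H ω ^ 1 :=
    (hG.pow_const 3).mul (hH.pow_const 1)
  have m2 : Measurable[sigmaExcept X k] fun ω => G ω ^ 2 * H ω ^ 2 :=
    (hG.pow_const 2).mul (hH.pow_const 2)
  have i1 := hX.integrable_mul' m1 (integrable_pow_mul_pow mG mH hG4 hH4 (by decide))
  have i2 := hX.integrable_pow_mul m2 (integrable_pow_mul_pow mG mH hG4 hH4 (by decide))
    (n := 2) (by decide)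
  have i4 := hX.integrable_pow_mul (hH.pow_const 4) hH4 le_rfl
  have i01 : Integrable (fun ω => G ω ^ 4 + 4 * (X k ω * (G ω ^ 3 * H ω ^ 1))) P :=
    hG4.add (i1.const_mul 4)
  have i012 : Integrable (fun ω => G ω ^ 4 + 4 * (X k ω * (G ω ^ 3 * H ω ^ 1))
      + 8 * (X k ω ^ 2 * (G ω ^ 2 * H ω ^ 2))) P := i01.add (i2.const_mul 8)
  calc ∫ ω, (G ω + X k ω * H ω) ^ 4 ∂P
      ≤ ∫ ω, (G ω ^ 4 + 4 * (X k ω * (G ω ^ 3 * H ω ^ 1))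
          + 8 * (X k ω ^ 2 * (G ω ^ 2 * H ω ^ 2)) + 3 * (X k ω ^ 4 * H ω ^ 4)) ∂P := by
        refine integral_mono_of_nonneg (ae_of_all _ fun ω => by positivity)
          (i012.add (i4.const_mul 3)) (ae_of_all _ fun ω => ?_)
        simp only
        nlinarith [sq_nonneg (X k ω * H ω * G ω - X k ω ^ 2 * H ω ^ 2)]
    _ = ∫ ω, G ω ^ 4 ∂P + 8 * ∫ ω, G ω ^ 2 * H ω ^ 2 ∂P
          + 3 * ∫ ω, X k ω ^ 4 * H ω ^ 4 ∂P := by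
        rw [integral_add i012 (i4.const_mul 3), integral_add i01 (i2.const_mul 8),
          integral_add hG4 (i1.const_mul 4), integral_const_mul, integral_const_mul,
          integral_const_mul, hX.integral_mul_eq_zero m1, hX.integral_sq_mul m2, mul_zero,
          add_zero]
    _ ≤ _ := by
        gcongr
        exact hX.integral_pow_four_mul_le (hH.pow_const 4) fun ω => by positivity

lemma one_le [Nonempty ι] (hX : IsStdIndep P X M) : 1 ≤ M := by
  obtain ⟨k⟩ := ‹Nonempty ι›
  have h := sq_integral_mul_le (P := P) (f := fun ω => X k ω ^ 2) (g := fun _ => 1)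
    (by simpa only [← pow_mul] using hX.integrable_pow_four k) (integrable_const _)
    (by simpa only [mul_one] using hX.integrable_pow k (n := 2) (by decide))
  simp only [mul_one, hX.integral_sq, ← pow_mul, one_pow, integral_const, probReal_univ,
    one_smul] at h
  exact h.trans (hX.integral_pow_four_le k)

lemma integral_add_mul_pow_four_le_of_le (hX : IsStdIndep P X M)
    (hG : Measurable[sigmaExcept X k] G) (hH : Measurable[sigmaExcept X k] H)
    (hG4 : Integrable (fun ω => G ω ^ 4) P) (hH4 : Integrable (fun ω => H ω ^ 4) P) {g h : ℝ}
    (hg : 0 ≤ g) (hh : 0 ≤ h) {d : ℕ} (hGg : ∫ ω, G ω ^ 4 ∂P ≤ (16 * M) ^ (d + 1) * g ^ 2)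
    (hHh : ∫ ω, H ω ^ 4 ∂P ≤ (16 * M) ^ d * h ^ 2) :
    ∫ ω, (G ω + X k ω * H ω) ^ 4 ∂P ≤ (16 * M) ^ (d + 1) * (g + h) ^ 2 := by
  have : Nonempty ι := ⟨k⟩
  have hM := hX.one_le
  have H4_nonneg : 0 ≤ ∫ ω, H ω ^ 4 ∂P := integral_nonneg fun ω => by positivity
  have cauchy_schwarz :
      (∫ ω, G ω ^ 2 * H ω ^ 2 ∂P) ^ 2 ≤ (∫ ω, G ω ^ 4 ∂P) * ∫ ω, H ω ^ 4 ∂P := by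
    have := sq_integral_mul_le (P := P) (f := fun ω => G ω ^ 2) (g := fun ω => H ω ^ 2)
      (by simpa only [← pow_mul] using hG4) (by simpa only [← pow_mul] using hH4)
      (integrable_pow_mul_pow (hX.measurable_of_sigmaExcept hG) (hX.measurable_of_sigmaExcept hH)
        hG4 hH4 le_rfl)
    simpa only [← pow_mul] using this
  have mixed_le : 4 * ∫ ω, G ω ^ 2 * H ω ^ 2 ∂P ≤ (16 * M) ^ (d + 1) * (g * h) := by
    refine le_of_sq_le_sq ?_ (by positivity)
    calc (4 * ∫ ω, G ω ^ 2 * H ω ^ 2 ∂P) ^ 2 = 16 * (∫ ω, G ω ^ 2 * H ω ^ 2 ∂P) ^ 2 := by ring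
      _ ≤ (16 * M) * (((16 * M) ^ (d + 1) * g ^ 2) * ((16 * M) ^ d * h ^ 2)) := by
          gcongr
          · linarith
          · exact cauchy_schwarz.trans (mul_le_mul hGg hHh H4_nonneg (by positivity))
      _ = ((16 * M) ^ (d + 1) * (g * h)) ^ 2 := by ring
  have last_le : 3 * (M * ∫ ω, H ω ^ 4 ∂P) ≤ (16 * M) ^ (d + 1) * h ^ 2 := by
    calc 3 * (M * ∫ ω, H ω ^ 4 ∂P) ≤ 16 * (M * ((16 * M) ^ d * h ^ 2)) := by gcongr; norm_num
      _ = (16 * M) ^ (d + 1) * h ^ 2 := by ring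
  calc ∫ ω, (G ω + X k ω * H ω) ^ 4 ∂P
      ≤ (16 * M) ^ (d + 1) * g ^ 2 + 2 * ((16 * M) ^ (d + 1) * (g * h))
          + (16 * M) ^ (d + 1) * h ^ 2 := by
        linarith [hX.integral_add_mul_pow_four_le hG hH hG4 hH4]
    _ = (16 * M) ^ (d + 1) * (g + h) ^ 2 := by ring

lemma integrable_mpoly_pow_four (hX : IsStdIndep P X M) (U : Finset ι) (c : Finset ι → ℝ) :
    Integrable (fun ω => mpoly X U c ω ^ 4) P := by
  classical
  induction U using Finset.induction_on generalizing c with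
  | empty => simp [mpoly]
  | insert j U hj ih =>
    have ih_mul := hX.integrable_pow_mul ((measurable_mpoly_sigmaExcept X hj _).pow_const 4)
      (ih fun A => c (insert j A)) le_rfl
    refine integrable_of_abs_le (((ih c).const_mul 8).add (ih_mul.const_mul 8))
      ((hX.measurable_mpoly _ _).pow_const 4) fun ω => ?_
    simp only [mpoly_insert X hj, Pi.add_apply, ← mul_pow]
    rw [abs_of_nonneg (by positivity), ← mul_add]
    refine (Even.add_pow_le (by decide)).trans_eq ?_
    norm_num

lemma integrable_mpoly_pow (hX : IsStdIndep P X M) (U : Finset ι) (c : Finset ι → ℝ) {n : ℕ}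
    (hn : n ≤ 4) : Integrable (fun ω => mpoly X U c ω ^ n) P :=
  integrable_pow_of_pow_four (hX.measurable_mpoly U c) (hX.integrable_mpoly_pow_four U c) hn

lemma integrable_mpoly (hX : IsStdIndep P X M) (U : Finset ι) (c : Finset ι → ℝ) :
    Integrable (mpoly X U c) P := by
  simpa only [pow_one] using hX.integrable_mpoly_pow U c (n := 1) (by decide)

lemma integral_mpoly_sq (hX : IsStdIndep P X M) (U : Finset ι) (c : Finset ι → ℝ) :
    ∫ ω, mpoly X U c ω ^ 2 ∂P = ∑ A ∈ U.powerset, c A ^ 2 := by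
  classical
  induction U using Finset.induction_on generalizing c with
  | empty => simp [mpoly]
  | insert j U hj ih =>
    simp only [mpoly_insert X hj]
    rw [hX.integral_add_mul_sq (measurable_mpoly_sigmaExcept X hj _)
      (measurable_mpoly_sigmaExcept X hj _) (hX.integrable_mpoly_pow _ _ (by decide))
      (hX.integrable_mpoly_pow _ _ (by decide)), ih, ih, Finset.sum_powerset_insert hj]

/-- Hypercontractivity for multilinear polynomials of degree at most `d`. -/
lemma integral_mpoly_pow_four_le [Nonempty ι] (hX : IsStdIndep P X M) (U : Finset ι)
    (c : Finset ι → ℝ) (d : ℕ) (hc : ∀ A ⊆ U, c A ≠ 0 → A.card ≤ d) :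
    ∫ ω, mpoly X U c ω ^ 4 ∂P ≤ (16 * M) ^ d * (∑ A ∈ U.powerset, c A ^ 2) ^ 2 := by
  classical
  induction U using Finset.induction_on generalizing c d with
  | empty =>
    simp only [mpoly, Finset.powerset_empty, Finset.sum_singleton, Finset.prod_empty, mul_one,
      integral_const, probReal_univ, one_smul, ← pow_mul]
    exact le_mul_of_one_le_left (by positivity) (one_le_pow₀ (by linarith [hX.one_le]))
  | insert j U hj ih =>
    have card_le : ∀ A ⊆ U, c A ≠ 0 → A.card ≤ d :=
      fun A hA => hc A (hA.trans (Finset.subset_insert j U))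
    have card_lt : ∀ A ⊆ U, c (insert j A) ≠ 0 → A.card < d := fun A hA h => by
      have := hc (insert j A) (Finset.insert_subset_insert j hA) h
      rwa [Finset.card_insert_of_notMem fun h => hj (hA h)] at this
    simp only [mpoly_insert X hj, Finset.sum_powerset_insert hj]
    rcases d with _ | d
    · have coeff_eq_zero : ∀ A ∈ U.powerset, c (insert j A) = 0 := fun A hA =>
        of_not_not fun h => Nat.not_lt_zero _ (card_lt A (Finset.mem_powerset.1 hA) h)
      have mpoly_eq_zero : ∀ ω, mpoly X U (fun A => c (insert j A)) ω = 0 := fun ω =>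
        Finset.sum_eq_zero fun A hA => by simp only [coeff_eq_zero A hA, zero_mul]
      have sum_eq_zero : ∑ A ∈ U.powerset, c (insert j A) ^ 2 = 0 :=
        Finset.sum_eq_zero fun A hA => by rw [coeff_eq_zero A hA, sq, zero_mul]
      simp only [mpoly_eq_zero, sum_eq_zero, mul_zero, add_zero]
      exact ih c 0 card_le
    · exact hX.integral_add_mul_pow_four_le_of_le (measurable_mpoly_sigmaExcept X hj _)
        (measurable_mpoly_sigmaExcept X hj _) (hX.integrable_mpoly_pow_four _ _)
        (hX.integrable_mpoly_pow_four _ _) (Finset.sum_nonneg fun A _ => sq_nonneg _)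
        (Finset.sum_nonneg fun A _ => sq_nonneg _) (ih c (d + 1) card_le)
        (ih _ d fun A hA h => Nat.le_of_lt_succ (card_lt A hA h))

end IsStdIndep

end MultilinearPolynomial

/-! ### Stein's method for homogeneous multilinear polynomials -/

section SteinMethod

variable {ι Ω : Type*}

namespace IsStdIndep

variable [MeasurableSpace Ω] {P : Measure Ω} [IsProbabilityMeasure P] {X : ι → Ω → ℝ} {M : ℝ}
  {h : ℝ → ℝ} {j : ι}

lemma integral_abs_le (hX : IsStdIndep P X M) (j : ι) : ∫ ω, |X j ω| ∂P ≤ M := by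
  have : Nonempty ι := ⟨j⟩
  have hi : Integrable (X j) P := by
    simpa only [pow_one] using hX.integrable_pow j (n := 1) (by decide)
  have := integral_abs_le_sqrt_integral_sq hi (hX.integrable_pow j (by decide))
  rw [hX.integral_sq, Real.sqrt_one] at this
  exact this.trans hX.one_le

lemma integral_abs_cube_le (hX : IsStdIndep P X M) (j : ι) : ∫ ω, |X j ω| ^ 3 ∂P ≤ M := by
  have : Nonempty ι := ⟨j⟩
  have := CombCLT.integral_abs_cube_le (hX.measurable j) (hX.integrable_pow_four j) one_pos
  rw [hX.integral_sq, inv_one] at this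
  linarith [hX.one_le, hX.integral_pow_four_le j]

lemma integral_abs_steinRemainder_le (hX : IsStdIndep P X M) (hh : LipschitzWith 1 h)
    (G : Ω → ℝ) {D : Ω → ℝ} (hD : Measurable[sigmaExcept X j] D)
    (hD4 : Integrable (fun ω => D ω ^ 4) P) :
    |∫ ω, steinRemainder h (G ω) (X j ω) (D ω) ∂P| ≤ 2 * steinLip * M * ∫ ω, |D ω| ^ 3 ∂P := by
  have hD3 : Measurable[sigmaExcept X j] fun ω => |D ω| ^ 3 :=
    (measurable_id.abs.pow_const 3 : Measurable fun x : ℝ => |x| ^ 3).comp hD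
  have iD3 : Integrable (fun ω => |D ω| ^ 3) P := by
    simpa only [abs_pow] using
      (integrable_pow_of_pow_four (hX.measurable_of_sigmaExcept hD) hD4 (n := 3) (by decide)).abs
  have iX : Integrable (fun ω => |X j ω|) P := by
    simpa only [pow_one] using (hX.integrable_pow j (n := 1) (by decide)).abs
  have iX3 : Integrable (fun ω => |X j ω| ^ 3) P := by
    simpa only [abs_pow] using (hX.integrable_pow j (n := 3) (by decide)).abs
  have i1 := hX.integrable_mul (g := fun x => |x|) hD3 measurable_id.abs iX iD3
  have i3 := hX.integrable_mul (g := fun x => |x| ^ 3) hD3 (measurable_id.abs.pow_const 3) iX3 iD3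
  have i13 : Integrable (fun ω => steinLip * (|X j ω| * |D ω| ^ 3 + |X j ω| ^ 3 * |D ω| ^ 3)) P :=
    (i1.add i3).const_mul steinLip
  calc |∫ ω, steinRemainder h (G ω) (X j ω) (D ω) ∂P|
      ≤ ∫ ω, steinLip * (|X j ω| * |D ω| ^ 3 + |X j ω| ^ 3 * |D ω| ^ 3) ∂P :=
        norm_integral_le_of_norm_le i13 (f := fun ω => steinRemainder h (G ω) (X j ω) (D ω))
          (ae_of_all _ fun ω => abs_steinRemainder_le hh _ _ _)
    _ = steinLip * ((∫ ω, |X j ω| ∂P) * ∫ ω, |D ω| ^ 3 ∂P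
          + (∫ ω, |X j ω| ^ 3 ∂P) * ∫ ω, |D ω| ^ 3 ∂P) := by
        rw [integral_const_mul, integral_add i1 i3,
          hX.integral_mul (g := fun x => |x|) hD3 measurable_id.abs,
          hX.integral_mul (g := fun x => |x| ^ 3) hD3 (measurable_id.abs.pow_const 3)]
    _ ≤ steinLip * (M * ∫ ω, |D ω| ^ 3 ∂P + M * ∫ ω, |D ω| ^ 3 ∂P) := by
        have := steinLip_pos
        have := integral_nonneg (μ := P) (f := fun ω => |D ω| ^ 3) fun ω => by positivity
        gcongr
        · exact hX.integral_abs_le j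
        · exact hX.integral_abs_cube_le j
    _ = 2 * steinLip * M * ∫ ω, |D ω| ^ 3 ∂P := by ring

lemma integral_stein_local_eq (hX : IsStdIndep P X M) (hh : LipschitzWith 1 h) {G D : Ω → ℝ}
    (hG : Measurable[sigmaExcept X j] G) (hD : Measurable[sigmaExcept X j] D)
    (hD4 : Integrable (fun ω => D ω ^ 4) P) :
    ∫ ω, (D ω ^ 2 * steinDeriv h (G ω + X j ω * D ω)
        - X j ω * D ω * steinSol h (G ω + X j ω * D ω)) ∂P
      = ∫ ω, steinRemainder h (G ω) (X j ω) (D ω) ∂P := by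
  have mG := hX.measurable_of_sigmaExcept hG
  have mD := hX.measurable_of_sigmaExcept hD
  have mF : Measurable fun ω => G ω + X j ω * D ω := mG.add ((hX.measurable j).mul mD)
  have iD : Integrable D P := by
    simpa only [pow_one] using integrable_pow_of_pow_four mD hD4 (n := 1) (by decide)
  have iD2 := integrable_pow_of_pow_four mD hD4 (n := 2) (by decide)
  have sDf : Measurable[sigmaExcept X j] fun ω => D ω * steinSol h (G ω) :=
    hD.mul ((continuous_steinSol hh).measurable.comp hG)
  have sD2f : Measurable[sigmaExcept X j] fun ω => D ω ^ 2 * steinDeriv h (G ω) :=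
    (hD.pow_const 2).mul ((continuous_steinDeriv hh).measurable.comp hG)
  have i0 : Integrable (fun ω => D ω ^ 2 * steinDeriv h (G ω + X j ω * D ω)
      - X j ω * D ω * steinSol h (G ω + X j ω * D ω)) P :=
    (integrable_mul_steinDeriv hh iD2 mF).sub
      (integrable_mul_steinSol hh (hX.integrable_mul' hD iD) mF)
  have i1 := hX.integrable_mul' sDf (integrable_mul_steinSol hh iD mG)
  have iD2f := integrable_mul_steinDeriv hh iD2 mG
  have i2 := hX.integrable_pow_mul sD2f iD2f (n := 2) (by decide)
  have i22 : Integrable (fun ω => X j ω ^ 2 * (D ω ^ 2 * steinDeriv h (G ω))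
      - D ω ^ 2 * steinDeriv h (G ω)) P := i2.sub iD2f
  have i012 : Integrable (fun ω => D ω ^ 2 * steinDeriv h (G ω + X j ω * D ω)
      - X j ω * D ω * steinSol h (G ω + X j ω * D ω) + X j ω * (D ω * steinSol h (G ω))) P :=
    i0.add i1
  symm
  calc ∫ ω, steinRemainder h (G ω) (X j ω) (D ω) ∂P
      = ∫ ω, (D ω ^ 2 * steinDeriv h (G ω + X j ω * D ω)
          - X j ω * D ω * steinSol h (G ω + X j ω * D ω) + X j ω * (D ω * steinSol h (G ω))
          + (X j ω ^ 2 * (D ω ^ 2 * steinDeriv h (G ω)) - D ω ^ 2 * steinDeriv h (G ω))) ∂P := by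
        congr 1 with ω
        rw [steinRemainder]
        ring
    _ = _ := by
        rw [integral_add i012 i22, integral_add i0 i1, integral_sub i2 iD2f,
          hX.integral_mul_eq_zero sDf, hX.integral_sq_mul sD2f, sub_self, add_zero, add_zero]

end IsStdIndep

variable [DecidableEq ι]

lemma sum_powerset_erase_insert {β : Type*} [AddCommMonoid β] {U : Finset ι} {j : ι} (hj : j ∈ U)
    (g : Finset ι → β) :
    ∑ A ∈ (U.erase j).powerset, g (insert j A) = ∑ A ∈ U.powerset with j ∈ A, g A := by
  refine Finset.sum_nbij' (insert j) (fun A => A.erase j) ?_ ?_ ?_ ?_ fun _ _ => rfl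
  · intro A hA
    simp only [Finset.mem_filter, Finset.mem_powerset] at hA ⊢
    exact ⟨Finset.insert_subset hj (hA.trans (Finset.erase_subset j U)),
      Finset.mem_insert_self j A⟩
  · intro A hA
    simp only [Finset.mem_filter, Finset.mem_powerset] at hA ⊢
    exact Finset.erase_subset_erase j hA.1
  · intro A hA
    exact Finset.erase_insert fun h => Finset.notMem_erase j U (Finset.mem_powerset.1 hA h)
  · intro A hA
    exact Finset.insert_erase (Finset.mem_filter.1 hA).2

lemma sum_sum_mem_powerset {β : Type*} [AddCommMonoid β] (U : Finset ι) (g : ι → Finset ι → β) :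
    ∑ j ∈ U, ∑ A ∈ U.powerset with j ∈ A, g j A = ∑ A ∈ U.powerset, ∑ j ∈ A, g j A := by
  refine Finset.sum_comm' fun j A => ?_
  simp only [Finset.mem_filter, Finset.mem_powerset]
  exact ⟨fun h => ⟨h.2.2, h.2.1⟩, fun h => ⟨h.2 h.1, h.2, h.1⟩⟩

lemma sum_sum_mem_powerset_of_homogeneous {U : Finset ι} {c : Finset ι → ℝ} {q : ℕ}
    (hc : ∀ A ⊆ U, c A ≠ 0 → A.card = q) {g : Finset ι → ℝ} (hg : ∀ A, c A = 0 → g A = 0) :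
    ∑ j ∈ U, ∑ A ∈ U.powerset with j ∈ A, g A = q * ∑ A ∈ U.powerset, g A := by
  rw [sum_sum_mem_powerset U fun _ A => g A, Finset.mul_sum]
  refine Finset.sum_congr rfl fun A hA => ?_
  rw [Finset.sum_const, nsmul_eq_mul]
  by_cases h : c A = 0
  · rw [hg A h, mul_zero, mul_zero]
  · rw [hc A (Finset.mem_powerset.1 hA) h]

/-- The influence of the `j`-th variable on `mpoly X U c`. -/
def influence (U : Finset ι) (c : Finset ι → ℝ) (j : ι) : ℝ :=
  ∑ A ∈ U.powerset with j ∈ A, c A ^ 2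

lemma influence_nonneg (U : Finset ι) (c : Finset ι → ℝ) (j : ι) : 0 ≤ influence U c j :=
  Finset.sum_nonneg fun _ _ => sq_nonneg _

lemma sum_influence {U : Finset ι} {c : Finset ι → ℝ} {q : ℕ}
    (hc : ∀ A ⊆ U, c A ≠ 0 → A.card = q) :
    ∑ j ∈ U, influence U c j = q * ∑ A ∈ U.powerset, c A ^ 2 :=
  sum_sum_mem_powerset_of_homogeneous hc fun A h => by rw [h, sq, zero_mul]

/-- The partial derivative of `mpoly X U c` with respect to the `j`-th variable. -/
noncomputable def mderiv (X : ι → Ω → ℝ) (U : Finset ι) (c : Finset ι → ℝ) (j : ι) : Ω → ℝ :=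
  mpoly X (U.erase j) fun A => c (insert j A)

lemma measurable_mderiv_sigmaExcept (X : ι → Ω → ℝ) (U : Finset ι) (c : Finset ι → ℝ) (j : ι) :
    Measurable[sigmaExcept X j] (mderiv X U c j) :=
  measurable_mpoly_sigmaExcept X (Finset.notMem_erase j U) _

lemma mpoly_eq_add (X : ι → Ω → ℝ) {U : Finset ι} {j : ι} (hj : j ∈ U) (c : Finset ι → ℝ)
    (ω : Ω) : mpoly X U c ω = mpoly X (U.erase j) c ω + X j ω * mderiv X U c j ω := by
  conv_lhs => rw [← Finset.insert_erase hj]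
  rw [mpoly_insert X (Finset.notMem_erase j U), mderiv]

lemma mul_mderiv (X : ι → Ω → ℝ) {U : Finset ι} {j : ι} (hj : j ∈ U) (c : Finset ι → ℝ) (ω : Ω) :
    X j ω * mderiv X U c j ω = ∑ A ∈ U.powerset with j ∈ A, c A * ∏ k ∈ A, X k ω := by
  rw [← sum_powerset_erase_insert hj fun A => c A * ∏ k ∈ A, X k ω, mderiv, mpoly, Finset.mul_sum]
  refine Finset.sum_congr rfl fun A hA => ?_
  rw [Finset.prod_insert fun h => Finset.notMem_erase j U (Finset.mem_powerset.1 hA h)]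
  ring

/-- Euler's identity for homogeneous multilinear polynomials. -/
lemma sum_mul_mderiv (X : ι → Ω → ℝ) {U : Finset ι} {c : Finset ι → ℝ} {q : ℕ}
    (hc : ∀ A ⊆ U, c A ≠ 0 → A.card = q) (ω : Ω) :
    ∑ j ∈ U, X j ω * mderiv X U c j ω = q * mpoly X U c ω := by
  rw [Finset.sum_congr rfl fun j hj => mul_mderiv X hj c ω, mpoly]
  exact sum_sum_mem_powerset_of_homogeneous hc fun A h => by rw [h, zero_mul]

lemma mul_sub_eq_sum_stein (h : ℝ → ℝ) (X : ι → Ω → ℝ) {U : Finset ι} {c : Finset ι → ℝ} {q : ℕ}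
    (hc : ∀ A ⊆ U, c A ≠ 0 → A.card = q) (ω : Ω) :
    q * (h (mpoly X U c ω) - ∫ x, h x ∂gaussianReal 0 1)
      = ∑ j ∈ U, (mderiv X U c j ω ^ 2 * steinDeriv h (mpoly X U c ω)
          - X j ω * mderiv X U c j ω * steinSol h (mpoly X U c ω))
        - (∑ j ∈ U, mderiv X U c j ω ^ 2 - q) * steinDeriv h (mpoly X U c ω) := by
  rw [Finset.sum_sub_distrib, ← Finset.sum_mul, ← Finset.sum_mul, sum_mul_mderiv X hc, steinDeriv]
  ring

namespace IsStdIndep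

variable [MeasurableSpace Ω] {P : Measure Ω} [IsProbabilityMeasure P] {X : ι → Ω → ℝ} {M : ℝ}
  {h : ℝ → ℝ} {j : ι}

lemma integrable_mderiv_pow (hX : IsStdIndep P X M) (U : Finset ι) (c : Finset ι → ℝ) (j : ι)
    {n : ℕ} (hn : n ≤ 4) : Integrable (fun ω => mderiv X U c j ω ^ n) P :=
  hX.integrable_mpoly_pow _ _ hn

lemma integral_mderiv_sq (hX : IsStdIndep P X M) {U : Finset ι} (c : Finset ι → ℝ) (hj : j ∈ U) :
    ∫ ω, mderiv X U c j ω ^ 2 ∂P = influence U c j := by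
  rw [mderiv, hX.integral_mpoly_sq, influence, sum_powerset_erase_insert hj fun A => c A ^ 2]

variable {U : Finset ι} {c : Finset ι → ℝ} {q : ℕ}

lemma integral_mderiv_pow_four_le (hX : IsStdIndep P X M) (hj : j ∈ U)
    (hc : ∀ A ⊆ U, c A ≠ 0 → A.card = q) :
    ∫ ω, mderiv X U c j ω ^ 4 ∂P ≤ (16 * M) ^ (q - 1) * influence U c j ^ 2 := by
  have : Nonempty ι := ⟨j⟩
  rw [influence, ← sum_powerset_erase_insert hj fun A => c A ^ 2]
  refine hX.integral_mpoly_pow_four_le _ _ _ fun A hA h => ?_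
  have := hc (insert j A) (Finset.insert_subset hj (hA.trans (Finset.erase_subset j U))) h
  rw [Finset.card_insert_of_notMem fun h => Finset.notMem_erase j U (hA h)] at this
  exact (Nat.eq_sub_of_add_eq this).le

lemma integral_abs_mderiv_cube_le (hX : IsStdIndep P X M) (hj : j ∈ U)
    (hc : ∀ A ⊆ U, c A ≠ 0 → A.card = q) {τ : ℝ} (hτ : 0 < τ) (h : influence U c j ≤ τ) :
    ∫ ω, |mderiv X U c j ω| ^ 3 ∂P ≤ √τ * (16 * M) ^ (q - 1) * influence U c j := by
  have : Nonempty ι := ⟨j⟩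
  have h0 := influence_nonneg U c j
  have hκ : 1 ≤ (16 * M) ^ (q - 1) := one_le_pow₀ (by linarith [hX.one_le])
  have hs := Real.sqrt_pos.2 hτ
  calc ∫ ω, |mderiv X U c j ω| ^ 3 ∂P
      ≤ (√τ * influence U c j + (√τ)⁻¹ * ∫ ω, mderiv X U c j ω ^ 4 ∂P) / 2 := by
        rw [← hX.integral_mderiv_sq c hj]
        exact CombCLT.integral_abs_cube_le (hX.measurable_mpoly _ _)
          (hX.integrable_mderiv_pow U c j le_rfl) hs
    _ ≤ (√τ * ((16 * M) ^ (q - 1) * influence U c j)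
          + (√τ)⁻¹ * ((16 * M) ^ (q - 1) * (√τ ^ 2 * influence U c j))) / 2 := by
        rw [Real.sq_sqrt hτ.le]
        gcongr
        · exact le_mul_of_one_le_left h0 hκ
        · refine (hX.integral_mderiv_pow_four_le hj hc).trans ?_
          rw [sq]
          gcongr
    _ = √τ * (16 * M) ^ (q - 1) * influence U c j := by
        field_simp
        ring

lemma integrable_stein_local (hX : IsStdIndep P X M) (hh : LipschitzWith 1 h) (U : Finset ι)
    (c : Finset ι → ℝ) (j : ι) :
    Integrable (fun ω => mderiv X U c j ω ^ 2 * steinDeriv h (mpoly X U c ω)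
      - X j ω * mderiv X U c j ω * steinSol h (mpoly X U c ω)) P :=
  (integrable_mul_steinDeriv hh (hX.integrable_mderiv_pow U c j (by decide))
    (hX.measurable_mpoly U c)).sub (integrable_mul_steinSol hh (hX.integrable_mul'
      (measurable_mderiv_sigmaExcept X U c j) (hX.integrable_mpoly _ _)) (hX.measurable_mpoly U c))

lemma abs_integral_stein_local_le (hX : IsStdIndep P X M) (hh : LipschitzWith 1 h)
    (c : Finset ι → ℝ) (hj : j ∈ U) :
    |∫ ω, (mderiv X U c j ω ^ 2 * steinDeriv h (mpoly X U c ω)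
        - X j ω * mderiv X U c j ω * steinSol h (mpoly X U c ω)) ∂P|
      ≤ 2 * steinLip * M * ∫ ω, |mderiv X U c j ω| ^ 3 ∂P := by
  have iD4 := hX.integrable_mderiv_pow U c j le_rfl
  have mD := measurable_mderiv_sigmaExcept X U c j
  simp only [mpoly_eq_add X hj c]
  rw [hX.integral_stein_local_eq hh
    (measurable_mpoly_sigmaExcept X (Finset.notMem_erase j U) c) mD iD4]
  exact hX.integral_abs_steinRemainder_le hh _ mD iD4

lemma abs_sum_integral_stein_local_le (hX : IsStdIndep P X M) (hh : LipschitzWith 1 h)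
    (hc : ∀ A ⊆ U, c A ≠ 0 → A.card = q) {τ : ℝ} (hτ : 0 < τ)
    (hinf : ∀ j ∈ U, influence U c j ≤ τ) :
    |∑ j ∈ U, ∫ ω, (mderiv X U c j ω ^ 2 * steinDeriv h (mpoly X U c ω)
        - X j ω * mderiv X U c j ω * steinSol h (mpoly X U c ω)) ∂P|
      ≤ q * (2 * steinLip * M * (16 * M) ^ (q - 1) * √τ * ∑ A ∈ U.powerset, c A ^ 2) := by
  refine (Finset.abs_sum_le_sum_abs _ _).trans ?_
  calc ∑ j ∈ U, |∫ ω, (mderiv X U c j ω ^ 2 * steinDeriv h (mpoly X U c ω)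
          - X j ω * mderiv X U c j ω * steinSol h (mpoly X U c ω)) ∂P|
      ≤ ∑ j ∈ U, 2 * steinLip * M * (√τ * (16 * M) ^ (q - 1) * influence U c j) := by
        refine Finset.sum_le_sum fun j hj => (hX.abs_integral_stein_local_le hh c hj).trans ?_
        have : Nonempty ι := ⟨j⟩
        have := hX.one_le
        have := steinLip_pos
        gcongr
        exact hX.integral_abs_mderiv_cube_le hj hc hτ (hinf j hj)
    _ = q * (2 * steinLip * M * (16 * M) ^ (q - 1) * √τ * ∑ A ∈ U.powerset, c A ^ 2) := by
        rw [← Finset.mul_sum, ← Finset.mul_sum, sum_influence hc]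
        ring

lemma abs_integral_sub_integral_gaussian_le (hX : IsStdIndep P X M) (hh : LipschitzWith 1 h)
    (hq : 1 ≤ q) (hc : ∀ A ⊆ U, c A ≠ 0 → A.card = q) {τ : ℝ} (hτ : 0 < τ)
    (hinf : ∀ j ∈ U, influence U c j ≤ τ) :
    |∫ ω, h (mpoly X U c ω) ∂P - ∫ x, h x ∂gaussianReal 0 1|
      ≤ 6 * ∫ ω, |∑ j ∈ U, mderiv X U c j ω ^ 2 - q| ∂P
        + 2 * steinLip * M * (16 * M) ^ (q - 1) * √τ * ∑ A ∈ U.powerset, c A ^ 2 := by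
  have iV : Integrable (fun ω => ∑ j ∈ U, mderiv X U c j ω ^ 2 - q) P :=
    (integrable_finsetSum _ fun j _ => hX.integrable_mderiv_pow U c j (by decide)).sub
      (integrable_const _)
  have iVf := integrable_mul_steinDeriv hh iV (hX.measurable_mpoly U c)
  have stein_identity : q * (∫ ω, h (mpoly X U c ω) ∂P - ∫ x, h x ∂gaussianReal 0 1)
      = ∑ j ∈ U, ∫ ω, (mderiv X U c j ω ^ 2 * steinDeriv h (mpoly X U c ω)
          - X j ω * mderiv X U c j ω * steinSol h (mpoly X U c ω)) ∂P
        - ∫ ω, (∑ j ∈ U, mderiv X U c j ω ^ 2 - q) * steinDeriv h (mpoly X U c ω) ∂P := by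
    have iloc := fun j => hX.integrable_stein_local hh U c j
    rw [← integral_finsetSum _ fun j _ => iloc j,
      ← integral_sub (integrable_finsetSum _ fun j _ => iloc j) iVf]
    simp only [← mul_sub_eq_sum_stein h X hc]
    rw [integral_const_mul, integral_sub
      (integrable_comp_of_lipschitz hh (hX.integrable_mpoly U c)) (integrable_const _)]
    simp
  have variance_le :
      |∫ ω, (∑ j ∈ U, mderiv X U c j ω ^ 2 - q) * steinDeriv h (mpoly X U c ω) ∂P|
        ≤ q * (6 * ∫ ω, |∑ j ∈ U, mderiv X U c j ω ^ 2 - q| ∂P) := by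
    calc |∫ ω, (∑ j ∈ U, mderiv X U c j ω ^ 2 - q) * steinDeriv h (mpoly X U c ω) ∂P|
        ≤ ∫ ω, 6 * |∑ j ∈ U, mderiv X U c j ω ^ 2 - q| ∂P := by
          refine abs_integral_le_integral_abs.trans
            (integral_mono iVf.abs (iV.abs.const_mul 6) fun ω => ?_)
          simp only [abs_mul]
          rw [mul_comm]
          exact mul_le_mul_of_nonneg_right (abs_steinDeriv_le hh _) (abs_nonneg _)
      _ = 6 * ∫ ω, |∑ j ∈ U, mderiv X U c j ω ^ 2 - q| ∂P := integral_const_mul _ _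
      _ ≤ q * (6 * ∫ ω, |∑ j ∈ U, mderiv X U c j ω ^ 2 - q| ∂P) :=
          le_mul_of_one_le_left (by positivity) (Nat.one_le_cast.2 hq)
  have q_pos : (0 : ℝ) < q := by exact_mod_cast hq
  refine le_of_mul_le_mul_left ?_ q_pos
  calc q * |∫ ω, h (mpoly X U c ω) ∂P - ∫ x, h x ∂gaussianReal 0 1|
      = |q * (∫ ω, h (mpoly X U c ω) ∂P - ∫ x, h x ∂gaussianReal 0 1)| := by
        rw [abs_mul, abs_of_pos q_pos]
    _ ≤ _ := by
        rw [stein_identity, add_comm, mul_add]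
        exact (abs_sub _ _).trans (add_le_add
          (hX.abs_sum_integral_stein_local_le hh hc hτ hinf) variance_le)

end IsStdIndep

end SteinMethod

/-! ### Pairs of index sets with the same differences -/

section PairTerms

lemma sum_filter_product_eq_sum_image_sq {κ β R : Type*} [DecidableEq β] [CommSemiring R]
    (I : Finset κ) (f : κ → β) (a : κ → R) :
    ∑ p ∈ I ×ˢ I with f p.1 = f p.2, a p.1 * a p.2
      = ∑ x ∈ I.image f, (∑ i ∈ I with f i = x, a i) ^ 2 := by
  rw [Finset.sum_filter, Finset.sum_product,
    ← Finset.sum_fiberwise_of_maps_to (t := I.image f) fun i => Finset.mem_image_of_mem f]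
  refine Finset.sum_congr rfl fun x _ => ?_
  rw [sq, Finset.sum_mul_sum]
  refine Finset.sum_congr rfl fun i hi => ?_
  rw [Finset.sum_filter]
  exact Finset.sum_congr rfl fun i' _ => by simp only [(Finset.mem_filter.1 hi).2, eq_comm]

lemma sum_filter_comp_product_le {κ β γ : Type*} [DecidableEq β] [DecidableEq γ] (I : Finset κ)
    (f : κ → β) (g : β → γ) (a : κ → ℝ) {N : ℕ}
    (hN : ∀ x ∈ I.image f, ((I.image f).filter fun y => g y = g x).card ≤ N) :
    ∑ p ∈ I ×ˢ I with g (f p.1) = g (f p.2), a p.1 * a p.2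
      ≤ N * ∑ p ∈ I ×ˢ I with f p.1 = f p.2, a p.1 * a p.2 := by
  have refine_fiber : ∀ w, ∑ i ∈ I with g (f i) = w, a i
      = ∑ x ∈ I.image f with g x = w, ∑ i ∈ I with f i = x, a i := fun w => by
    rw [← Finset.sum_fiberwise_of_maps_to (g := f) (t := (I.image f).filter fun x => g x = w)]
    · refine Finset.sum_congr rfl fun x hx => ?_
      rw [Finset.filter_filter]
      refine Finset.sum_congr (Finset.filter_congr fun i _ => ?_) fun _ _ => rfl
      exact and_iff_right_of_imp fun h => h ▸ (Finset.mem_filter.1 hx).2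
    · intro i hi
      obtain ⟨hi, hw⟩ := Finset.mem_filter.1 hi
      exact Finset.mem_filter.2 ⟨Finset.mem_image_of_mem f hi, hw⟩
  rw [sum_filter_product_eq_sum_image_sq I (fun i => g (f i)) a,
    sum_filter_product_eq_sum_image_sq I f a, Finset.mul_sum,
    ← Finset.sum_fiberwise_of_maps_to (s := I.image f) (g := g)
      (t := I.image fun i => g (f i)) fun x hx => ?_]
  · refine Finset.sum_le_sum fun w hw => ?_
    obtain ⟨i, hi, rfl⟩ := Finset.mem_image.1 hw
    rw [refine_fiber, ← Finset.mul_sum]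
    refine sq_sum_le_card_mul_sum_sq.trans (mul_le_mul_of_nonneg_right ?_ ?_)
    · exact_mod_cast hN _ (Finset.mem_image_of_mem f hi)
    · exact Finset.sum_nonneg fun _ _ => sq_nonneg _
  · obtain ⟨i, hi, rfl⟩ := Finset.mem_image.1 hx
    exact Finset.mem_image_of_mem _ hi

lemma eq_of_sdiff_eq_sdiff {α : Type*} [GeneralizedBooleanAlgebra α] {a b c : α}
    (h₁ : a \ c = b \ c) (h₂ : c \ a = c \ b) : a = b :=
  eq_of_inf_eq_sup_eq (a := c) (by simpa only [inf_comm] using sdiff_eq_sdiff_iff_inf_eq_inf.1 h₂)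
    (by rw [← sdiff_sup_self c a, h₁, sdiff_sup_self])

variable {ι : Type*} [DecidableEq ι]

/-- Triples `((A, B), T)` of finite sets. -/
abbrev PairTerm (ι : Type*) := Σ _ : Finset ι × Finset ι, Finset ι

/-- The triples `((A, B), T)` with `A, B ∈ 𝒦` and `T ⊂ A ∩ B`. They index the expansion of the sum
of the squares of the partial derivatives of a multilinear polynomial with support `𝒦`. -/
def pairTerms (𝒦 : Finset (Finset ι)) : Finset (PairTerm ι) :=
  (𝒦 ×ˢ 𝒦).sigma fun p => (p.1 ∩ p.2).ssubsets

/-- The key `(A \ B, B \ A, T)` of a triple `((A, B), T)`. The random monomials of two triples are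
orthogonal unless the keys have the same union. -/
def pairKey (i : PairTerm ι) : Finset ι × Finset ι × Finset ι :=
  (i.1.1 \ i.1.2, i.1.2 \ i.1.1, i.2)

/-- The union of the three sets of a key. -/
def keySupport (x : Finset ι × Finset ι × Finset ι) : Finset ι := x.1 ∪ x.2.1 ∪ x.2.2

/-- The triples whose random monomial is not constant. -/
def properTerms (𝒦 : Finset (Finset ι)) : Finset (PairTerm ι) :=
  (pairTerms 𝒦).filter fun i => keySupport (pairKey i) ≠ ∅

/-- The pairs of nonconstant triples with the same key. -/
def sameKeyPairs (𝒦 : Finset (Finset ι)) :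
    Finset (PairTerm ι × PairTerm ι) :=
  (properTerms 𝒦 ×ˢ properTerms 𝒦).filter fun p => pairKey p.1 = pairKey p.2

/-- A pair of disjoint sets whose union is also that of another pair of members of `𝒦`; these are
the pairs forming `K^#`. -/
def IsSharpPair (𝒦 : Finset (Finset ι)) (p : Finset ι × Finset ι) : Prop :=
  Disjoint p.1 p.2 ∧ ∃ C ∈ 𝒦, ∃ D ∈ 𝒦, C ∪ D = p.1 ∪ p.2 ∧ C ≠ p.1 ∧ C ≠ p.2

instance (𝒦 : Finset (Finset ι)) : DecidablePred (IsSharpPair 𝒦) := fun p =>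
  inferInstanceAs (Decidable (Disjoint p.1 p.2 ∧ _))

/-- The total squared weight of the pairs forming `K^#`. -/
noncomputable def sharpSum (𝒦 : Finset (Finset ι)) (c : Finset ι → ℝ) : ℝ :=
  ∑ p ∈ 𝒦 ×ˢ 𝒦 with IsSharpPair 𝒦 p, c p.1 ^ 2 * c p.2 ^ 2

/-- On its support, `c A` is proportional to a product over the elements of `A`. -/
def IsProductType (c : Finset ι → ℝ) : Prop :=
  ∃ (a : ℝ) (b : ι → ℝ), ∀ A, c A ≠ 0 → c A = a * ∏ k ∈ A, b k

variable {𝒦 : Finset (Finset ι)} {c : Finset ι → ℝ} {q : ℕ}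

lemma IsProductType.mul_eq_mul (hc : IsProductType c) {A B A' B' : Finset ι} (hA : c A ≠ 0)
    (hB : c B ≠ 0) (hA' : c A' ≠ 0) (hB' : c B' ≠ 0) (h₁ : A \ B = A' \ B')
    (h₂ : B \ A = B' \ A') : c A * c B' = c A' * c B := by
  obtain ⟨a, b, hab⟩ := hc
  rw [hab A hA, hab B hB, hab A' hA', hab B' hB', ← Finset.prod_inter_mul_prod_sdiff A B,
    ← Finset.prod_inter_mul_prod_sdiff B A, ← Finset.prod_inter_mul_prod_sdiff A' B',
    ← Finset.prod_inter_mul_prod_sdiff B' A', h₁, h₂, Finset.inter_comm B A,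
    Finset.inter_comm B' A']
  ring

lemma mem_pairTerms {A B T : Finset ι} :
    ⟨(A, B), T⟩ ∈ pairTerms 𝒦
      ↔ A ∈ 𝒦 ∧ B ∈ 𝒦 ∧ T ⊂ A ∩ B := by
  simp only [pairTerms, Finset.mem_sigma, Finset.mem_product, Finset.mem_ssubsets, and_assoc]

lemma card_keySupport_pairKey_le (h𝒦 : ∀ A ∈ 𝒦, A.card = q)
    {i : PairTerm ι} (hi : i ∈ pairTerms 𝒦) :
    (keySupport (pairKey i)).card ≤ 2 * q := by
  obtain ⟨⟨A, B⟩, T⟩ := i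
  obtain ⟨hA, hB, hT⟩ := mem_pairTerms.1 hi
  have support_subset : keySupport (pairKey ⟨(A, B), T⟩) ⊆ A ∪ B :=
    Finset.union_subset (Finset.union_subset (Finset.sdiff_subset.trans Finset.subset_union_left)
      (Finset.sdiff_subset.trans Finset.subset_union_right))
      (hT.1.trans (Finset.inter_subset_left.trans Finset.subset_union_left))
  calc (keySupport (pairKey ⟨(A, B), T⟩)).card ≤ (A ∪ B).card := Finset.card_le_card support_subset
    _ ≤ A.card + B.card := Finset.card_union_le _ _
    _ = 2 * q := by rw [h𝒦 A hA, h𝒦 B hB, two_mul]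

lemma card_filter_keySupport_eq_le (J : Finset (Finset ι × Finset ι × Finset ι)) (W : Finset ι) :
    (J.filter fun x => keySupport x = W).card ≤ 8 ^ W.card := by
  calc (J.filter fun x => keySupport x = W).card
      ≤ (W.powerset ×ˢ W.powerset ×ˢ W.powerset).card := by
        refine Finset.card_le_card fun x hx => ?_
        obtain ⟨-, rfl⟩ := Finset.mem_filter.1 hx
        simp only [Finset.mem_product, Finset.mem_powerset, keySupport]
        exact ⟨Finset.subset_union_left.trans Finset.subset_union_left,
          Finset.subset_union_right.trans Finset.subset_union_left, Finset.subset_union_right⟩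
    _ = 8 ^ W.card := by
        rw [Finset.card_product, Finset.card_product, Finset.card_powerset, ← mul_pow, ← mul_pow]
        norm_num

lemma mem_sameKeyPairs {A B T A' B' T' : Finset ι} :
    ((⟨(A, B), T⟩, ⟨(A', B'), T'⟩) : PairTerm ι × PairTerm ι) ∈ sameKeyPairs 𝒦
      ↔ (A ∈ 𝒦 ∧ B ∈ 𝒦 ∧ A' ∈ 𝒦 ∧ B' ∈ 𝒦) ∧ (T ⊂ A ∩ B ∧ T' ⊂ A' ∩ B')
        ∧ (A \ B = A' \ B' ∧ B \ A = B' \ A' ∧ T = T') ∧ ¬ (A = B ∧ T = ∅) := by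
  have empty_iff : ∀ A B T : Finset ι, keySupport (pairKey ⟨(A, B), T⟩) = ∅ ↔ A = B ∧ T = ∅ := by
    intro A B T
    simp only [keySupport, pairKey, Finset.union_eq_empty, Finset.sdiff_eq_empty_iff_subset]
    exact and_congr_left' ⟨fun h => h.1.antisymm h.2, fun h => ⟨h.subset, h.superset⟩⟩
  have key_iff : (pairKey ⟨(A, B), T⟩ = pairKey ⟨(A', B'), T'⟩)
      ↔ A \ B = A' \ B' ∧ B \ A = B' \ A' ∧ T = T' := by
    simp only [pairKey, Prod.mk.injEq]
  simp only [sameKeyPairs, properTerms, Finset.mem_filter, Finset.mem_product, mem_pairTerms]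
  constructor
  · rintro ⟨⟨⟨⟨hA, hB, hT⟩, hne⟩, ⟨hA', hB', hT'⟩, -⟩, hkey⟩
    exact ⟨⟨hA, hB, hA', hB'⟩, ⟨hT, hT'⟩, key_iff.1 hkey, (empty_iff A B T).not.1 hne⟩
  · rintro ⟨⟨hA, hB, hA', hB'⟩, ⟨hT, hT'⟩, hkey, hne⟩
    have hne := (empty_iff A B T).not.2 hne
    exact ⟨⟨⟨⟨hA, hB, hT⟩, hne⟩, ⟨hA', hB', hT'⟩, key_iff.2 hkey ▸ hne⟩, key_iff.2 hkey⟩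

/-- The crossed pair `(A, B')` of two triples with the same key is sharp as soon as it is disjoint,
since then `A' ∪ B = A ∪ B'`. -/
lemma isSharpPair_of_mem_sameKeyPairs {A B T A' B' T' : Finset ι}
    (h : ((⟨(A, B), T⟩, ⟨(A', B'), T'⟩) : PairTerm ι × PairTerm ι)
      ∈ sameKeyPairs 𝒦) (hd : Disjoint A B') : IsSharpPair 𝒦 (A, B') := by
  obtain ⟨⟨-, hB, hA', -⟩, ⟨hT, hT'⟩, ⟨h₁, h₂, rfl⟩, hne⟩ := mem_sameKeyPairs.1 h
  simp only [Finset.ext_iff, Finset.mem_sdiff] at h₁ h₂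
  have not_both := Finset.disjoint_left.1 hd
  refine ⟨hd, A', hA', B, hB, ?_, ?_, ?_⟩
  · ext k
    have := h₁ k
    have := h₂ k
    simp only [Finset.mem_union]
    tauto
  · rintro rfl
    obtain ⟨j, hj, -⟩ := Finset.exists_of_ssubset hT
    obtain ⟨hjA, hjB⟩ := Finset.mem_inter.1 hj
    have := h₁ j
    exact not_both hjA (by tauto)
  · rintro rfl
    refine hne ⟨Finset.ext fun k => ?_, Finset.eq_empty_of_forall_notMem fun k hk => ?_⟩
    · have := h₁ k
      have := h₂ k
      tauto
    · exact not_both (Finset.mem_inter.1 (hT.1 hk)).1 (Finset.mem_inter.1 (hT'.1 hk)).2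

lemma card_filter_sameKeyPairs_le {A B' : Finset ι} (hA : A.card = q) (hB' : B'.card = q) :
    ((sameKeyPairs 𝒦).filter fun p => (p.1.1.1, p.2.1.2) = (A, B')).card ≤ 8 ^ q := by
  have card_target : (A.powerset ×ˢ B'.powerset ×ˢ A.powerset).card = 8 ^ q := by
    rw [Finset.card_product, Finset.card_product, Finset.card_powerset, Finset.card_powerset, hA,
      hB', ← mul_pow, ← mul_pow]
    norm_num
  rw [← card_target]
  refine Finset.card_le_card_of_injOn (fun p => pairKey p.1) ?_ ?_
  · rintro ⟨⟨⟨A, B⟩, T⟩, ⟨A', B'⟩, T'⟩ hp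
    simp only [Finset.coe_filter, Set.mem_ofPred_eq, Prod.mk.injEq] at hp
    obtain ⟨hp, rfl, rfl⟩ := hp
    obtain ⟨-, ⟨hT, -⟩, ⟨-, h₂, -⟩, -⟩ := mem_sameKeyPairs.1 hp
    simp only [pairKey, Finset.coe_product, Set.mem_prod, Finset.mem_coe, Finset.mem_powerset]
    exact ⟨Finset.sdiff_subset, h₂ ▸ Finset.sdiff_subset, hT.1.trans Finset.inter_subset_left⟩
  · rintro ⟨⟨⟨A₁, B₁⟩, T₁⟩, ⟨A₁', B₁'⟩, T₁'⟩ hp₁ ⟨⟨⟨A₂, B₂⟩, T₂⟩, ⟨A₂', B₂'⟩, T₂'⟩ hp₂ heq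
    simp only [Finset.coe_filter, Set.mem_ofPred_eq, Prod.mk.injEq] at hp₁ hp₂
    obtain ⟨hp₁, rfl, rfl⟩ := hp₁
    obtain ⟨hp₂, rfl, rfl⟩ := hp₂
    obtain ⟨-, -, ⟨h₁, h₂, rfl⟩, -⟩ := mem_sameKeyPairs.1 hp₁
    obtain ⟨-, -, ⟨h₃, h₄, rfl⟩, -⟩ := mem_sameKeyPairs.1 hp₂
    simp only [pairKey, Prod.mk.injEq] at heq
    obtain ⟨h₅, h₆, rfl⟩ := heq
    obtain rfl := eq_of_sdiff_eq_sdiff h₆ h₅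
    obtain rfl := eq_of_sdiff_eq_sdiff (h₁.symm.trans h₃) (h₂.symm.trans h₄)
    rfl

lemma sum_sameKeyPairs_le (h𝒦 : ∀ A ∈ 𝒦, A.card = q) (hne : ∀ A ∈ 𝒦, c A ≠ 0)
    (hc : IsProductType c) :
    ∑ p ∈ sameKeyPairs 𝒦, |c p.1.1.1 * c p.1.1.2| * |c p.2.1.1 * c p.2.1.2|
      ≤ 8 ^ q * (sharpSum 𝒦 c
        + ∑ p ∈ 𝒦 ×ˢ 𝒦 with ¬ Disjoint p.1 p.2, c p.1 ^ 2 * c p.2 ^ 2) := by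
  set crossed := (𝒦 ×ˢ 𝒦).filter fun p => IsSharpPair 𝒦 p ∨ ¬ Disjoint p.1 p.2
  have maps_to : ∀ p ∈ sameKeyPairs 𝒦, (p.1.1.1, p.2.1.2) ∈ crossed := by
    rintro ⟨⟨⟨A, B⟩, T⟩, ⟨A', B'⟩, T'⟩ hp
    obtain ⟨⟨hA, -, -, hB'⟩, -⟩ := mem_sameKeyPairs.1 hp
    refine Finset.mem_filter.2 ⟨Finset.mk_mem_product hA hB', ?_⟩
    exact or_not_of_imp (isSharpPair_of_mem_sameKeyPairs hp)
  have summand_eq : ∀ p ∈ sameKeyPairs 𝒦, |c p.1.1.1 * c p.1.1.2| * |c p.2.1.1 * c p.2.1.2|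
      = c p.1.1.1 ^ 2 * c p.2.1.2 ^ 2 := by
    rintro ⟨⟨⟨A, B⟩, T⟩, ⟨A', B'⟩, T'⟩ hp
    obtain ⟨⟨hA, hB, hA', hB'⟩, -, ⟨h₁, h₂, -⟩, -⟩ := mem_sameKeyPairs.1 hp
    have := hc.mul_eq_mul (hne A hA) (hne B hB) (hne A' hA') (hne B' hB') h₁ h₂
    calc |c A * c B| * |c A' * c B'| = |(c A' * c B) * (c A * c B')| := by
          rw [← abs_mul]
          congr 1
          ring
      _ = c A ^ 2 * c B' ^ 2 := by rw [← this, abs_mul_self, ← sq, mul_pow]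
  have sq_nonneg' : ∀ p : Finset ι × Finset ι, 0 ≤ c p.1 ^ 2 * c p.2 ^ 2 := fun p => by positivity
  calc ∑ p ∈ sameKeyPairs 𝒦, |c p.1.1.1 * c p.1.1.2| * |c p.2.1.1 * c p.2.1.2|
      = ∑ x ∈ crossed, ∑ p ∈ sameKeyPairs 𝒦 with (p.1.1.1, p.2.1.2) = x,
          c p.1.1.1 ^ 2 * c p.2.1.2 ^ 2 := by
        rw [Finset.sum_congr rfl summand_eq, Finset.sum_fiberwise_of_maps_to maps_to]
    _ ≤ ∑ x ∈ crossed, 8 ^ q * (c x.1 ^ 2 * c x.2 ^ 2) := by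
        refine Finset.sum_le_sum fun x hx => ?_
        obtain ⟨hA, hB'⟩ := Finset.mem_product.1 (Finset.mem_filter.1 hx).1
        have summand_const : ∀ p ∈ (sameKeyPairs 𝒦).filter fun p => (p.1.1.1, p.2.1.2) = x,
            c p.1.1.1 ^ 2 * c p.2.1.2 ^ 2 = c x.1 ^ 2 * c x.2 ^ 2 := fun p hp => by
          rw [← (Finset.mem_filter.1 hp).2]
        rw [Finset.sum_congr rfl summand_const, Finset.sum_const, nsmul_eq_mul]
        refine mul_le_mul_of_nonneg_right ?_ (sq_nonneg' x)
        exact_mod_cast card_filter_sameKeyPairs_le (h𝒦 _ hA) (h𝒦 _ hB')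
    _ ≤ 8 ^ q * (sharpSum 𝒦 c
          + ∑ p ∈ 𝒦 ×ˢ 𝒦 with ¬ Disjoint p.1 p.2, c p.1 ^ 2 * c p.2 ^ 2) := by
        rw [← Finset.mul_sum, show crossed = _ from Finset.filter_or _ _ _, sharpSum,
          ← Finset.sum_union_inter]
        gcongr
        exact le_add_of_nonneg_right (Finset.sum_nonneg fun x _ => sq_nonneg' x)

lemma sum_not_disjoint_le {U : Finset ι} (hU : ∀ A ∈ 𝒦, A ⊆ U) (h𝒦 : ∀ A ∈ 𝒦, A.card = q)
    {τ : ℝ} (hinf : ∀ j ∈ U, influence U c j ≤ τ) :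
    ∑ p ∈ 𝒦 ×ˢ 𝒦 with ¬ Disjoint p.1 p.2, c p.1 ^ 2 * c p.2 ^ 2
      ≤ q * τ * ∑ A ∈ 𝒦, c A ^ 2 := by
  have union_bound : ∀ A B : Finset ι, (if ¬ Disjoint A B then c A ^ 2 * c B ^ 2 else 0)
      ≤ ∑ j ∈ A, if j ∈ B then c A ^ 2 * c B ^ 2 else 0 := fun A B => by
    have nonneg : ∀ j ∈ A, 0 ≤ if j ∈ B then c A ^ 2 * c B ^ 2 else 0 := fun j _ => by
      split_ifs <;> positivity
    split_ifs with hd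
    · exact Finset.sum_nonneg nonneg
    · obtain ⟨j, hjA, hjB⟩ := Finset.not_disjoint_iff.1 hd
      simpa only [if_pos hjB] using Finset.single_le_sum nonneg hjA
  have sum_mem_le : ∀ j ∈ U, ∑ B ∈ 𝒦 with j ∈ B, c B ^ 2 ≤ τ := fun j hj =>
    (Finset.sum_le_sum_of_subset_of_nonneg
      (Finset.filter_subset_filter _ fun B hB => Finset.mem_powerset.2 (hU B hB))
      fun _ _ _ => sq_nonneg _).trans (hinf j hj)
  rw [Finset.sum_filter, Finset.sum_product, Finset.mul_sum]
  refine Finset.sum_le_sum fun A hA => ?_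
  calc ∑ B ∈ 𝒦, (if ¬ Disjoint A B then c A ^ 2 * c B ^ 2 else 0)
      ≤ ∑ B ∈ 𝒦, ∑ j ∈ A, (if j ∈ B then c A ^ 2 * c B ^ 2 else 0) :=
        Finset.sum_le_sum fun B _ => union_bound A B
    _ = ∑ j ∈ A, c A ^ 2 * ∑ B ∈ 𝒦 with j ∈ B, c B ^ 2 := by
        rw [Finset.sum_comm]
        exact Finset.sum_congr rfl fun _ _ => by rw [Finset.mul_sum, Finset.sum_filter]
    _ ≤ ∑ _ ∈ A, c A ^ 2 * τ := Finset.sum_le_sum fun j hj =>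
        mul_le_mul_of_nonneg_left (sum_mem_le j (hU A hA hj)) (sq_nonneg _)
    _ = q * τ * c A ^ 2 := by
        rw [Finset.sum_const, nsmul_eq_mul, h𝒦 A hA]
        ring

end PairTerms

/-! ### The variance of the sum of the squares of the partial derivatives -/

section SumOfSquares

variable {ι Ω : Type*}

/-- The product of the first Hermite polynomials of the variables in `D` and the second ones of the
variables in `T`. -/
noncomputable def hermiteMonomial (X : ι → Ω → ℝ) (D T : Finset ι) (ω : Ω) : ℝ :=
  (∏ k ∈ D, X k ω) * ∏ k ∈ T, (X k ω ^ 2 - 1)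

lemma hermiteMonomial_empty (X : ι → Ω → ℝ) (ω : Ω) : hermiteMonomial X ∅ ∅ ω = 1 := by
  rw [hermiteMonomial, Finset.prod_empty, Finset.prod_empty, mul_one]

variable [DecidableEq ι]

/-- The factor of `hermiteMonomial X D T` in the `k`-th variable, for disjoint `D` and `T`. -/
noncomputable def hermiteFactor (D T : Finset ι) (k : ι) (t : ℝ) : ℝ :=
  if k ∈ D then t else if k ∈ T then t ^ 2 - 1 else 1

lemma hermiteMonomial_eq_prod (X : ι → Ω → ℝ) {D T U : Finset ι} (hDT : Disjoint D T)
    (hU : D ∪ T ⊆ U) (ω : Ω) :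
    hermiteMonomial X D T ω = ∏ k ∈ U, hermiteFactor D T k (X k ω) := by
  rw [← Finset.prod_subset hU fun k _ hk => ?_, Finset.prod_union hDT, hermiteMonomial]
  · congr 1
    · exact Finset.prod_congr rfl fun k hk => by rw [hermiteFactor, if_pos hk]
    · refine Finset.prod_congr rfl fun k hk => ?_
      rw [hermiteFactor, if_neg (Finset.disjoint_right.1 hDT hk), if_pos hk]
  · rw [Finset.mem_union, not_or] at hk
    rw [hermiteFactor, if_neg hk.1, if_neg hk.2]

lemma measurable_hermiteFactor (D T : Finset ι) (k : ι) : Measurable (hermiteFactor D T k) := by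
  unfold hermiteFactor
  split_ifs <;> fun_prop

lemma abs_hermiteFactor_le (D T : Finset ι) (k : ι) (t : ℝ) :
    |hermiteFactor D T k t| ≤ 1 + t ^ 2 := by
  unfold hermiteFactor
  split_ifs <;> rw [abs_le] <;> constructor <;> nlinarith [sq_nonneg (t - 1), sq_nonneg (t + 1)]

lemma prod_erase_mul_prod_erase (X : ι → Ω → ℝ) {A B : Finset ι} {j : ι} (hj : j ∈ A ∩ B) (ω : Ω) :
    (∏ k ∈ A.erase j, X k ω) * ∏ k ∈ B.erase j, X k ω
      = ∑ T ∈ ((A ∩ B).erase j).powerset, hermiteMonomial X (A \ B ∪ B \ A) T ω := by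
  have split_erase : ∀ {A B : Finset ι}, j ∈ A ∩ B → ∏ k ∈ A.erase j, X k ω
      = (∏ k ∈ A \ B, X k ω) * ∏ k ∈ (A ∩ B).erase j, X k ω := fun {A B} hj => by
    have hjAB : j ∉ A \ B := fun h => (Finset.mem_sdiff.1 h).2 (Finset.mem_inter.1 hj).2
    rw [← Finset.prod_union ((Finset.disjoint_sdiff_inter A B).mono_right
      (Finset.erase_subset _ _)), ← Finset.erase_eq_of_notMem hjAB, ← Finset.erase_union_distrib,
      Finset.sdiff_union_inter]
  have one_add : ∀ k, 1 + (X k ω ^ 2 - 1) = X k ω * X k ω := fun k => by ring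
  simp only [hermiteMonomial]
  rw [split_erase hj, split_erase (A := B) (B := A) (Finset.inter_comm A B ▸ hj),
    Finset.inter_comm B A, ← Finset.mul_sum, ← Finset.prod_one_add,
    Finset.prod_union disjoint_sdiff_sdiff]
  simp only [one_add, Finset.prod_mul_distrib]
  ring

lemma sum_prod_erase_mul_prod_erase (X : ι → Ω → ℝ) (A B : Finset ι) (ω : Ω) :
    ∑ j ∈ A ∩ B, (∏ k ∈ A.erase j, X k ω) * ∏ k ∈ B.erase j, X k ω
      = ∑ T ∈ (A ∩ B).ssubsets,
        ((A ∩ B) \ T).card * hermiteMonomial X (A \ B ∪ B \ A) T ω := by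
  rw [Finset.sum_congr rfl fun j hj => prod_erase_mul_prod_erase X hj ω,
    Finset.sum_comm' (t' := (A ∩ B).ssubsets) (s' := fun T => (A ∩ B) \ T) fun j T => ?_]
  · exact Finset.sum_congr rfl fun T _ => by rw [Finset.sum_const, nsmul_eq_mul]
  · rw [Finset.mem_powerset, Finset.subset_erase, Finset.mem_ssubsets, Finset.mem_sdiff]
    exact ⟨fun ⟨hj, hT, hjT⟩ => ⟨⟨hj, hjT⟩, hT, fun h => hjT (h hj)⟩,
      fun ⟨⟨hj, hjT⟩, hT⟩ => ⟨hj, hT.1, hjT⟩⟩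

/-- The index sets with nonzero coefficients. -/
noncomputable def coeffSupport (U : Finset ι) (c : Finset ι → ℝ) : Finset (Finset ι) :=
  U.powerset.filter fun A => c A ≠ 0

lemma mderiv_eq_sum_coeffSupport (X : ι → Ω → ℝ) {U : Finset ι} (c : Finset ι → ℝ) {j : ι}
    (hj : j ∈ U) (ω : Ω) :
    mderiv X U c j ω = ∑ A ∈ coeffSupport U c with j ∈ A, c A * ∏ k ∈ A.erase j, X k ω := by
  calc mderiv X U c j ω = ∑ A ∈ U.powerset with j ∈ A, c A * ∏ k ∈ A.erase j, X k ω := by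
        rw [← sum_powerset_erase_insert hj fun A => c A * ∏ k ∈ A.erase j, X k ω, mderiv, mpoly]
        refine Finset.sum_congr rfl fun A hA => ?_
        rw [Finset.erase_insert fun h => Finset.notMem_erase j U (Finset.mem_powerset.1 hA h)]
    _ = ∑ A ∈ coeffSupport U c with j ∈ A, c A * ∏ k ∈ A.erase j, X k ω := by
        rw [coeffSupport, Finset.filter_comm]
        exact (Finset.sum_filter_of_ne fun A _ h => left_ne_zero_of_mul h).symm

/-- The Hermite monomial of a triple. -/
noncomputable def pairMonomial (X : ι → Ω → ℝ) (i : PairTerm ι) : Ω → ℝ :=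
  hermiteMonomial X (i.1.1 \ i.1.2 ∪ i.1.2 \ i.1.1) i.2

/-- The coefficient of `pairMonomial X i` in the sum of the squares of the partial derivatives of
`mpoly X U c`: a triple `((A, B), T)` comes from every `j ∈ (A ∩ B) \ T`. -/
noncomputable def pairCoeff (c : Finset ι → ℝ) (i : PairTerm ι) : ℝ :=
  c i.1.1 * c i.1.2 * ((i.1.1 ∩ i.1.2) \ i.2).card

lemma sum_mderiv_sq_eq (X : ι → Ω → ℝ) (U : Finset ι) (c : Finset ι → ℝ) (ω : Ω) :
    ∑ j ∈ U, mderiv X U c j ω ^ 2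
      = ∑ i ∈ pairTerms (coeffSupport U c), pairCoeff c i * pairMonomial X i ω := by
  set 𝒦 := coeffSupport U c
  calc ∑ j ∈ U, mderiv X U c j ω ^ 2
      = ∑ j ∈ U, ∑ p ∈ (𝒦.filter (j ∈ ·)) ×ˢ (𝒦.filter (j ∈ ·)), c p.1 * c p.2
          * ((∏ k ∈ p.1.erase j, X k ω) * ∏ k ∈ p.2.erase j, X k ω) := by
        refine Finset.sum_congr rfl fun j hj => ?_
        rw [mderiv_eq_sum_coeffSupport X c hj, sq, Finset.sum_mul_sum, ← Finset.sum_product']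
        exact Finset.sum_congr rfl fun p _ => mul_mul_mul_comm _ _ _ _
    _ = ∑ p ∈ 𝒦 ×ˢ 𝒦, ∑ j ∈ p.1 ∩ p.2, c p.1 * c p.2
          * ((∏ k ∈ p.1.erase j, X k ω) * ∏ k ∈ p.2.erase j, X k ω) := by
        refine Finset.sum_comm' fun j p => ?_
        simp only [Finset.mem_product, Finset.mem_filter, Finset.mem_inter]
        refine ⟨fun ⟨_, hA, hB⟩ => ⟨⟨hA.2, hB.2⟩, hA.1, hB.1⟩, fun ⟨hj, hA, hB⟩ => ⟨?_, ?_⟩⟩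
        · exact Finset.mem_powerset.1 (Finset.mem_filter.1 hA).1 hj.1
        · exact ⟨⟨hA, hj.1⟩, hB, hj.2⟩
    _ = ∑ i ∈ pairTerms 𝒦, pairCoeff c i * pairMonomial X i ω := by
        rw [pairTerms, Finset.sum_sigma]
        refine Finset.sum_congr rfl fun p _ => ?_
        rw [← Finset.mul_sum, sum_prod_erase_mul_prod_erase, Finset.mul_sum]
        exact Finset.sum_congr rfl fun T _ => (mul_assoc _ _ _).symm

variable {𝒦 : Finset (Finset ι)} {U : Finset ι} {c : Finset ι → ℝ} {q : ℕ}

lemma disjoint_of_mem_pairTerms {i : PairTerm ι} (hi : i ∈ pairTerms 𝒦) :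
    Disjoint (i.1.1 \ i.1.2 ∪ i.1.2 \ i.1.1) i.2 := by
  obtain ⟨⟨A, B⟩, T⟩ := i
  have hT := (mem_pairTerms.1 hi).2.2.1
  refine Finset.disjoint_union_left.2 ⟨?_, ?_⟩
  · exact Finset.sdiff_disjoint.mono_right (hT.trans Finset.inter_subset_right)
  · exact Finset.sdiff_disjoint.mono_right (hT.trans Finset.inter_subset_left)

lemma abs_pairCoeff_le (h𝒦 : ∀ A ∈ 𝒦, A.card = q) (c : Finset ι → ℝ) {i : PairTerm ι}
    (hi : i ∈ pairTerms 𝒦) : |pairCoeff c i| ≤ q * |c i.1.1 * c i.1.2| := by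
  obtain ⟨⟨A, B⟩, T⟩ := i
  rw [pairCoeff, abs_mul, Nat.abs_cast, mul_comm]
  gcongr
  rw [← h𝒦 A (mem_pairTerms.1 hi).1]
  exact Finset.card_le_card (Finset.sdiff_subset.trans Finset.inter_subset_left)

lemma sum_sameKeyPairs_abs_pairCoeff_le (h𝒦 : ∀ A ∈ 𝒦, A.card = q) (c : Finset ι → ℝ) :
    ∑ p ∈ sameKeyPairs 𝒦, |pairCoeff c p.1| * |pairCoeff c p.2|
      ≤ q ^ 2 * ∑ p ∈ sameKeyPairs 𝒦, |c p.1.1.1 * c p.1.1.2| * |c p.2.1.1 * c p.2.1.2| := by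
  rw [Finset.mul_sum]
  refine Finset.sum_le_sum fun p hp => ?_
  obtain ⟨hp₁, hp₂⟩ := Finset.mem_product.1 (Finset.mem_filter.1 hp).1
  have coeff_le : ∀ i ∈ properTerms 𝒦, |pairCoeff c i| ≤ q * |c i.1.1 * c i.1.2| := fun i hi =>
    abs_pairCoeff_le h𝒦 c (Finset.mem_filter.1 hi).1
  calc |pairCoeff c p.1| * |pairCoeff c p.2|
      ≤ (q * |c p.1.1.1 * c p.1.1.2|) * (q * |c p.2.1.1 * c p.2.1.2|) := by
        gcongr
        exacts [coeff_le _ hp₁, coeff_le _ hp₂]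
    _ = q ^ 2 * (|c p.1.1.1 * c p.1.1.2| * |c p.2.1.1 * c p.2.1.2|) := by ring

lemma sum_keySupport_eq_abs_pairCoeff_le (h𝒦 : ∀ A ∈ 𝒦, A.card = q) (h0 : ∀ A ∈ 𝒦, c A ≠ 0)
    (hc : IsProductType c) (hU : ∀ A ∈ 𝒦, A ⊆ U) {τ : ℝ} (hinf : ∀ j ∈ U, influence U c j ≤ τ) :
    ∑ p ∈ properTerms 𝒦 ×ˢ properTerms 𝒦 with
        keySupport (pairKey p.1) = keySupport (pairKey p.2), |pairCoeff c p.1| * |pairCoeff c p.2|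
      ≤ q ^ 2 * 512 ^ q * (sharpSum 𝒦 c + q * τ * ∑ A ∈ 𝒦, c A ^ 2) := by
  have card_fiber : ∀ x ∈ (properTerms 𝒦).image pairKey,
      (((properTerms 𝒦).image pairKey).filter fun y => keySupport y = keySupport x).card
        ≤ 64 ^ q := fun x hx => by
    obtain ⟨i, hi, rfl⟩ := Finset.mem_image.1 hx
    calc _ ≤ 8 ^ (keySupport (pairKey i)).card := card_filter_keySupport_eq_le _ _
      _ ≤ 8 ^ (2 * q) := Nat.pow_le_pow_right (by norm_num)
          (card_keySupport_pairKey_le h𝒦 (Finset.mem_filter.1 hi).1)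
      _ = 64 ^ q := by rw [pow_mul]; norm_num
  calc ∑ p ∈ properTerms 𝒦 ×ˢ properTerms 𝒦 with
        keySupport (pairKey p.1) = keySupport (pairKey p.2), |pairCoeff c p.1| * |pairCoeff c p.2|
      ≤ (64 ^ q : ℕ) * ∑ p ∈ sameKeyPairs 𝒦, |pairCoeff c p.1| * |pairCoeff c p.2| :=
        sum_filter_comp_product_le _ pairKey keySupport (fun i => |pairCoeff c i|) card_fiber
    _ ≤ (64 ^ q : ℕ) * (q ^ 2 * (8 ^ q * (sharpSum 𝒦 c + q * τ * ∑ A ∈ 𝒦, c A ^ 2))) := by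
        gcongr
        refine (sum_sameKeyPairs_abs_pairCoeff_le h𝒦 c).trans
          (mul_le_mul_of_nonneg_left ((sum_sameKeyPairs_le h𝒦 h0 hc).trans ?_) (sq_nonneg _))
        gcongr
        exact sum_not_disjoint_le hU h𝒦 hinf
    _ = q ^ 2 * 512 ^ q * (sharpSum 𝒦 c + q * τ * ∑ A ∈ 𝒦, c A ^ 2) := by
        rw [show (512 : ℝ) = 64 * 8 by norm_num, mul_pow]
        push_cast
        ring

namespace IsStdIndep

variable [MeasurableSpace Ω] {P : Measure Ω} [IsProbabilityMeasure P] {X : ι → Ω → ℝ} {M : ℝ}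
  {D T D' T' : Finset ι}

lemma integrable_hermiteFactor_mul (hX : IsStdIndep P X M) (D T D' T' : Finset ι) (k : ι) :
    Integrable (fun ω => hermiteFactor D T k (X k ω) * hermiteFactor D' T' k (X k ω)) P := by
  have iX : Integrable (fun ω => 1 + 2 * X k ω ^ 2 + X k ω ^ 4) P :=
    ((integrable_const 1).add ((hX.integrable_pow k (by decide)).const_mul 2)).add
      (hX.integrable_pow_four k)
  refine integrable_of_abs_le iX (((measurable_hermiteFactor D T k).comp (hX.measurable k)).mul
    ((measurable_hermiteFactor D' T' k).comp (hX.measurable k))) fun ω => ?_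
  calc |hermiteFactor D T k (X k ω) * hermiteFactor D' T' k (X k ω)|
      ≤ (1 + X k ω ^ 2) * (1 + X k ω ^ 2) := by
        rw [abs_mul]
        gcongr <;> exact abs_hermiteFactor_le _ _ _ _
    _ = 1 + 2 * X k ω ^ 2 + X k ω ^ 4 := by ring

lemma integral_hermiteFactor (hX : IsStdIndep P X M) {k : ι} (hk : k ∈ D ∪ T) :
    ∫ ω, hermiteFactor D T k (X k ω) ∂P = 0 := by
  by_cases hD : k ∈ D
  · simp only [hermiteFactor, if_pos hD, hX.integral_eq_zero]
  · simp only [hermiteFactor, if_neg hD, if_pos ((Finset.mem_union.1 hk).resolve_left hD)]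
    rw [integral_sub (hX.integrable_pow k (by decide)) (integrable_const 1), hX.integral_sq]
    simp

lemma integral_hermiteFactor_sq_le (hX : IsStdIndep P X M) (D T : Finset ι) (k : ι) :
    ∫ ω, hermiteFactor D T k (X k ω) ^ 2 ∂P ≤ M := by
  have : Nonempty ι := ⟨k⟩
  have iX2 := hX.integrable_pow k (n := 2) (by decide)
  unfold hermiteFactor
  split_ifs
  · rw [hX.integral_sq]
    exact hX.one_le
  · have expand : ∀ ω, (X k ω ^ 2 - 1) ^ 2 = X k ω ^ 4 - 2 * X k ω ^ 2 + 1 := fun ω => by ring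
    have i42 : Integrable (fun ω => X k ω ^ 4 - 2 * X k ω ^ 2) P :=
      (hX.integrable_pow_four k).sub (iX2.const_mul 2)
    simp only [expand]
    rw [integral_add i42 (integrable_const 1),
      integral_sub (hX.integrable_pow_four k) (iX2.const_mul 2), integral_const_mul, hX.integral_sq]
    simp
    linarith [hX.integral_pow_four_le k]
  · simpa using hX.one_le

lemma abs_integral_hermiteFactor_mul_le (hX : IsStdIndep P X M) (D T D' T' : Finset ι) (k : ι) :
    |∫ ω, hermiteFactor D T k (X k ω) * hermiteFactor D' T' k (X k ω) ∂P| ≤ M := by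
  have isq : ∀ D T, Integrable (fun ω => hermiteFactor D T k (X k ω) ^ 2) P := fun D T => by
    simpa only [sq] using hX.integrable_hermiteFactor_mul D T D T k
  calc |∫ ω, hermiteFactor D T k (X k ω) * hermiteFactor D' T' k (X k ω) ∂P|
      ≤ ∫ ω, |hermiteFactor D T k (X k ω) * hermiteFactor D' T' k (X k ω)| ∂P :=
        abs_integral_le_integral_abs
    _ ≤ ∫ ω, 2⁻¹ * (hermiteFactor D T k (X k ω) ^ 2 + hermiteFactor D' T' k (X k ω) ^ 2) ∂P := by
        refine integral_mono (hX.integrable_hermiteFactor_mul D T D' T' k).abs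
          (((isq D T).add (isq D' T')).const_mul 2⁻¹) fun ω => ?_
        simp only
        rw [abs_le]
        constructor <;> nlinarith [sq_nonneg (hermiteFactor D T k (X k ω)
          - hermiteFactor D' T' k (X k ω)), sq_nonneg (hermiteFactor D T k (X k ω)
          + hermiteFactor D' T' k (X k ω))]
    _ ≤ M := by
        rw [integral_const_mul, integral_add (isq D T) (isq D' T')]
        linarith [hX.integral_hermiteFactor_sq_le D T k, hX.integral_hermiteFactor_sq_le D' T' k]

lemma integrable_and_integral_hermiteMonomial_mul (hX : IsStdIndep P X M) (h : Disjoint D T)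
    (h' : Disjoint D' T') :
    Integrable (fun ω => hermiteMonomial X D T ω * hermiteMonomial X D' T' ω) P ∧
    ∫ ω, hermiteMonomial X D T ω * hermiteMonomial X D' T' ω ∂P
      = ∏ k ∈ (D ∪ T) ∪ (D' ∪ T'),
        ∫ ω, hermiteFactor D T k (X k ω) * hermiteFactor D' T' k (X k ω) ∂P := by
  simp only [hermiteMonomial_eq_prod X h (Finset.subset_union_left (s₂ := D' ∪ T')),
    hermiteMonomial_eq_prod X h' (Finset.subset_union_right (s₁ := D ∪ T)),
    ← Finset.prod_mul_distrib]
  exact hX.integrable_prod_comp _ (g := fun k t => hermiteFactor D T k t * hermiteFactor D' T' k t)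
    (fun k => (measurable_hermiteFactor D T k).mul (measurable_hermiteFactor D' T' k))
    (hX.integrable_hermiteFactor_mul D T D' T')

lemma abs_integral_hermiteMonomial_mul_le (hX : IsStdIndep P X M) (h : Disjoint D T)
    (h' : Disjoint D' T') (heq : D ∪ T = D' ∪ T') :
    |∫ ω, hermiteMonomial X D T ω * hermiteMonomial X D' T' ω ∂P| ≤ M ^ (D ∪ T).card := by
  rw [(hX.integrable_and_integral_hermiteMonomial_mul h h').2, ← heq, Finset.union_self,
    Finset.abs_prod, ← Finset.prod_const]
  exact Finset.prod_le_prod (fun _ _ => abs_nonneg _) fun k _ =>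
    hX.abs_integral_hermiteFactor_mul_le D T D' T' k

lemma integral_hermiteMonomial_mul_eq_zero (hX : IsStdIndep P X M) (h : Disjoint D T)
    (h' : Disjoint D' T') (hne : D ∪ T ≠ D' ∪ T') :
    ∫ ω, hermiteMonomial X D T ω * hermiteMonomial X D' T' ω ∂P = 0 := by
  rw [(hX.integrable_and_integral_hermiteMonomial_mul h h').2]
  have factor_eq_one : ∀ {D T : Finset ι} {k : ι}, k ∉ D ∪ T → ∀ t, hermiteFactor D T k t = 1 := by
    intro D T k hk t
    rw [Finset.mem_union, not_or] at hk
    rw [hermiteFactor, if_neg hk.1, if_neg hk.2]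
  obtain ⟨k, hk⟩ : ∃ k, ¬ (k ∈ D ∪ T ↔ k ∈ D' ∪ T') := not_forall.1 (mt Finset.ext hne)
  by_cases hk₁ : k ∈ D ∪ T
  · refine Finset.prod_eq_zero (Finset.mem_union_left _ hk₁) ?_
    simp only [factor_eq_one fun hk₂ => hk (iff_of_true hk₁ hk₂), mul_one,
      hX.integral_hermiteFactor hk₁]
  · have hk₂ : k ∈ D' ∪ T' := by tauto
    refine Finset.prod_eq_zero (Finset.mem_union_right _ hk₂) ?_
    simp only [factor_eq_one hk₁, one_mul, hX.integral_hermiteFactor hk₂]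

/-- Hermite monomials with different supports are orthogonal. -/
lemma integral_sum_hermiteMonomial_sq_le {κ : Type*} (hX : IsStdIndep P X M) (hM : 1 ≤ M)
    {I : Finset κ} {D T : κ → Finset ι} (a : κ → ℝ) {m : ℕ} (hdisj : ∀ i ∈ I, Disjoint (D i) (T i))
    (hcard : ∀ i ∈ I, (D i ∪ T i).card ≤ m) :
    Integrable (fun ω => (∑ i ∈ I, a i * hermiteMonomial X (D i) (T i) ω) ^ 2) P ∧
    ∫ ω, (∑ i ∈ I, a i * hermiteMonomial X (D i) (T i) ω) ^ 2 ∂P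
      ≤ M ^ m * ∑ p ∈ I ×ˢ I with D p.1 ∪ T p.1 = D p.2 ∪ T p.2, |a p.1| * |a p.2| := by
  have expand : ∀ ω, (∑ i ∈ I, a i * hermiteMonomial X (D i) (T i) ω) ^ 2
      = ∑ p ∈ I ×ˢ I, a p.1 * a p.2
        * (hermiteMonomial X (D p.1) (T p.1) ω * hermiteMonomial X (D p.2) (T p.2) ω) := fun ω => by
    rw [sq, Finset.sum_mul_sum, ← Finset.sum_product']
    exact Finset.sum_congr rfl fun p _ => mul_mul_mul_comm _ _ _ _
  have disjoint_left : ∀ p ∈ I ×ˢ I, Disjoint (D p.1) (T p.1) := fun p hp =>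
    hdisj _ (Finset.mem_product.1 hp).1
  have disjoint_right : ∀ p ∈ I ×ˢ I, Disjoint (D p.2) (T p.2) := fun p hp =>
    hdisj _ (Finset.mem_product.1 hp).2
  have integrable_term : ∀ p ∈ I ×ˢ I, Integrable (fun ω => a p.1 * a p.2
      * (hermiteMonomial X (D p.1) (T p.1) ω * hermiteMonomial X (D p.2) (T p.2) ω)) P :=
    fun p hp => (hX.integrable_and_integral_hermiteMonomial_mul (disjoint_left p hp)
      (disjoint_right p hp)).1.const_mul _
  simp only [expand]
  refine ⟨integrable_finsetSum _ integrable_term, ?_⟩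
  rw [integral_finsetSum _ integrable_term, Finset.sum_filter, Finset.mul_sum]
  refine Finset.sum_le_sum fun p hp => ?_
  rw [integral_const_mul]
  split_ifs with h
  · refine (le_abs_self _).trans ?_
    rw [abs_mul, abs_mul, mul_comm]
    gcongr
    exact (hX.abs_integral_hermiteMonomial_mul_le (disjoint_left p hp) (disjoint_right p hp)
      h).trans (pow_le_pow_right₀ hM (hcard _ (Finset.mem_product.1 hp).1))
  · rw [hX.integral_hermiteMonomial_mul_eq_zero (disjoint_left p hp) (disjoint_right p hp) h,
      mul_zero, mul_zero]

lemma integral_pairMonomial (hX : IsStdIndep P X M) {i : PairTerm ι} (hi : i ∈ properTerms 𝒦) :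
    Integrable (pairMonomial X i) P ∧ ∫ ω, pairMonomial X i ω ∂P = 0 := by
  obtain ⟨hi, hne⟩ := Finset.mem_filter.1 hi
  have hdisj := disjoint_of_mem_pairTerms hi
  have := (hX.integrable_and_integral_hermiteMonomial_mul hdisj (Finset.disjoint_empty_left ∅)).1
  have h0 := hX.integral_hermiteMonomial_mul_eq_zero hdisj (Finset.disjoint_empty_left ∅) hne
  simp only [hermiteMonomial_empty, mul_one] at this h0
  exact ⟨this, h0⟩

/-- Both sides are centred, and they differ by a constant. -/
lemma sum_mderiv_sq_sub_eq (hX : IsStdIndep P X M) (hc : ∀ A ⊆ U, c A ≠ 0 → A.card = q) (ω : Ω) :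
    ∑ j ∈ U, mderiv X U c j ω ^ 2 - q * ∑ A ∈ U.powerset, c A ^ 2
      = ∑ i ∈ properTerms (coeffSupport U c), pairCoeff c i * pairMonomial X i ω := by
  set 𝒦 := coeffSupport U c
  set C := ∑ i ∈ pairTerms 𝒦 with ¬ keySupport (pairKey i) ≠ ∅, pairCoeff c i
  have expansion : ∀ ω, ∑ j ∈ U, mderiv X U c j ω ^ 2
      = ∑ i ∈ properTerms 𝒦, pairCoeff c i * pairMonomial X i ω + C := fun ω => by
    rw [sum_mderiv_sq_eq, ← Finset.sum_filter_add_sum_filter_not _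
      fun i => keySupport (pairKey i) ≠ ∅]
    refine congrArg₂ (· + ·) rfl (Finset.sum_congr rfl fun i hi => ?_)
    have h := Finset.union_eq_empty.1 (not_not.1 (Finset.mem_filter.1 hi).2)
    have constant : pairMonomial X i ω = hermiteMonomial X ∅ ∅ ω :=
      congrArg₂ (hermiteMonomial X · · ω) h.1 h.2
    rw [constant, hermiteMonomial_empty, mul_one]
  have integral_eq_const : ∫ ω, ∑ j ∈ U, mderiv X U c j ω ^ 2 ∂P = C := by
    have iterm : ∀ i ∈ properTerms 𝒦, Integrable (fun ω => pairCoeff c i * pairMonomial X i ω) P :=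
      fun i hi => (hX.integral_pairMonomial hi).1.const_mul _
    simp only [expansion]
    rw [integral_add (integrable_finsetSum _ iterm) (integrable_const _),
      integral_finsetSum _ iterm, Finset.sum_eq_zero fun i hi => by
        rw [integral_const_mul, (hX.integral_pairMonomial hi).2, mul_zero]]
    simp
  have integral_eq_influence :
      ∫ ω, ∑ j ∈ U, mderiv X U c j ω ^ 2 ∂P = q * ∑ A ∈ U.powerset, c A ^ 2 := by
    rw [integral_finsetSum _ fun j _ => hX.integrable_mderiv_pow U c j (by decide),
      ← sum_influence hc]
    exact Finset.sum_congr rfl fun j hj => hX.integral_mderiv_sq c hj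
  rw [expansion, ← integral_eq_influence, integral_eq_const, add_sub_cancel_right]

lemma integral_sum_mderiv_sq_sub_sq_le (hX : IsStdIndep P X M) (hM : 1 ≤ M)
    (hq : ∀ A ⊆ U, c A ≠ 0 → A.card = q) (hc : IsProductType c) {τ : ℝ}
    (hinf : ∀ j ∈ U, influence U c j ≤ τ) :
    Integrable (fun ω => (∑ j ∈ U, mderiv X U c j ω ^ 2 - q * ∑ A ∈ U.powerset, c A ^ 2) ^ 2) P ∧
    ∫ ω, (∑ j ∈ U, mderiv X U c j ω ^ 2 - q * ∑ A ∈ U.powerset, c A ^ 2) ^ 2 ∂P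
      ≤ M ^ (2 * q) * (q ^ 2 * 512 ^ q * (sharpSum (coeffSupport U c) c
        + q * τ * ∑ A ∈ U.powerset, c A ^ 2)) := by
  set 𝒦 := coeffSupport U c
  have subset_of_mem : ∀ A ∈ 𝒦, A ⊆ U := fun A hA =>
    Finset.mem_powerset.1 (Finset.mem_filter.1 hA).1
  have ne_zero : ∀ A ∈ 𝒦, c A ≠ 0 := fun A hA => (Finset.mem_filter.1 hA).2
  have card_eq : ∀ A ∈ 𝒦, A.card = q := fun A hA => hq A (subset_of_mem A hA) (ne_zero A hA)
  have mem_pair : ∀ i ∈ properTerms 𝒦, i ∈ pairTerms 𝒦 := fun i hi => (Finset.mem_filter.1 hi).1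
  have sum_support : ∑ A ∈ 𝒦, c A ^ 2 = ∑ A ∈ U.powerset, c A ^ 2 :=
    Finset.sum_filter_of_ne fun A _ h => fun h₀ => h (by rw [h₀, sq, mul_zero])
  simp only [hX.sum_mderiv_sq_sub_eq hq]
  obtain ⟨integrable_sq, integral_sq_le⟩ := hX.integral_sum_hermiteMonomial_sq_le hM
    (D := fun i : PairTerm ι => i.1.1 \ i.1.2 ∪ i.1.2 \ i.1.1) (T := fun i => i.2) (pairCoeff c)
    (fun i hi => disjoint_of_mem_pairTerms (mem_pair i hi))
    fun i hi => card_keySupport_pairKey_le card_eq (mem_pair i hi)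
  refine ⟨integrable_sq, integral_sq_le.trans (mul_le_mul_of_nonneg_left ?_ (by positivity))⟩
  rw [← sum_support]
  exact sum_keySupport_eq_abs_pairCoeff_le card_eq ne_zero hc subset_of_mem hinf

end IsStdIndep

end SumOfSquares

/-! ### The normal approximation bound for finite sums -/

section FiniteSums

/-- The constant of the normal approximation bound for homogeneous sums of degree `q`. -/
noncomputable def cltConst (q : ℕ) : ℝ := 6 * (q ^ 2 * 512 ^ q) + 2 * steinLip * 16 ^ q

lemma cltConst_pos (q : ℕ) : 0 < cltConst q := by
  have := steinLip_pos
  rw [cltConst]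
  positivity

lemma sharpSum_nonneg {ι : Type*} [DecidableEq ι] (𝒦 : Finset (Finset ι)) (c : Finset ι → ℝ) :
    0 ≤ sharpSum 𝒦 c :=
  Finset.sum_nonneg fun _ _ => mul_nonneg (sq_nonneg _) (sq_nonneg _)

namespace IsStdIndep

variable {ι Ω : Type*} [DecidableEq ι] [MeasurableSpace Ω] {P : Measure Ω} [IsProbabilityMeasure P]
  {X : ι → Ω → ℝ} {M τ : ℝ} {U : Finset ι} {c : Finset ι → ℝ} {q : ℕ}

lemma sqrt_integral_sum_mderiv_sq_sub_sq_le (hX : IsStdIndep P X M) (hM : 1 ≤ M) (hq : 1 ≤ q)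
    (hcard : ∀ A ⊆ U, c A ≠ 0 → A.card = q) (hc : IsProductType c) (hτ : 0 ≤ τ)
    (hinf : ∀ j ∈ U, influence U c j ≤ τ) (hv : ∑ A ∈ U.powerset, c A ^ 2 ≤ 1) :
    √(∫ ω, (∑ j ∈ U, mderiv X U c j ω ^ 2 - q * ∑ A ∈ U.powerset, c A ^ 2) ^ 2 ∂P)
      ≤ M ^ q * (q ^ 2 * 512 ^ q * (√(sharpSum (coeffSupport U c) c) + √τ)) := by
  set D := sharpSum (coeffSupport U c) c
  have hD : 0 ≤ D := sharpSum_nonneg _ c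
  have one_le_q : (1 : ℝ) ≤ q := by exact_mod_cast hq
  have q_le : (q : ℝ) ≤ q ^ 2 * 512 ^ q :=
    (le_self_pow₀ one_le_q two_ne_zero).trans
      (le_mul_of_one_le_right (sq_nonneg _) (one_le_pow₀ (by norm_num)))
  set B : ℝ := q ^ 2 * 512 ^ q
  have inner_le : D + q * τ * ∑ A ∈ U.powerset, c A ^ 2 ≤ B * (D + τ) :=
    calc D + q * τ * ∑ A ∈ U.powerset, c A ^ 2 ≤ B * D + B * τ * 1 := by
          gcongr
          exact le_mul_of_one_le_left hD (one_le_q.trans q_le)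
      _ = B * (D + τ) := by ring
  have sum_le_sq : D + τ ≤ (√D + √τ) ^ 2 := by
    rw [add_sq, Real.sq_sqrt hD, Real.sq_sqrt hτ]
    linarith [mul_nonneg (mul_nonneg zero_le_two (Real.sqrt_nonneg D)) (Real.sqrt_nonneg τ)]
  refine Real.sqrt_le_iff.2 ⟨by positivity, ?_⟩
  calc ∫ ω, (∑ j ∈ U, mderiv X U c j ω ^ 2 - q * ∑ A ∈ U.powerset, c A ^ 2) ^ 2 ∂P
      ≤ M ^ (2 * q) * (B * (B * (√D + √τ) ^ 2)) := by
        refine (hX.integral_sum_mderiv_sq_sub_sq_le hM hcard hc hinf).2.trans ?_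
        gcongr
        exact inner_le.trans (by gcongr)
    _ = (M ^ q * (B * (√D + √τ))) ^ 2 := by ring

lemma integral_abs_sum_mderiv_sq_sub_le (hX : IsStdIndep P X M) (hM : 1 ≤ M) (hq : 1 ≤ q)
    (hcard : ∀ A ⊆ U, c A ≠ 0 → A.card = q) (hc : IsProductType c) (hτ : 0 ≤ τ)
    (hinf : ∀ j ∈ U, influence U c j ≤ τ) (hv : ∑ A ∈ U.powerset, c A ^ 2 ≤ 1) :
    ∫ ω, |∑ j ∈ U, mderiv X U c j ω ^ 2 - q| ∂P
      ≤ M ^ q * (q ^ 2 * 512 ^ q * (√(sharpSum (coeffSupport U c) c) + √τ))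
        + q * (1 - ∑ A ∈ U.powerset, c A ^ 2) := by
  set V : Ω → ℝ := fun ω => ∑ j ∈ U, mderiv X U c j ω ^ 2
  set v := ∑ A ∈ U.powerset, c A ^ 2
  have hV : Integrable V P :=
    integrable_finsetSum _ fun j _ => hX.integrable_mderiv_pow U c j (by decide)
  have hVv : Integrable (fun ω => V ω - q * v) P := hV.sub (integrable_const _)
  calc ∫ ω, |V ω - q| ∂P ≤ ∫ ω, (|V ω - q * v| + q * (1 - v)) ∂P := by
        refine integral_mono (hV.sub (integrable_const _)).abs
          (hVv.abs.add (integrable_const _)) fun ω => ?_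
        calc |V ω - q| = |V ω - q * v - q * (1 - v)| := by ring_nf
          _ ≤ |V ω - q * v| + |q * (1 - v)| := abs_sub _ _
          _ = |V ω - q * v| + q * (1 - v) := by
            rw [abs_of_nonneg (mul_nonneg q.cast_nonneg (sub_nonneg.2 hv))]
    _ = ∫ ω, |V ω - q * v| ∂P + q * (1 - v) := by
        rw [integral_add hVv.abs (integrable_const _), integral_const, probReal_univ, one_smul]
    _ ≤ √(∫ ω, (V ω - q * v) ^ 2 ∂P) + q * (1 - v) := by
        gcongr
        exact integral_abs_le_sqrt_integral_sq hVv
          (hX.integral_sum_mderiv_sq_sub_sq_le hM hcard hc hinf).1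
    _ ≤ _ := by
        gcongr
        exact hX.sqrt_integral_sum_mderiv_sq_sub_sq_le hM hq hcard hc hτ hinf hv

lemma abs_integral_sub_integral_gaussian_le_of_isProductType (hX : IsStdIndep P X M) (hM : 1 ≤ M)
    {h : ℝ → ℝ} (hh : LipschitzWith 1 h) (hq : 1 ≤ q)
    (hcard : ∀ A ⊆ U, c A ≠ 0 → A.card = q) (hc : IsProductType c) (hτ : 0 < τ)
    (hinf : ∀ j ∈ U, influence U c j ≤ τ) (hv : ∑ A ∈ U.powerset, c A ^ 2 ≤ 1) :
    |∫ ω, h (mpoly X U c ω) ∂P - ∫ x, h x ∂gaussianReal 0 1|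
      ≤ 6 * q * (1 - ∑ A ∈ U.powerset, c A ^ 2)
        + cltConst q * M ^ q * (√(sharpSum (coeffSupport U c) c) + √τ) := by
  have hL := steinLip_pos
  have hV := hX.integral_abs_sum_mderiv_sq_sub_le hM hq hcard hc hτ.le hinf hv
  have hstein := hX.abs_integral_sub_integral_gaussian_le hh hq hcard hτ hinf
  set v := ∑ A ∈ U.powerset, c A ^ 2
  set D := sharpSum (coeffSupport U c) c
  have remainder_le : 2 * steinLip * M * (16 * M) ^ (q - 1) * √τ * v
      ≤ 2 * steinLip * 16 ^ q * M ^ q * (√D + √τ) :=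
    calc 2 * steinLip * M * (16 * M) ^ (q - 1) * √τ * v
        ≤ 2 * steinLip * M * (16 * M) ^ (q - 1) * (√D + √τ) * 1 := by
          gcongr
          exact le_add_of_nonneg_left (Real.sqrt_nonneg D)
      _ = 2 * steinLip * 16 ^ (q - 1) * M ^ (q - 1 + 1) * (√D + √τ) := by ring
      _ ≤ 2 * steinLip * 16 ^ q * M ^ q * (√D + √τ) := by
          rw [Nat.sub_add_cancel hq]
          gcongr
          · norm_num
          · exact q.sub_le 1
  rw [cltConst]
  linarith

end IsStdIndep

end FiniteSums

/-! ### Tuples and their weights -/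

section Tuples

section Entries

variable {α : Type*} [DecidableEq α] {q : ℕ} {i j : Fin q → α}

/-- The set of entries of a tuple. -/
def entries (i : Fin q → α) : Finset α := Finset.univ.image i

lemma coe_entries (i : Fin q → α) : (entries i : Set α) = Set.range i := by
  rw [entries, Finset.coe_image, Finset.coe_univ, Set.image_univ]

lemma prod_entries {β : Type*} [CommMonoid β] (hi : Function.Injective i) (f : α → β) :
    ∏ k ∈ entries i, f k = ∏ k, f (i k) :=
  Finset.prod_image hi.injOn

lemma card_entries (hi : Function.Injective i) : (entries i).card = q := by
  rw [entries, Finset.card_image_of_injective _ hi, Finset.card_univ, Fintype.card_fin]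

/-- The tuples obtained by permuting the entries of a tuple. -/
def rearrangements (i : Fin q → α) : Finset (Fin q → α) :=
  Finset.univ.image fun σ : Equiv.Perm (Fin q) => i ∘ σ

lemma card_rearrangements (hi : Function.Injective i) :
    (rearrangements i).card = q.factorial := by
  have comp_injective : Function.Injective fun σ : Equiv.Perm (Fin q) => i ∘ σ := fun σ τ h =>
    Equiv.ext fun k => hi (congrFun h k)
  rw [rearrangements, Finset.card_image_of_injective _ comp_injective, Finset.card_univ,
    Fintype.card_perm, Fintype.card_fin]

lemma mem_rearrangements (hj : Function.Injective j) :
    j ∈ rearrangements i ↔ entries j = entries i := by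
  simp only [rearrangements, Finset.mem_image, Finset.mem_univ, true_and]
  constructor
  · rintro ⟨σ, rfl⟩
    rw [← Finset.coe_inj, coe_entries, coe_entries, σ.surjective.range_comp]
  · intro h
    have exists_eq : ∀ k, ∃ l, i l = j k := fun k => by
      rw [← Set.mem_range, ← coe_entries, ← h, coe_entries]
      exact Set.mem_range_self k
    choose f hf using exists_eq
    have f_injective : Function.Injective f := fun a b hab => hj (by rw [← hf a, ← hf b, hab])
    exact ⟨Equiv.ofBijective f (Finite.injective_iff_bijective.1 f_injective), funext hf⟩

lemma card_filter_entries_eq_le {F : Finset (Fin q → α)} (hF : ∀ i ∈ F, Function.Injective i)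
    (hi : Function.Injective i) : (F.filter fun j => entries j = entries i).card ≤ q.factorial := by
  rw [← card_rearrangements hi]
  refine Finset.card_le_card fun j hj => ?_
  obtain ⟨hjF, hj⟩ := Finset.mem_filter.1 hj
  exact (mem_rearrangements (hF j hjF)).2 hj

end Entries

variable {q : ℕ} {K : Set (Fin q → ℕ)}

open Classical in
/-- The tuples in `K` with entries below `n`. -/
noncomputable def truncate (K : Set (Fin q → ℕ)) (n : ℕ) : Finset (Fin q → ℕ) :=
  (Fintype.piFinset fun _ => Finset.range n).filter (· ∈ K)

lemma mem_truncate {n : ℕ} {i : Fin q → ℕ} :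
    i ∈ truncate K n ↔ i ∈ K ∧ entries i ⊆ Finset.range n := by
  simp only [truncate, Finset.mem_filter, Fintype.mem_piFinset, entries, Finset.image_subset_iff,
    Finset.mem_univ, true_implies, and_comm]

lemma sum_truncate (hK : IsSymmetricOffDiagonal K) (n : ℕ) (g : Finset ℕ → ℝ) :
    ∑ i ∈ truncate K n, g (entries i)
      = q.factorial * ∑ A ∈ (Finset.range n).powerset, (entries '' K).indicator g A := by
  classical
  have maps_to : ∀ i ∈ truncate K n,
      entries i ∈ (Finset.range n).powerset.filter (· ∈ entries '' K) := fun i hi => by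
    obtain ⟨hiK, hin⟩ := mem_truncate.1 hi
    exact Finset.mem_filter.2 ⟨Finset.mem_powerset.2 hin, i, hiK, rfl⟩
  simp only [Set.indicator_apply]
  rw [← Finset.sum_filter, ← Finset.sum_fiberwise_of_maps_to maps_to, Finset.mul_sum]
  refine Finset.sum_congr rfl fun A hA => ?_
  obtain ⟨hAn, i, hiK, rfl⟩ := Finset.mem_filter.1 hA
  have fiber_eq : ((truncate K n).filter fun j => entries j = entries i) = rearrangements i := by
    ext j
    rw [Finset.mem_filter, mem_truncate]
    constructor
    · rintro ⟨⟨hjK, -⟩, hj⟩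
      exact (mem_rearrangements (hK.injective j hjK)).2 hj
    · intro hj
      obtain ⟨σ, -, rfl⟩ := Finset.mem_image.1 hj
      have hσ := hK.symmetric i hiK σ
      have h := (mem_rearrangements (hK.injective _ hσ)).1 hj
      exact ⟨⟨hσ, h ▸ Finset.mem_powerset.1 hAn⟩, h⟩
  rw [Finset.sum_congr rfl fun j hj => by rw [(Finset.mem_filter.1 hj).2], Finset.sum_const,
    fiber_eq, card_rearrangements (hK.injective i hiK), nsmul_eq_mul]

lemma tendsto_truncate_subtype (K : Set (Fin q → ℕ)) [DecidablePred (· ∈ K)] :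
    Tendsto (fun n => (truncate K n).subtype (· ∈ K)) atTop (atTop : Filter (Finset K)) := by
  refine tendsto_atTop_finset_of_monotone (fun m n hmn i hi => ?_) fun i => ?_
  · obtain ⟨hiK, him⟩ := mem_truncate.1 (Finset.mem_subtype.1 hi)
    exact Finset.mem_subtype.2
      (mem_truncate.2 ⟨hiK, him.trans (Finset.range_subset_range.2 hmn)⟩)
  · exact ⟨(entries i.1).sup id + 1, Finset.mem_subtype.2
      (mem_truncate.2 ⟨i.2, Finset.subset_range_sup_succ _⟩)⟩

/-- The weight `b_{i_1}² ⋯ b_{i_q}²` of a tuple. -/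
def tupleWeight (b : ℕ → ℝ) (i : Fin q → ℕ) : ℝ := ∏ k, b (i k) ^ 2

lemma tupleWeight_nonneg (b : ℕ → ℝ) (i : Fin q → ℕ) : 0 ≤ tupleWeight b i :=
  Finset.prod_nonneg fun _ _ => sq_nonneg _

variable {b : ℕ → ℝ}

instance weightPow_sigmaFinite (b : ℕ → ℝ) (q : ℕ) : SigmaFinite (weightPow b q) := by
  unfold weightPow
  infer_instance

instance weightPowPair_sigmaFinite (b : ℕ → ℝ) (q : ℕ) : SigmaFinite (weightPowPair b q) := by
  unfold weightPowPair
  infer_instance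

lemma weightPow_real_singleton (b : ℕ → ℝ) (i : Fin q → ℕ) :
    (weightPow b q).real {i} = tupleWeight b i := by
  have weightMeasure_singleton : ∀ k, weightMeasure b {k} = ENNReal.ofReal (b k ^ 2) := fun k => by
    rw [weightMeasure, withDensity_apply _ (measurableSet_singleton k), Measure.restrict_singleton,
      lintegral_smul_measure, lintegral_dirac, Measure.count_singleton, one_smul]
  rw [measureReal_def, weightPow, ← Set.univ_pi_singleton, Measure.pi_pi, ENNReal.toReal_prod]
  refine Finset.prod_congr rfl fun k _ => ?_
  rw [weightMeasure_singleton, ENNReal.toReal_ofReal (sq_nonneg _)]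

lemma weightPowPair_real_singleton (b : ℕ → ℝ) (p : (Fin q → ℕ) × (Fin q → ℕ)) :
    (weightPowPair b q).real {p} = tupleWeight b p.1 * tupleWeight b p.2 := by
  rw [weightPowPair, ← Set.singleton_prod_singleton, measureReal_prod_prod,
    weightPow_real_singleton, weightPow_real_singleton]

lemma sum_tupleWeight_le {F : Finset (Fin q → ℕ)} {T : Set (Fin q → ℕ)} (h : ↑F ⊆ T)
    (hT : weightPow b q T ≠ ∞) : ∑ i ∈ F, tupleWeight b i ≤ (weightPow b q).real T := by
  simp only [← weightPow_real_singleton, sum_measureReal_singleton]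
  exact measureReal_mono h hT

lemma sum_tupleWeight_mul_tupleWeight_le {F : Finset ((Fin q → ℕ) × (Fin q → ℕ))}
    {T : Set ((Fin q → ℕ) × (Fin q → ℕ))} (h : ↑F ⊆ T) (hT : weightPowPair b q T ≠ ∞) :
    ∑ p ∈ F, tupleWeight b p.1 * tupleWeight b p.2 ≤ (weightPowPair b q).real T := by
  simp only [← weightPowPair_real_singleton, sum_measureReal_singleton]
  exact measureReal_mono h hT

lemma hasSum_tupleWeight (hK : weightPow b q K ≠ ∞) :
    HasSum (fun i : K => tupleWeight b i.1) ((weightPow b q).real K) := by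
  have tsum_eq : ∑' i : K, weightPow b q {i.1} = weightPow b q K := by
    rw [← measure_biUnion K.to_countable (fun i _ j _ hij => Set.disjoint_singleton.2 hij)
      fun i _ => measurableSet_singleton i, Set.biUnion_of_singleton]
  have h := ENNReal.hasSum_toReal (f := fun i : K => weightPow b q {i.1}) (tsum_eq ▸ hK)
  rw [← ENNReal.tsum_toReal_eq fun i => ne_top_of_le_ne_top hK
    (measure_mono (Set.singleton_subset_iff.2 i.2)), tsum_eq] at h
  simpa only [← weightPow_real_singleton, measureReal_def] using h

lemma tendsto_sum_truncate (hK : weightPow b q K ≠ ∞) :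
    Tendsto (fun n => ∑ i ∈ truncate K n, tupleWeight b i) atTop
      (𝓝 ((weightPow b q).real K)) := by
  classical
  refine ((hasSum_tupleWeight hK).comp (tendsto_truncate_subtype K)).congr fun n => ?_
  exact Finset.sum_subtype_of_mem (tupleWeight b) fun i hi => (mem_truncate.1 hi).1

lemma star_subset (K : Set (Fin q → ℕ)) (j : ℕ) : star K j ⊆ K := fun _ h => h.1

lemma weightPowPair_sharp_ne_top (hK : weightPow b q K ≠ ∞) :
    weightPowPair b q (sharp K) ≠ ∞ := by
  have sharp_subset : sharp K ⊆ K ×ˢ K := fun _ h => ⟨h.1, h.2.1⟩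
  refine ne_top_of_le_ne_top ?_ (measure_mono sharp_subset)
  rw [weightPowPair, Measure.prod_prod]
  exact ENNReal.mul_ne_top hK hK

lemma iSup_star_div_le_one : ⨆ j : ℕ, weightPow b q (star K j) / weightPow b q K ≤ 1 :=
  iSup_le fun j => ENNReal.div_le_of_le_mul (by
    rw [one_mul]
    exact measure_mono (star_subset K j))

lemma iSup_star_div_ne_zero (hq : 1 ≤ q) (h0 : weightPow b q K ≠ 0) (hfin : weightPow b q K ≠ ∞) :
    ⨆ j : ℕ, weightPow b q (star K j) / weightPow b q K ≠ 0 := by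
  intro h
  have star_eq_zero : ∀ j, weightPow b q (star K j) = 0 := fun j =>
    (ENNReal.div_eq_zero_iff.1 (iSup_eq_bot.1 h j)).resolve_right hfin
  have subset_iUnion : K ⊆ ⋃ j, star K j := fun i hi =>
    Set.mem_iUnion.2 ⟨i ⟨0, hq⟩, hi, ⟨0, hq⟩, rfl⟩
  exact h0 (measure_mono_null subset_iUnion (measure_iUnion_null star_eq_zero))

end Tuples

/-! ### Homogeneous sums as multilinear polynomials -/

section TupleCoefficients

section Coefficients

variable {b : ℕ → ℝ} {q : ℕ} {K : Set (Fin q → ℕ)} {s : ℝ} {A : Finset ℕ}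

/-- The coefficients of a homogeneous sum over `K`, collected by sets of entries:
`s ∏_{k ∈ A} b_k` if `A` is the set of entries of a tuple in `K`, and `0` otherwise. -/
noncomputable def tupleCoeff (b : ℕ → ℝ) (K : Set (Fin q → ℕ)) (s : ℝ) : Finset ℕ → ℝ :=
  (entries '' K).indicator fun A => s * ∏ k ∈ A, b k

lemma isProductType_tupleCoeff (b : ℕ → ℝ) (K : Set (Fin q → ℕ)) (s : ℝ) :
    IsProductType (tupleCoeff b K s) :=
  ⟨s, b, fun _ hA => Set.indicator_of_mem (Set.mem_of_indicator_ne_zero hA) _⟩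

lemma exists_entries_eq_of_tupleCoeff_ne_zero (hA : tupleCoeff b K s A ≠ 0) :
    ∃ i ∈ K, entries i = A :=
  (Set.mem_image _ _ _).1 (Set.mem_of_indicator_ne_zero hA)

lemma card_eq_of_tupleCoeff_ne_zero (hK : IsSymmetricOffDiagonal K)
    (hA : tupleCoeff b K s A ≠ 0) : A.card = q := by
  obtain ⟨i, hi, rfl⟩ := exists_entries_eq_of_tupleCoeff_ne_zero hA
  exact card_entries (hK.injective i hi)

lemma tupleCoeff_sq (b : ℕ → ℝ) (K : Set (Fin q → ℕ)) (s : ℝ) (A : Finset ℕ) :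
    tupleCoeff b K s A ^ 2 = tupleCoeff (fun k => b k ^ 2) K (s ^ 2) A := by
  by_cases hA : A ∈ entries '' K
  · simp only [tupleCoeff, Set.indicator_of_mem hA, mul_pow, Finset.prod_pow]
  · simp only [tupleCoeff, Set.indicator_of_notMem hA, zero_pow two_ne_zero]

lemma sum_tupleCoeff_mul (hK : IsSymmetricOffDiagonal K) (n : ℕ) (g : Finset ℕ → ℝ) :
    ∑ A ∈ (Finset.range n).powerset, tupleCoeff b K s A * g A
      = s / q.factorial * ∑ i ∈ truncate K n, (∏ k, b (i k)) * g (entries i) := by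
  have sum_eq : ∑ i ∈ truncate K n, (∏ k, b (i k)) * g (entries i)
      = ∑ i ∈ truncate K n, (∏ k ∈ entries i, b k) * g (entries i) :=
    Finset.sum_congr rfl fun i hi => by rw [prod_entries (hK.injective i (mem_truncate.1 hi).1)]
  have factorial_ne_zero : (q.factorial : ℝ) ≠ 0 := Nat.cast_ne_zero.2 q.factorial_ne_zero
  rw [sum_eq, sum_truncate hK n fun A => (∏ k ∈ A, b k) * g A, ← mul_assoc,
    div_mul_cancel₀ _ factorial_ne_zero, Finset.mul_sum]
  refine Finset.sum_congr rfl fun A _ => ?_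
  by_cases hA : A ∈ entries '' K
  · rw [tupleCoeff, Set.indicator_of_mem hA, Set.indicator_of_mem hA, mul_assoc]
  · rw [tupleCoeff, Set.indicator_of_notMem hA, Set.indicator_of_notMem hA, zero_mul, mul_zero]

lemma sum_tupleCoeff_sq_mul (hK : IsSymmetricOffDiagonal K) (n : ℕ) (g : Finset ℕ → ℝ) :
    ∑ A ∈ (Finset.range n).powerset, tupleCoeff b K s A ^ 2 * g A
      = s ^ 2 / q.factorial * ∑ i ∈ truncate K n, tupleWeight b i * g (entries i) := by
  simp only [tupleCoeff_sq]
  exact sum_tupleCoeff_mul hK n g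

lemma sum_tupleCoeff_sq (hK : IsSymmetricOffDiagonal K) (n : ℕ) :
    ∑ A ∈ (Finset.range n).powerset, tupleCoeff b K s A ^ 2
      = s ^ 2 / q.factorial * ∑ i ∈ truncate K n, tupleWeight b i := by
  simpa only [mul_one] using sum_tupleCoeff_sq_mul hK n fun _ => 1

lemma mpoly_tupleCoeff {Ω : Type*} (hK : IsSymmetricOffDiagonal K) (X : ℕ → Ω → ℝ) (n : ℕ) (ω : Ω) :
    mpoly X (Finset.range n) (tupleCoeff b K s) ω
      = s / q.factorial * ∑ i ∈ truncate K n, ∏ k, b (i k) * X (i k) ω := by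
  rw [mpoly, sum_tupleCoeff_mul hK n fun A => ∏ k ∈ A, X k ω]
  refine congrArg _ (Finset.sum_congr rfl fun i hi => ?_)
  rw [prod_entries (hK.injective i (mem_truncate.1 hi).1), Finset.prod_mul_distrib]

lemma influence_tupleCoeff_le (hK : IsSymmetricOffDiagonal K) (hfin : weightPow b q K ≠ ∞)
    (n j : ℕ) :
    influence (Finset.range n) (tupleCoeff b K s) j
      ≤ s ^ 2 / q.factorial * (weightPow b q).real (star K j) := by
  have filter_subset : ↑((truncate K n).filter fun i => j ∈ entries i) ⊆ star K j := fun i hi => by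
    obtain ⟨hi, hj⟩ := Finset.mem_filter.1 hi
    obtain ⟨k, -, hk⟩ := Finset.mem_image.1 hj
    exact ⟨(mem_truncate.1 hi).1, k, hk⟩
  have h := sum_tupleCoeff_sq_mul (b := b) (s := s) hK n fun A => if j ∈ A then 1 else 0
  simp only [mul_ite, mul_one, mul_zero, ← Finset.sum_filter] at h
  rw [influence, h]
  gcongr
  exact sum_tupleWeight_le filter_subset
    (ne_top_of_le_ne_top hfin (measure_mono (star_subset K j)))

lemma mem_sharp_of_isSharpPair {U : Finset ℕ} {i j : Fin q → ℕ} (hi : i ∈ K) (hj : j ∈ K)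
    (h : IsSharpPair (coeffSupport U (tupleCoeff b K s)) (entries i, entries j)) :
    (i, j) ∈ sharp K := by
  obtain ⟨hdisj, C, hC, D, hD, hunion, hne₁, hne₂⟩ := h
  obtain ⟨k, hk, rfl⟩ := exists_entries_eq_of_tupleCoeff_ne_zero (Finset.mem_filter.1 hC).2
  obtain ⟨l, hl, rfl⟩ := exists_entries_eq_of_tupleCoeff_ne_zero (Finset.mem_filter.1 hD).2
  simp only [← Finset.coe_inj, ← Finset.disjoint_coe, Finset.coe_union, coe_entries, ne_eq]
    at hdisj hunion hne₁ hne₂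
  exact ⟨hi, hj, hdisj, k, hk, l, hl, hunion, hne₁, hne₂⟩

lemma sharpSum_coeffSupport (U : Finset ℕ) (c : Finset ℕ → ℝ) :
    sharpSum (coeffSupport U c) c = ∑ A ∈ U.powerset, c A ^ 2 *
      ∑ B ∈ U.powerset, c B ^ 2 * if IsSharpPair (coeffSupport U c) (A, B) then 1 else 0 := by
  simp only [sharpSum, Finset.sum_filter, Finset.sum_product, Finset.mul_sum, mul_ite, mul_one,
    mul_zero]
  have sum_eq : ∀ g : Finset ℕ → ℝ, (∀ A, c A = 0 → g A = 0) →
      ∑ A ∈ coeffSupport U c, g A = ∑ A ∈ U.powerset, g A := fun g hg =>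
    Finset.sum_filter_of_ne fun A _ hA hc => hA (hg A hc)
  rw [sum_eq]
  · refine Finset.sum_congr rfl fun A _ => sum_eq _ fun B hB => ?_
    rw [hB, zero_pow two_ne_zero, mul_zero, ite_self]
  · refine fun A hA => Finset.sum_eq_zero fun B _ => ?_
    rw [hA, zero_pow two_ne_zero, zero_mul, ite_self]

lemma sharpSum_tupleCoeff_le (hK : IsSymmetricOffDiagonal K) (hfin : weightPow b q K ≠ ∞) (n : ℕ) :
    sharpSum (coeffSupport (Finset.range n) (tupleCoeff b K s)) (tupleCoeff b K s)
      ≤ (s ^ 2 / q.factorial) ^ 2 * (weightPowPair b q).real (sharp K) := by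
  set 𝒦 := coeffSupport (Finset.range n) (tupleCoeff b K s)
  have filter_subset : ↑((truncate K n ×ˢ truncate K n).filter fun p =>
      IsSharpPair 𝒦 (entries p.1, entries p.2)) ⊆ sharp K := fun p hp => by
    obtain ⟨hp, hsharp⟩ := Finset.mem_filter.1 hp
    obtain ⟨h₁, h₂⟩ := Finset.mem_product.1 hp
    exact mem_sharp_of_isSharpPair (mem_truncate.1 h₁).1 (mem_truncate.1 h₂).1 hsharp
  calc sharpSum 𝒦 (tupleCoeff b K s)
      = s ^ 2 / q.factorial * ∑ i ∈ truncate K n, tupleWeight b i * (s ^ 2 / q.factorial *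
          ∑ j ∈ truncate K n, tupleWeight b j *
            if IsSharpPair 𝒦 (entries i, entries j) then 1 else 0) := by
        simp only [sharpSum_coeffSupport, 𝒦, sum_tupleCoeff_sq_mul hK]
    _ = (s ^ 2 / q.factorial) ^ 2 * ∑ p ∈ truncate K n ×ˢ truncate K n with
          IsSharpPair 𝒦 (entries p.1, entries p.2), tupleWeight b p.1 * tupleWeight b p.2 := by
        simp only [Finset.sum_filter, Finset.sum_product, Finset.mul_sum, mul_ite, mul_one,
          mul_zero]
        refine Finset.sum_congr rfl fun i _ => Finset.sum_congr rfl fun j _ => ?_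
        split_ifs
        · ring
        · rfl
    _ ≤ _ := by
        gcongr
        exact sum_tupleWeight_mul_tupleWeight_le filter_subset (weightPowPair_sharp_ne_top hfin)

end Coefficients

/-! ### Existence of the homogeneous sum -/

/-- Independent square integrable random variables with mean `0` and variance `1`. -/
structure IsStdL2Indep {ι Ω : Type*} [MeasurableSpace Ω] (P : Measure Ω) (X : ι → Ω → ℝ) : Prop
    extends IsIndepFamily P X where
  memLp : ∀ k, MemLp (X k) 2 P
  integral_eq_zero : ∀ k, ∫ ω, X k ω ∂P = 0
  integral_sq : ∀ k, ∫ ω, X k ω ^ 2 ∂P = 1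

namespace IsStdL2Indep

variable {ι Ω : Type*} [MeasurableSpace Ω] {P : Measure Ω} {X : ι → Ω → ℝ}

variable [IsProbabilityMeasure P]

section Monomials

lemma integral_prod_mul_prod [DecidableEq ι] (hX : IsStdL2Indep P X) (A B : Finset ι) :
    ∫ ω, (∏ k ∈ A, X k ω) * ∏ k ∈ B, X k ω ∂P = if A = B then 1 else 0 := by
  set n : ι → ℕ := fun k => (if k ∈ A then 1 else 0) + if k ∈ B then 1 else 0 with n_def
  have prod_eq : ∀ ω, (∏ k ∈ A, X k ω) * ∏ k ∈ B, X k ω = ∏ k ∈ A ∪ B, X k ω ^ n k := fun ω => by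
    simp only [n_def, pow_add, Finset.prod_mul_distrib, pow_ite, pow_one, pow_zero,
      Finset.prod_ite_mem, Finset.inter_eq_right.2 Finset.subset_union_left,
      Finset.inter_eq_right.2 Finset.subset_union_right]
  have integrable : ∀ k, Integrable (fun ω => X k ω ^ n k) P := fun k => by
    have h₁ := (hX.memLp k).integrable one_le_two
    have h₂ := (hX.memLp k).integrable_sq
    simp only [n_def]
    split_ifs <;> simp [h₁, h₂]
  have integral_eq : ∀ k ∈ A ∪ B, ∫ ω, X k ω ^ n k ∂P = if k ∈ A ↔ k ∈ B then 1 else 0 :=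
    fun k hk => by
      have := hX.integral_eq_zero k
      have := hX.integral_sq k
      by_cases hA : k ∈ A <;> by_cases hB : k ∈ B <;> simp_all
  simp only [prod_eq]
  rw [(hX.integrable_prod_comp (A ∪ B) (g := fun k x => x ^ n k)
    (fun k => measurable_id.pow_const _) integrable).2, Finset.prod_congr rfl integral_eq,
    Finset.prod_ite_zero, Finset.prod_const_one]
  refine if_congr ?_ rfl rfl
  rw [Finset.ext_iff]
  refine forall_congr' fun k => ?_
  rw [Finset.mem_union]
  tauto

variable {q : ℕ} {b : ι → ℝ} {i j : Fin q → ι}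

lemma memLp_prod (hX : IsStdL2Indep P X) (hi : Function.Injective i) :
    MemLp (fun ω => ∏ k, b (i k) * X (i k) ω) 2 P := by
  classical
  have measurable : Measurable fun ω => ∏ k, b (i k) * X (i k) ω :=
    Finset.measurable_fun_prod _ fun k _ => (hX.measurable (i k)).const_mul _
  rw [memLp_two_iff_integrable_sq measurable.aestronglyMeasurable]
  have h := (hX.integrable_prod_comp (entries i) (g := fun k x => (b k * x) ^ 2)
    (fun k => (measurable_id.const_mul _).pow_const 2) fun k => by
      simpa only [mul_pow] using (hX.memLp k).integrable_sq.const_mul _).1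
  simpa only [prod_entries hi, Finset.prod_pow] using h

lemma integral_prod_mul_prod_tuple [DecidableEq ι] (hX : IsStdL2Indep P X)
    (hi : Function.Injective i) (hj : Function.Injective j) :
    ∫ ω, (∏ k, b (i k) * X (i k) ω) * ∏ k, b (j k) * X (j k) ω ∂P
      = if entries i = entries j then ∏ k, b (i k) ^ 2 else 0 := by
  have prod_eq : ∀ ω, (∏ k, b (i k) * X (i k) ω) * ∏ k, b (j k) * X (j k) ω
      = (∏ k ∈ entries i, b k) * (∏ k ∈ entries j, b k)
        * ((∏ k ∈ entries i, X k ω) * ∏ k ∈ entries j, X k ω) := fun ω => by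
    rw [← prod_entries hi fun k => b k * X k ω, ← prod_entries hj fun k => b k * X k ω,
      Finset.prod_mul_distrib, Finset.prod_mul_distrib, mul_mul_mul_comm]
  simp only [prod_eq]
  rw [integral_const_mul, hX.integral_prod_mul_prod]
  split_ifs with h
  · rw [← h, mul_one, ← sq, prod_entries hi, Finset.prod_pow]
  · rw [mul_zero]

end Monomials

section Series

variable {X : ℕ → Ω → ℝ} {b : ℕ → ℝ} {q : ℕ} {K : Set (Fin q → ℕ)}

/-- The terms of the homogeneous sum, as elements of `L²`. -/
noncomputable def term (hX : IsStdL2Indep P X) (b : ℕ → ℝ) (hK : IsSymmetricOffDiagonal K)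
    (i : K) : Lp ℝ 2 P :=
  (hX.memLp_prod (b := b) (hK.injective i.1 i.2)).toLp

lemma coeFn_term (hX : IsStdL2Indep P X) (hK : IsSymmetricOffDiagonal K) (i : K) :
    hX.term b hK i =ᵐ[P] fun ω => ∏ k, b (i.1 k) * X (i.1 k) ω :=
  (hX.memLp_prod (hK.injective i.1 i.2)).coeFn_toLp

lemma coeFn_sum_term (hX : IsStdL2Indep P X) (hK : IsSymmetricOffDiagonal K) (F : Finset K) :
    ⇑(∑ i ∈ F, hX.term b hK i) =ᵐ[P] fun ω => ∑ i ∈ F, ∏ k, b (i.1 k) * X (i.1 k) ω := by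
  have coeFn_terms : ∀ᵐ ω ∂P, ∀ i : K, hX.term b hK i ω = ∏ k, b (i.1 k) * X (i.1 k) ω :=
    ae_all_iff.2 fun i => hX.coeFn_term hK i
  filter_upwards [Lp.coeFn_finsetSum F (hX.term b hK), coeFn_terms] with ω h_sum h_terms
  rw [h_sum, Finset.sum_apply]
  exact Finset.sum_congr rfl fun i _ => h_terms i

lemma inner_term (hX : IsStdL2Indep P X) (hK : IsSymmetricOffDiagonal K) (i j : K) :
    inner ℝ (hX.term b hK i) (hX.term b hK j)
      = if entries j.1 = entries i.1 then tupleWeight b i.1 else 0 := by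
  have integral_eq := hX.integral_prod_mul_prod_tuple (b := b) (hK.injective i.1 i.2)
    (hK.injective j.1 j.2)
  rw [L2.inner_def]
  simp only [eq_comm (a := entries j.1), tupleWeight, ← integral_eq]
  refine integral_congr_ae ?_
  filter_upwards [hX.coeFn_term (b := b) hK i, hX.coeFn_term (b := b) hK j] with ω hi hj
  rw [hi, hj, RCLike.inner_apply', conj_trivial]

lemma norm_sum_term_sq_le (hX : IsStdL2Indep P X) (hK : IsSymmetricOffDiagonal K) (F : Finset K) :
    ‖∑ i ∈ F, hX.term b hK i‖ ^ 2 ≤ q.factorial * ∑ i ∈ F, tupleWeight b i.1 := by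
  have card_le : ∀ i : K, (F.filter fun j => entries j.1 = entries i.1).card ≤ q.factorial :=
    fun i => by
      have h := card_filter_entries_eq_le (F := F.map (Function.Embedding.subtype _))
        (fun j hj => by
          obtain ⟨j, -, rfl⟩ := Finset.mem_map.1 hj
          exact hK.injective j.1 j.2) (hK.injective i.1 i.2)
      rwa [Finset.filter_map, Finset.card_map] at h
  rw [← real_inner_self_eq_norm_sq, sum_inner, Finset.mul_sum]
  refine Finset.sum_le_sum fun i _ => ?_
  simp only [inner_sum, hX.inner_term hK]
  rw [← Finset.sum_filter, Finset.sum_const, nsmul_eq_mul]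
  exact mul_le_mul_of_nonneg_right (Nat.cast_le.2 (card_le i)) (tupleWeight_nonneg b i.1)

lemma summable_term (hX : IsStdL2Indep P X) (hK : IsSymmetricOffDiagonal K)
    (hfin : weightPow b q K ≠ ∞) : Summable (hX.term b hK) := by
  have summable_weight := (hasSum_tupleWeight hfin).summable
  rw [summable_iff_vanishing_norm] at summable_weight ⊢
  intro ε hε
  have factorial_pos : (0 : ℝ) < q.factorial := Nat.cast_pos.2 q.factorial_pos
  obtain ⟨F, hF⟩ := summable_weight (ε ^ 2 / q.factorial) (by positivity)
  refine ⟨F, fun G hG => lt_of_pow_lt_pow_left₀ 2 hε.le ?_⟩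
  calc ‖∑ i ∈ G, hX.term b hK i‖ ^ 2 ≤ q.factorial * ∑ i ∈ G, tupleWeight b i.1 :=
        hX.norm_sum_term_sq_le hK G
    _ < ε ^ 2 := (lt_div_iff₀' factorial_pos).1 ((le_abs_self _).trans_lt (hF G hG))

lemma exists_isHomogeneousSum (hX : IsStdL2Indep P X) (hK : IsSymmetricOffDiagonal K)
    (hfin : weightPow b q K ≠ ∞) : ∃ S : Ω → ℝ, IsHomogeneousSum P X b K S := by
  obtain ⟨T, hT⟩ := hX.summable_term hK hfin
  set t := normFactor P X b K
  have tendsto : Tendsto (fun F : Finset K => t • ∑ i ∈ F, hX.term b hK i) atTop (𝓝 (t • T)) :=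
    Filter.Tendsto.const_smul hT t
  rw [Lp.tendsto_Lp_iff_tendsto_eLpNorm'] at tendsto
  refine ⟨⇑(t • T), Lp.memLp _, tendsto.congr fun F => ?_⟩
  rw [eLpNorm_sub_comm]
  refine eLpNorm_congr_ae ?_
  filter_upwards [hX.coeFn_sum_term (b := b) hK F, Lp.coeFn_smul t (∑ i ∈ F, hX.term b hK i)]
    with ω h_sum h_smul
  rw [Pi.sub_apply, h_smul, Pi.smul_apply, h_sum, smul_eq_mul]

end Series

end IsStdL2Indep

end TupleCoefficients

/-! ### The normal approximation bound for infinite sums -/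

section InfiniteSums

variable {Ω : Type*} [MeasurableSpace Ω] {P : Measure Ω}

lemma tendsto_integral_comp_of_tendsto_eLpNorm [IsProbabilityMeasure P] {h : ℝ → ℝ}
    (hh : LipschitzWith 1 h) {S : Ω → ℝ} (hS : MemLp S 2 P) {F : ℕ → Ω → ℝ}
    (hF : ∀ n, MemLp (F n) 2 P) (hlim : Tendsto (fun n => eLpNorm (S - F n) 2 P) atTop (𝓝 0)) :
    Tendsto (fun n => ∫ ω, h (F n ω) ∂P) atTop (𝓝 (∫ ω, h (S ω) ∂P)) := by
  have integrable_comp : ∀ {f}, MemLp f 2 P → Integrable (fun ω => h (f ω)) P := fun hf =>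
    integrable_comp_of_lipschitz hh (hf.integrable one_le_two)
  refine tendsto_integral_of_L1' _ (integrable_comp hS).aestronglyMeasurable
    (Eventually.of_forall fun n => integrable_comp (hF n))
    (tendsto_of_tendsto_of_tendsto_of_le_of_le tendsto_const_nhds hlim
      (fun _ => zero_le) fun n => ?_)
  calc eLpNorm ((fun ω => h (F n ω)) - fun ω => h (S ω)) 1 P
      ≤ eLpNorm (F n - S) 1 P := eLpNorm_mono fun ω => abs_sub_le_of_lipschitz hh _ _
    _ ≤ eLpNorm (F n - S) 2 P :=
        eLpNorm_le_eLpNorm_of_exponent_le one_le_two ((hF n).sub hS).aestronglyMeasurable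
    _ = eLpNorm (S - F n) 2 P := eLpNorm_sub_comm _ _ _ _

section NormalizedCoeff

variable {b : ℕ → ℝ} {q : ℕ} {K : Set (Fin q → ℕ)}

/-- The coefficients, collected by sets of entries, of the homogeneous sum over `K` in
standardized variables. -/
noncomputable def normalizedCoeff (b : ℕ → ℝ) (K : Set (Fin q → ℕ)) : Finset ℕ → ℝ :=
  tupleCoeff b K √(q.factorial / (weightPow b q).real K)

lemma sq_sqrt_factorial_div (b : ℕ → ℝ) (K : Set (Fin q → ℕ)) :
    √(q.factorial / (weightPow b q).real K) ^ 2 / q.factorial = ((weightPow b q).real K)⁻¹ := by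
  rw [Real.sq_sqrt (by positivity), div_div_cancel_left' (Nat.cast_ne_zero.2 q.factorial_ne_zero)]

lemma sum_normalizedCoeff_sq (hK : IsSymmetricOffDiagonal K) (n : ℕ) :
    ∑ A ∈ (Finset.range n).powerset, normalizedCoeff b K A ^ 2
      = ((weightPow b q).real K)⁻¹ * ∑ i ∈ truncate K n, tupleWeight b i := by
  simp only [normalizedCoeff, sum_tupleCoeff_sq hK, sq_sqrt_factorial_div]

lemma sum_normalizedCoeff_sq_le_one (hK : IsSymmetricOffDiagonal K) (hfin : weightPow b q K ≠ ∞)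
    (n : ℕ) : ∑ A ∈ (Finset.range n).powerset, normalizedCoeff b K A ^ 2 ≤ 1 := by
  rw [sum_normalizedCoeff_sq hK]
  exact inv_mul_le_one_of_le₀ (sum_tupleWeight_le (fun i hi => (mem_truncate.1 hi).1) hfin)
    measureReal_nonneg

lemma tendsto_sum_normalizedCoeff_sq (hK : IsSymmetricOffDiagonal K) (h0 : weightPow b q K ≠ 0)
    (hfin : weightPow b q K ≠ ∞) :
    Tendsto (fun n => ∑ A ∈ (Finset.range n).powerset, normalizedCoeff b K A ^ 2) atTop (𝓝 1) := by
  simp only [sum_normalizedCoeff_sq hK]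
  have h := (tendsto_sum_truncate hfin).const_mul ((weightPow b q).real K)⁻¹
  rwa [inv_mul_cancel₀ ((measureReal_ne_zero_iff hfin).2 h0)] at h

lemma influence_normalizedCoeff_le (hK : IsSymmetricOffDiagonal K) (hfin : weightPow b q K ≠ ∞)
    (n j : ℕ) : influence (Finset.range n) (normalizedCoeff b K) j
      ≤ (weightPow b q).real (star K j) / (weightPow b q).real K := by
  refine (influence_tupleCoeff_le hK hfin n j).trans_eq ?_
  rw [sq_sqrt_factorial_div, inv_mul_eq_div]

lemma sqrt_sharpSum_normalizedCoeff_le (hK : IsSymmetricOffDiagonal K)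
    (hfin : weightPow b q K ≠ ∞) (n : ℕ) :
    √(sharpSum (coeffSupport (Finset.range n) (normalizedCoeff b K)) (normalizedCoeff b K))
      ≤ √((weightPowPair b q).real (sharp K)) / (weightPow b q).real K := by
  refine (Real.sqrt_le_sqrt (sharpSum_tupleCoeff_le hK hfin n)).trans_eq ?_
  rw [sq_sqrt_factorial_div, Real.sqrt_mul (sq_nonneg _), Real.sqrt_sq (by positivity),
    inv_mul_eq_div]

lemma mpoly_normalizedCoeff (hK : IsSymmetricOffDiagonal K) {X : ℕ → Ω → ℝ}
    (hX : ∫ ω, X 1 ω ^ 2 ∂P = 1) (n : ℕ) (ω : Ω) :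
    mpoly X (Finset.range n) (normalizedCoeff b K) ω
      = normFactor P X b K * ∑ i ∈ truncate K n, ∏ k, b (i k) * X (i k) ω := by
  have factor_eq : √(q.factorial / (weightPow b q).real K) / q.factorial = normFactor P X b K := by
    rw [normFactor, hX, one_pow, mul_one, ← measureReal_def, Real.sqrt_mul (Nat.cast_nonneg _),
      Real.sqrt_div (Nat.cast_nonneg _), div_right_comm, Real.sqrt_div_self', div_div]
  rw [normalizedCoeff, mpoly_tupleCoeff hK, factor_eq]

lemma IsHomogeneousSum.tendsto_eLpNorm_sub_mpoly (hK : IsSymmetricOffDiagonal K) {X : ℕ → Ω → ℝ}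
    (hX : ∫ ω, X 1 ω ^ 2 ∂P = 1) {S : Ω → ℝ} (hS : IsHomogeneousSum P X b K S) :
    Tendsto (fun n => eLpNorm (S - mpoly X (Finset.range n) (normalizedCoeff b K)) 2 P) atTop
      (𝓝 0) := by
  classical
  refine (hS.2.comp (tendsto_truncate_subtype K)).congr fun n => congrArg (eLpNorm · 2 P) ?_
  funext ω
  rw [Pi.sub_apply, mpoly_normalizedCoeff hK hX,
    Finset.sum_subtype_of_mem (fun i => ∏ k, b (i k) * X (i k) ω) fun i hi => (mem_truncate.1 hi).1]

lemma IsStdIndep.abs_integral_sub_integral_gaussian_le_of_isHomogeneousSum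
    [IsProbabilityMeasure P] {X : ℕ → Ω → ℝ} {M : ℝ} (hX : IsStdIndep P X M) {h : ℝ → ℝ}
    (hh : LipschitzWith 1 h) (hq : 1 ≤ q) (hK : IsSymmetricOffDiagonal K)
    (h0 : weightPow b q K ≠ 0) (hfin : weightPow b q K ≠ ∞) {τ : ℝ} (hτ : 0 < τ)
    (hinf : ∀ j, (weightPow b q).real (star K j) / (weightPow b q).real K ≤ τ)
    {S : Ω → ℝ} (hS : IsHomogeneousSum P X b K S) :
    |∫ ω, h (S ω) ∂P - ∫ x, h x ∂gaussianReal 0 1| ≤ cltConst q * M ^ q *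
      (√((weightPowPair b q).real (sharp K)) / (weightPow b q).real K + √τ) := by
  set B := cltConst q * M ^ q *
    (√((weightPowPair b q).real (sharp K)) / (weightPow b q).real K + √τ)
  set c := normalizedCoeff b K
  set F : ℕ → Ω → ℝ := fun n => mpoly X (Finset.range n) c
  have memLp_F : ∀ n, MemLp (F n) 2 P := fun n =>
    (memLp_two_iff_integrable_sq (hX.measurable_mpoly _ _).aestronglyMeasurable).2
      (hX.integrable_mpoly_pow _ _ (by decide))
  have partial_sum_bound : ∀ n, |∫ ω, h (F n ω) ∂P - ∫ x, h x ∂gaussianReal 0 1|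
      ≤ 6 * q * (1 - ∑ A ∈ (Finset.range n).powerset, c A ^ 2) + B := fun n => by
    have hC := cltConst_pos q
    have hM := hX.one_le
    refine (hX.abs_integral_sub_integral_gaussian_le_of_isProductType hM hh hq
      (fun A _ hA => card_eq_of_tupleCoeff_ne_zero hK hA) (isProductType_tupleCoeff b K _) hτ
      (fun j _ => (influence_normalizedCoeff_le hK hfin n j).trans (hinf j))
      (sum_normalizedCoeff_sq_le_one hK hfin n)).trans ?_
    exact add_le_add le_rfl (mul_le_mul_of_nonneg_left
      (add_le_add (sqrt_sharpSum_normalizedCoeff_le hK hfin n) le_rfl) (by positivity))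
  have tendsto_bound : Tendsto
      (fun n => 6 * q * (1 - ∑ A ∈ (Finset.range n).powerset, c A ^ 2) + B) atTop (𝓝 B) := by
    simpa using (((tendsto_sum_normalizedCoeff_sq hK h0 hfin).const_sub 1).const_mul
      (6 * (q : ℝ))).add_const B
  exact le_of_tendsto_of_tendsto' ((tendsto_integral_comp_of_tendsto_eLpNorm hh hS.1 memLp_F
    (hS.tendsto_eLpNorm_sub_mpoly hK (hX.integral_sq 1))).sub_const _).abs tendsto_bound
    partial_sum_bound

end NormalizedCoeff

end InfiniteSums

section IdenticalVariance

variable {Ω : Type*} [MeasurableSpace Ω] {P : Measure Ω}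

lemma ofReal_sqrt_toReal {a : ℝ≥0∞} (ha : a ≠ ∞) : ENNReal.ofReal √a.toReal = a ^ (1 / 2 : ℝ) := by
  rw [Real.sqrt_eq_rpow, ENNReal.toReal_rpow,
    ENNReal.ofReal_toReal (ENNReal.rpow_ne_top_of_nonneg (by positivity) ha)]

namespace IsStdL2Indep

lemma isStdIndep {ι : Type*} {X : ι → Ω → ℝ} (hX : IsStdL2Indep P X)
    (h4 : ⨆ k, ∫⁻ ω, ‖X k ω‖ₑ ^ 4 ∂P ≠ ∞) :
    IsStdIndep P X (⨆ k, ∫⁻ ω, ‖X k ω‖ₑ ^ 4 ∂P).toReal := by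
  have lintegral_le : ∀ k, ∫⁻ ω, ‖X k ω ^ 4‖ₑ ∂P ≤ ⨆ k, ∫⁻ ω, ‖X k ω‖ₑ ^ 4 ∂P := fun k => by
    simp only [enorm_pow]
    exact le_iSup (fun k => ∫⁻ ω, ‖X k ω‖ₑ ^ 4 ∂P) k
  have integrable : ∀ k, Integrable (fun ω => X k ω ^ 4) P := fun k =>
    ⟨((hX.measurable k).pow_const 4).aestronglyMeasurable,
      (lintegral_le k).trans_lt (lt_top_iff_ne_top.2 h4)⟩
  refine ⟨hX.toIsIndepFamily, integrable, hX.integral_eq_zero, hX.integral_sq, fun k => ?_⟩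
  calc ∫ ω, X k ω ^ 4 ∂P = ∫ ω, ‖X k ω ^ 4‖ ∂P :=
        integral_congr_ae (ae_of_all _ fun ω => (Real.norm_of_nonneg (by positivity)).symm)
    _ = (∫⁻ ω, ‖X k ω ^ 4‖ₑ ∂P).toReal :=
        integral_norm_eq_lintegral_enorm (integrable k).aestronglyMeasurable
    _ ≤ _ := ENNReal.toReal_mono h4 (lintegral_le k)

lemma lintegral_enorm_sq {ι : Type*} {X : ι → Ω → ℝ} (hX : IsStdL2Indep P X) (k : ι) :
    ∫⁻ ω, ‖X k ω‖ₑ ^ 2 ∂P = 1 := by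
  have h := ofReal_integral_eq_lintegral_ofReal (hX.memLp k).integrable_sq
    (ae_of_all _ fun ω => sq_nonneg _)
  simp only [hX.integral_sq, ENNReal.ofReal_one, ← Real.enorm_of_nonneg (sq_nonneg _),
    enorm_pow] at h
  exact h.symm

variable [IsProbabilityMeasure P] {X : ℕ → Ω → ℝ} {b : ℕ → ℝ} {q : ℕ} {K : Set (Fin q → ℕ)}

lemma wassersteinDist_le (hX : IsStdL2Indep P X) (hq : 1 ≤ q) (hK : IsSymmetricOffDiagonal K)
    (h0 : weightPow b q K ≠ 0) (hfin : weightPow b q K ≠ ∞) {S : Ω → ℝ}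
    (hS : IsHomogeneousSum P X b K S) :
    wassersteinDist (P.map S) (gaussianReal 0 1) ≤
      ENNReal.ofReal (cltConst q) * (⨆ k, ∫⁻ ω, ‖X k ω‖ₑ ^ 4 ∂P) ^ q *
        (weightPowPair b q (sharp K) ^ (1 / 2 : ℝ) / weightPow b q K +
          (⨆ j, weightPow b q (star K j) / weightPow b q K) ^ (1 / 2 : ℝ)) := by
  set W := weightPow b q K
  set D := weightPowPair b q (sharp K)
  set T := ⨆ j, weightPow b q (star K j) / W
  set L := ⨆ k, ∫⁻ ω, ‖X k ω‖ₑ ^ 4 ∂P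
  have hT0 : T ≠ 0 := iSup_star_div_ne_zero hq h0 hfin
  have hT : T ≠ ∞ := ne_top_of_le_ne_top ENNReal.one_ne_top iSup_star_div_le_one
  have hC : 0 < cltConst q := cltConst_pos q
  rcases eq_or_ne L ∞ with hL | hL
  · have rpow_ne_zero : T ^ (1 / 2 : ℝ) ≠ 0 := by
      simp only [ne_eq, ENNReal.rpow_eq_zero_iff, hT0, hT, false_and, or_self, not_false_eq_true]
    rw [hL, ENNReal.top_pow (Nat.one_le_iff_ne_zero.1 hq),
      ENNReal.mul_top (ENNReal.ofReal_pos.2 hC).ne',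
      ENNReal.top_mul fun h => rpow_ne_zero (add_eq_zero.1 h).2]
    exact le_top
  have influence_le : ∀ j, (weightPow b q).real (star K j) / (weightPow b q).real K ≤ T.toReal :=
    fun j => by
      rw [measureReal_def, measureReal_def, ← ENNReal.toReal_div]
      exact ENNReal.toReal_mono hT (le_iSup (fun j => weightPow b q (star K j) / W) j)
  have sharp_eq : ENNReal.ofReal (√((weightPowPair b q).real (sharp K)) / (weightPow b q).real K)
      = D ^ (1 / 2 : ℝ) / W := by
    rw [measureReal_def, measureReal_def, ENNReal.ofReal_div_of_pos (ENNReal.toReal_pos h0 hfin),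
      ofReal_sqrt_toReal (weightPowPair_sharp_ne_top hfin), ENNReal.ofReal_toReal hfin]
  refine iSup₂_le fun h hh => ?_
  rw [integral_map hS.1.1.aemeasurable hh.continuous.aestronglyMeasurable]
  refine (ENNReal.ofReal_le_ofReal
    ((hX.isStdIndep hL).abs_integral_sub_integral_gaussian_le_of_isHomogeneousSum hh hq hK h0 hfin
      (ENNReal.toReal_pos hT0 hT) influence_le hS)).trans_eq ?_
  rw [ENNReal.ofReal_mul (by positivity), ENNReal.ofReal_mul hC.le,
    ENNReal.ofReal_pow ENNReal.toReal_nonneg, ENNReal.ofReal_toReal hL,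
    ENNReal.ofReal_add (by positivity) (Real.sqrt_nonneg _), sharp_eq, ofReal_sqrt_toReal hT]

end IsStdL2Indep

/-! ### Standardization -/

section Standardization

variable {ι : Type*} {σ : ℝ}

lemma exists_isStdL2Indep {X : ι → Ω → ℝ} (hind : iIndepFun X P) (h2 : ∀ k, MemLp (X k) 2 P)
    (hmean : ∀ k, ∫ ω, X k ω ∂P = 0) (hσ : σ ≠ 0) (hvar : ∀ k, ∫ ω, X k ω ^ 2 ∂P = σ ^ 2) :
    ∃ Y : ι → Ω → ℝ, IsStdL2Indep P Y ∧ ∀ k, X k =ᵐ[P] fun ω => σ * Y k ω := by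
  set Z : ι → Ω → ℝ := fun k => (h2 k).1.aemeasurable.mk (X k)
  have measurable_Z : ∀ k, Measurable (Z k) := fun k => (h2 k).1.aemeasurable.measurable_mk
  have ae_eq_Z : ∀ k, X k =ᵐ[P] Z k := fun k => (h2 k).1.aemeasurable.ae_eq_mk
  refine ⟨fun k ω => σ⁻¹ * Z k ω, ⟨⟨fun k => (measurable_Z k).const_mul _,
    (hind.congr ae_eq_Z).comp (fun _ x => σ⁻¹ * x) fun _ => measurable_id.const_mul _⟩,
    fun k => ((memLp_congr_ae (ae_eq_Z k)).1 (h2 k)).const_mul _, fun k => ?_, fun k => ?_⟩,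
    fun k => ?_⟩
  · rw [integral_const_mul, ← integral_congr_ae (ae_eq_Z k), hmean, mul_zero]
  · have integral_sq_Z : ∫ ω, Z k ω ^ 2 ∂P = σ ^ 2 :=
      (integral_congr_ae ((ae_eq_Z k).pow_const 2)).symm.trans (hvar k)
    simp only [mul_pow]
    rw [integral_const_mul, integral_sq_Z, inv_pow, inv_mul_cancel₀ (pow_ne_zero 2 hσ)]
  · filter_upwards [ae_eq_Z k] with ω hω
    rw [hω, mul_inv_cancel_left₀ hσ]

lemma lintegral_enorm_pow_of_ae_eq_mul {f g : Ω → ℝ} (hfg : f =ᵐ[P] fun ω => σ * g ω) (n : ℕ) :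
    ∫⁻ ω, ‖f ω‖ₑ ^ n ∂P = ‖σ‖ₑ ^ n * ∫⁻ ω, ‖g ω‖ₑ ^ n ∂P := by
  rw [← lintegral_const_mul' _ _ (ENNReal.pow_ne_top enorm_ne_top)]
  refine lintegral_congr_ae ?_
  filter_upwards [hfg] with ω hω
  rw [hω, enorm_mul, mul_pow]

lemma iSup_lintegral_pow_four_div_of_ae_eq_mul {X Y : ℕ → Ω → ℝ} (hY : IsStdL2Indep P Y)
    (hσ : σ ≠ 0) (hXY : ∀ k, X k =ᵐ[P] fun ω => σ * Y k ω) :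
    (⨆ k, ∫⁻ ω, ‖X k ω‖ₑ ^ 4 ∂P) / (∫⁻ ω, ‖X 1 ω‖ₑ ^ 2 ∂P) ^ 2
      = ⨆ k, ∫⁻ ω, ‖Y k ω‖ₑ ^ 4 ∂P := by
  simp only [lintegral_enorm_pow_of_ae_eq_mul (hXY _), hY.lintegral_enorm_sq, mul_one, ← pow_mul,
    ← ENNReal.mul_iSup]
  rw [mul_comm]
  exact ENNReal.mul_div_cancel_right (pow_ne_zero 4 (enorm_ne_zero.2 hσ))
    (ENNReal.pow_ne_top enorm_ne_top)

variable {X Y : ℕ → Ω → ℝ} {q : ℕ} {K : Set (Fin q → ℕ)} {b : ℕ → ℝ}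

lemma normFactor_mul_pow_of_ae_eq_mul (hσ : 0 < σ) (hXY : X 1 =ᵐ[P] fun ω => σ * Y 1 ω)
    (b : ℕ → ℝ) (K : Set (Fin q → ℕ)) :
    normFactor P X b K * σ ^ q = normFactor P Y b K := by
  have variance_eq : ∫ ω, X 1 ω ^ 2 ∂P = σ ^ 2 * ∫ ω, Y 1 ω ^ 2 ∂P := by
    simp only [← integral_const_mul, ← mul_pow]
    exact integral_congr_ae (hXY.pow_const 2)
  rw [normFactor, normFactor, variance_eq, mul_pow, pow_right_comm, mul_left_comm,
    Real.sqrt_mul (sq_nonneg _), Real.sqrt_sq (by positivity), one_div_mul_eq_div,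
    div_mul_cancel_left₀ (pow_ne_zero q hσ.ne'), one_div]

lemma isHomogeneousSum_iff_of_ae_eq_mul (hσ : 0 < σ) (hXY : ∀ k, X k =ᵐ[P] fun ω => σ * Y k ω)
    (S : Ω → ℝ) : IsHomogeneousSum P X b K S ↔ IsHomogeneousSum P Y b K S := by
  have partial_sum_eq : ∀ F : Finset K,
      (fun ω => S ω - normFactor P X b K * ∑ i ∈ F, ∏ k, b (i.1 k) * X (i.1 k) ω)
        =ᵐ[P] fun ω => S ω - normFactor P Y b K * ∑ i ∈ F, ∏ k, b (i.1 k) * Y (i.1 k) ω :=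
    fun F => by
      filter_upwards [ae_all_iff.2 hXY] with ω hω
      have prod_eq : ∀ i : Fin q → ℕ,
          ∏ k, b (i k) * X (i k) ω = σ ^ q * ∏ k, b (i k) * Y (i k) ω := fun i => by
        simp only [hω, mul_left_comm _ σ]
        rw [Finset.prod_mul_distrib, Finset.prod_const, Finset.card_univ, Fintype.card_fin]
      simp only [prod_eq]
      rw [← Finset.mul_sum, ← mul_assoc, normFactor_mul_pow_of_ae_eq_mul hσ (hXY 1)]
  simp only [IsHomogeneousSum, eLpNorm_congr_ae (partial_sum_eq _)]

end Standardization

end IdenticalVariance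

end CombCLT

theorem theorem5p4_general (q : ℕ) (hq : 1 ≤ q) :
    ∃ C : ℝ≥0, ∀ {Ω : Type*} [MeasurableSpace Ω] (P : Measure Ω) [IsProbabilityMeasure P]
      (X : ℕ → Ω → ℝ) (b : ℕ → ℝ) (K : Set (Fin q → ℕ)),
      iIndepFun X P → (∀ k, MemLp (X k) 2 P) → (∀ k, ∫ ω, X k ω ∂P = 0) →
      (∀ k, ∫ ω, X k ω ^ 2 ∂P = ∫ ω, X 1 ω ^ 2 ∂P) → ∫ ω, X 1 ω ^ 2 ∂P ≠ 0 →
      CombCLT.IsSymmetricOffDiagonal K →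
      CombCLT.weightPow b q K ≠ 0 → CombCLT.weightPow b q K ≠ ∞ →
      (∃ S : Ω → ℝ, CombCLT.IsHomogeneousSum P X b K S) ∧
      ∀ S : Ω → ℝ, CombCLT.IsHomogeneousSum P X b K S →
        CombCLT.wassersteinDist (P.map S) (gaussianReal 0 1) ≤
          C * ((⨆ k, ∫⁻ ω, ‖X k ω‖ₑ ^ 4 ∂P) / (∫⁻ ω, ‖X 1 ω‖ₑ ^ 2 ∂P) ^ 2) ^ q *
            (CombCLT.weightPowPair b q (CombCLT.sharp K) ^ (1 / 2 : ℝ) / CombCLT.weightPow b q K +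
              (⨆ j : ℕ, CombCLT.weightPow b q (CombCLT.star K j) /
                CombCLT.weightPow b q K) ^ (1 / 2 : ℝ)) := by
  refine ⟨(CombCLT.cltConst q).toNNReal, fun P _ X b K hind h2 hmean hvar hvar0 hK h0 hfin => ?_⟩
  have variance_pos : 0 < ∫ ω, X 1 ω ^ 2 ∂P :=
    (integral_nonneg fun ω => sq_nonneg (X 1 ω)).lt_of_ne' hvar0
  set σ := √(∫ ω, X 1 ω ^ 2 ∂P)
  have hσ : 0 < σ := Real.sqrt_pos.2 variance_pos
  obtain ⟨Y, hY, hXY⟩ := CombCLT.exists_isStdL2Indep hind h2 hmean hσ.ne' fun k =>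
    (hvar k).trans (Real.sq_sqrt variance_pos.le).symm
  simp only [CombCLT.isHomogeneousSum_iff_of_ae_eq_mul hσ hXY,
    CombCLT.iSup_lintegral_pow_four_div_of_ae_eq_mul hY hσ.ne' hXY]
  exact ⟨hY.exists_isHomogeneousSum hK hfin, fun S hS => hY.wassersteinDist_le hq hK h0 hfin hS⟩

theorem theorem5p4 (q : ℕ) (hq : 1 ≤ q) :
    ∃ C : ℝ≥0, ∀ {Ω : Type*} [MeasurableSpace Ω] (P : Measure Ω) [IsProbabilityMeasure P]
      (X : ℕ → Ω → ℝ) (b : ℕ → ℝ) (K : Set (Fin q → ℕ)),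
      iIndepFun X P → (∀ k, IdentDistrib (X k) (X 1) P P) →
      MemLp (X 1) 2 P → ∫ ω, X 1 ω ∂P = 0 → ∫ ω, X 1 ω ^ 2 ∂P ≠ 0 →
      CombCLT.IsSymmetricOffDiagonal K →
      CombCLT.weightPow b q K ≠ 0 → CombCLT.weightPow b q K ≠ ∞ →
      (∃ S : Ω → ℝ, CombCLT.IsHomogeneousSum P X b K S) ∧
      ∀ S : Ω → ℝ, CombCLT.IsHomogeneousSum P X b K S →
        CombCLT.wassersteinDist (P.map S) (gaussianReal 0 1) ≤
          C * ((∫⁻ ω, ‖X 1 ω‖ₑ ^ 4 ∂P) / (∫⁻ ω, ‖X 1 ω‖ₑ ^ 2 ∂P) ^ 2) ^ q *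
            (CombCLT.weightPowPair b q (CombCLT.sharp K) ^ (1 / 2 : ℝ) / CombCLT.weightPow b q K +
              (⨆ j : ℕ, CombCLT.weightPow b q (CombCLT.star K j) /
                CombCLT.weightPow b q K) ^ (1 / 4 : ℝ)) := by
  obtain ⟨C, hC⟩ := theorem5p4_general q hq
  refine ⟨C, fun P _ X b K hind hid h2 hmean hvar hK h0 hfin => ?_⟩
  obtain ⟨hex, hbound⟩ := hC P X b K hind (fun k => (hid k).symm.memLp_snd h2)
    (fun k => (hid k).integral_eq.trans hmean)
    (fun k => ((hid k).comp (measurable_id.pow_const 2)).integral_eq) hvar hK h0 hfin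
  have lintegral_eq : ∀ k, ∫⁻ ω, ‖X k ω‖ₑ ^ 4 ∂P = ∫⁻ ω, ‖X 1 ω‖ₑ ^ 4 ∂P := fun k =>
    ((hid k).comp (measurable_enorm.pow_const 4)).lintegral_eq
  simp only [lintegral_eq, ciSup_const] at hbound
  refine ⟨hex, fun S hS => (hbound S hS).trans ?_⟩
  gcongr _ * (_ + ?_)
  exact ENNReal.rpow_le_rpow_of_exponent_ge CombCLT.iSup_star_div_le_one (by norm_num)
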